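/- Let $p$ be a prime, let $S$ be a finite $p$-group, and let $\mathcal F$ be a saturated fusion system on $S$. Let $$O^p_{\mathcal F}(S)=\langle [P,O^p(\mathrm{Aut}_{\mathcal F}(P))] \mid P\le S\rangle$$ be its hyperfocal subgroup, where $[P,A]=\langle x^{-1}\alpha(x)\mid x\in P,\ \alpha\in A\rangle$ and $O^p(A)$ denotes the smallest normal subgroup of $p$-power index of a finite group $A$. Let $N$ be a normal subgroup of $S$ containing $O^p_{\mathcal F}(S)$. A fusion subsystem $\mathcal H$ of $\mathcal F$ on a subgroup $T\le S$ is said to have $p$-power index if $O^p_{\mathcal F}(S)\le T$ and $O^p(\mathrm{Aut}_{\mathcal F}(P))\le \mathrm{Aut}_{\mathcal H}(P)$ for all $P\le T$. A subgroup $T \le S$ is strongly $\mathcal F$-closed if $\varphi(P)\le T$ for every $P\le T$ and every $\varphi\in\mathrm{Hom}_{\mathcal F}(P,S)$. A fusion subsystem $\mathcal H$ of $\mathcal F$ on $T$ is $\mathcal F$-invariant if $T$ is strongly $\mathcal F$-closed and, for every isomorphism $\varphi\colon Q\to P$ in $\mathcal F$ and all subgroups $U,V\le Q\cap T$, $$\varphi\circ\mathrm{Hom}_{\mathcal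 H}(U,V)\circ\varphi^{-1}\subseteq \mathrm{Hom}_{\mathcal H}(\varphi(U),\varphi(V)).$$ Then: 1. $N$ is strongly $\mathcal F$-closed; 2. there is exactly one saturated fusion subsystem $\mathcal F_N$ of $\mathcal F$ on $N$ of $p$-power index, and $\mathcal F_N$ is $\mathcal F$-invariant. -/

import Mathlib

/-- A fusion system on the subgroup `T` of an ambient group `G` (the whole group is the case `T = ⊤`).
Its objects are the subgroups `P ≤ T`, and `hom P Q` is the set of morphisms from `P` to `Q`.
The sets `hom P Q` with `P` or `Q` not contained in `T` carry no information and are required to be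
empty, so that two fusion systems on `T` are equal exactly when they have the same morphisms. -/
@[ext]
structure FusionSystem {G : Type*} [Group G] (T : Subgroup G) where
  /-- The set of morphisms from `P` to `Q`. -/
  hom : (P Q : Subgroup G) → Set (P →* Q)
  le_of_mem : ∀ {P Q : Subgroup G} {φ : P →* Q}, φ ∈ hom P Q → P ≤ T ∧ Q ≤ T
  injective : ∀ {P Q : Subgroup G} {φ : P →* Q}, φ ∈ hom P Q → Function.Injective φ
  /-- All homomorphisms between subgroups of `T` induced by conjugation in `T` are morphisms. -/
  conj_mem : ∀ {P Q : Subgroup G}, P ≤ T → Q ≤ T → ∀ (φ : P →* Q) (s : G), s ∈ T →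
    (∀ x : P, (φ x : G) = s * x * s⁻¹) → φ ∈ hom P Q
  comp_mem : ∀ {P Q R : Subgroup G} {φ : P →* Q} {ψ : Q →* R},
    φ ∈ hom P Q → ψ ∈ hom Q R → ψ.comp φ ∈ hom P R
  /-- Every morphism is an isomorphism (in the fusion system) onto its image followed by an
  inclusion: if `e : P ≃* R` is the corestriction of the morphism `φ` to its image `R`, then `e` and
  its inverse are morphisms. -/
  iso_mem : ∀ {P Q R : Subgroup G} {φ : P →* Q}, φ ∈ hom P Q → ∀ e : P ≃* R,
    (∀ x : P, (e x : G) = φ x) → e.toMonoidHom ∈ hom P R ∧ e.symm.toMonoidHom ∈ hom R P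

/-- `O^p(A)`: the intersection of all normal subgroups of `A` of `p`-power index, which for a finite
group `A` is the smallest such subgroup. -/
def pResidual (p : ℕ) (A : Type*) [Group A] : Subgroup A :=
  sInf {K : Subgroup A | K.Normal ∧ ∃ n : ℕ, K.index = p ^ n}

/-- `Aut_T(P)`: the automorphisms of `P` induced by conjugation with elements of `T`. -/
def autConj {G : Type*} [Group G] (T P : Subgroup G) : Subgroup (MulAut P) where
  carrier := {α | ∃ s ∈ T, ∀ x : P, (α x : G) = s * x * s⁻¹}
  one_mem' := ⟨1, T.one_mem, fun x => by simp⟩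
  mul_mem' := by
    rintro α β ⟨s, hs, h⟩ ⟨t, ht, k⟩
    exact ⟨s * t, T.mul_mem hs ht, fun x => by simp [h, k, mul_assoc]⟩
  inv_mem' := by
    rintro α ⟨s, hs, h⟩
    refine ⟨s⁻¹, T.inv_mem hs, fun x => ?_⟩
    have := h (α⁻¹ x)
    rw [MulAut.apply_inv_self] at this
    simp [this, mul_assoc]

/-- For an isomorphism `e : P ≃* Q`, the group `N_e` of all `g ∈ N_T(P)` such that the automorphism
`e ∘ c_g ∘ e⁻¹` of `Q` is induced by conjugation with an element of `T`. -/
def extensionDomain {G : Type*} [Group G] (T : Subgroup G) {P Q : Subgroup G} (e : P ≃* Q) :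
    Subgroup G where
  carrier := {g | g ∈ T ∧ g ∈ Subgroup.normalizer (P : Set G) ∧
    ∃ h ∈ T, ∀ x y : P, (y : G) = g * x * g⁻¹ → (e y : G) = h * e x * h⁻¹}
  one_mem' := by
    refine ⟨T.one_mem, Subgroup.one_mem _, 1, T.one_mem, fun x y hxy => ?_⟩
    have : y = x := Subtype.ext (by simpa using hxy)
    simp [this]
  mul_mem' := by
    rintro a b ⟨ha, ha', h, hh, hx⟩ ⟨hb, hb', k, hk, kx⟩
    refine ⟨T.mul_mem ha hb, Subgroup.mul_mem _ ha' hb', h * k, T.mul_mem hh hk, fun x y hxy => ?_⟩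
    have hz : b * x * b⁻¹ ∈ P := (Subgroup.mem_normalizer_iff.1 hb' x).1 x.2
    rw [hx ⟨_, hz⟩ y (by simp [hxy, mul_assoc]), kx x ⟨_, hz⟩ rfl]
    simp [mul_assoc]
  inv_mem' := by
    rintro a ⟨ha, ha', h, hh, hx⟩
    refine ⟨T.inv_mem ha, Subgroup.inv_mem _ ha', h⁻¹, T.inv_mem hh, fun x y hxy => ?_⟩
    rw [hx y x (by simp [hxy, mul_assoc])]
    simp [mul_assoc]

namespace FusionSystem

/-- `Aut_F(P)`, as a subgroup of `Aut(P)`. -/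
def aut {G : Type*} [Group G] {T : Subgroup G} (F : FusionSystem T) (P : Subgroup G) (hP : P ≤ T) :
    Subgroup (MulAut P) where
  carrier := {α | α.toMonoidHom ∈ F.hom P P}
  one_mem' := F.conj_mem hP hP _ 1 T.one_mem fun x => by simp
  mul_mem' := fun {_ _} ha hb => F.comp_mem hb ha
  inv_mem' := fun {a} ha => (F.iso_mem ha a fun _ => rfl).2

/-- `O^p(Aut_F(P))`, as a subgroup of `Aut(P)`. -/
def pResidualAut {G : Type*} [Group G] {T : Subgroup G} (F : FusionSystem T) (p : ℕ)
    (P : Subgroup G) (hP : P ≤ T) : Subgroup (MulAut P) :=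
  (pResidual p (F.aut P hP)).map (F.aut P hP).subtype

/-- `P` and `Q` are isomorphic in the fusion system. -/
def Conjugate {G : Type*} [Group G] {T : Subgroup G} (F : FusionSystem T) (P Q : Subgroup G) : Prop :=
  ∃ e : P ≃* Q, e.toMonoidHom ∈ F.hom P Q

/-- `|C_T(P)|` is maximal in the isomorphism class of `P`. -/
def FullyCentralized {G : Type*} [Group G] {T : Subgroup G} (F : FusionSystem T)
    (P : Subgroup G) : Prop :=
  ∀ Q : Subgroup G, F.Conjugate P Q →
    Nat.card ↥(T ⊓ Subgroup.centralizer (Q : Set G)) ≤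
      Nat.card ↥(T ⊓ Subgroup.centralizer (P : Set G))

/-- `|N_T(P)|` is maximal in the isomorphism class of `P`. -/
def FullyNormalized {G : Type*} [Group G] {T : Subgroup G} (F : FusionSystem T)
    (P : Subgroup G) : Prop :=
  ∀ Q : Subgroup G, F.Conjugate P Q →
    Nat.card ↥(T ⊓ Subgroup.normalizer (Q : Set G)) ≤
      Nat.card ↥(T ⊓ Subgroup.normalizer (P : Set G))

/-- Saturation, for a fusion system on a finite `p`-group `T`. -/
structure Saturated {G : Type*} [Group G] {T : Subgroup G} (F : FusionSystem T) (p : ℕ) : Prop where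
  /-- A fully normalized subgroup is fully centralized. -/
  fullyCentralized : ∀ P : Subgroup G, P ≤ T → F.FullyNormalized P → F.FullyCentralized P
  /-- If `P` is fully normalized, then `Aut_T(P)` is a Sylow `p`-subgroup of `Aut_F(P)`. -/
  sylow : ∀ (P : Subgroup G) (hP : P ≤ T), F.FullyNormalized P →
    ∃ A : Sylow p (F.aut P hP), (A : Subgroup (F.aut P hP)) = (autConj T P).subgroupOf (F.aut P hP)
  /-- An isomorphism `e : P → Q` onto a fully centralized subgroup extends to a morphism
  from `N_e` to `T`. -/
  extend : ∀ (P Q : Subgroup G) (e : P ≃* Q), e.toMonoidHom ∈ F.hom P Q → F.FullyCentralized Q →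
    ∃ ψ ∈ F.hom (extensionDomain T e) T, ∀ (x : P) (y : extensionDomain T e),
      (y : G) = x → (ψ y : G) = e x

/-- The hyperfocal subgroup `O^p_F(T) = ⟨[P, O^p(Aut_F(P))] ∣ P ≤ T⟩`. -/
def hyperfocal {G : Type*} [Group G] {T : Subgroup G} (F : FusionSystem T) (p : ℕ) : Subgroup G :=
  Subgroup.closure {g | ∃ (P : Subgroup G) (hP : P ≤ T), ∃ α ∈ F.pResidualAut p P hP,
    ∃ x : P, g = (x : G)⁻¹ * α x}

/-- The subgroup `N` of `T` is strongly `F`-closed: every morphism defined on a subgroup of `N` has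
its image in `N`. -/
def StronglyClosed {G : Type*} [Group G] {T : Subgroup G} (F : FusionSystem T)
    (N : Subgroup G) : Prop :=
  N ≤ T ∧ ∀ (P Q : Subgroup G), P ≤ N → ∀ φ ∈ F.hom P Q, ∀ x : P, (φ x : G) ∈ N

/-- `H`, a fusion system on `N`, is a subsystem of `F`, a fusion system on `T`. -/
def IsSubsystem {G : Type*} [Group G] {N T : Subgroup G} (H : FusionSystem N)
    (F : FusionSystem T) : Prop :=
  N ≤ T ∧ ∀ P Q : Subgroup G, H.hom P Q ⊆ F.hom P Q

/-- `H` is a subsystem of `F` of `p`-power index: its underlying group `N` contains the hyperfocal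
subgroup of `F`, and `Aut_H(P)` contains `O^p(Aut_F(P))` for all `P ≤ N`. -/
def IsPPowerIndex {G : Type*} [Group G] {N T : Subgroup G} (H : FusionSystem N)
    (F : FusionSystem T) (p : ℕ) : Prop :=
  H.IsSubsystem F ∧ F.hyperfocal p ≤ N ∧
    ∀ (P : Subgroup G) (hN : P ≤ N) (hT : P ≤ T), F.pResidualAut p P hT ≤ H.aut P hN

/-- The subsystem `H` of `F` is `F`-invariant: its underlying group `N` is strongly `F`-closed, and
`φ ∘ Hom_H(U, V) ∘ φ⁻¹ ⊆ Hom_H(φ(U), φ(V))` for every isomorphism `φ : Q → P` in `F` and all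
`U, V ≤ Q ⊓ N`. Here `U'` and `V'` are `φ(U)` and `φ(V)`, and `χ` is `φ ∘ ψ ∘ φ⁻¹`. -/
def IsInvariant {G : Type*} [Group G] {N T : Subgroup G} (H : FusionSystem N)
    (F : FusionSystem T) : Prop :=
  H.IsSubsystem F ∧ F.StronglyClosed N ∧
    ∀ (Q P : Subgroup G) (φ : Q ≃* P), φ.toMonoidHom ∈ F.hom Q P →
    ∀ (U V : Subgroup G) (_ : U ≤ Q ⊓ N) (hV : V ≤ Q ⊓ N), ∀ ψ ∈ H.hom U V,
    ∀ U' V' : Subgroup G,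
      U' = (U.subgroupOf Q).map (P.subtype.comp φ.toMonoidHom) →
      V' = (V.subgroupOf Q).map (P.subtype.comp φ.toMonoidHom) →
    ∀ χ : U' →* V',
      (∀ (u : U') (q : Q) (hq : (q : G) ∈ U), (u : G) = φ q →
        (χ u : G) = φ ⟨ψ ⟨q, hq⟩, (hV (ψ ⟨q, hq⟩).2).1⟩) →
      χ ∈ H.hom U' V'

end FusionSystem

/-! Closure, uniqueness and invariance rest on Alperin's fusion theorem in the form
`Saturated.induction`: all morphisms of a saturated system on `T` arise by restriction, composition
and inversion from conjugations in `T` and automorphisms of order prime to `p`. Such an automorphism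
`f` multiplies `x` by the hyperfocal element `x⁻¹ f(x)`, so morphisms of `F` preserve membership in
`N`. Applied to a saturated subsystem of `p`-power index, the theorem puts it inside every other
subsystem of `p`-power index on `N`, since the latter contains all generators; this is uniqueness.
Invariance is an induction over the transporting morphism: conjugation by `T` respects the
subsystem, and a `p'`-automorphism of `P` restricts to a morphism of the subsystem on `P ⊓ N`.

Existence reduces, through a chain of subgroups each of index `p` in the previous one, to the case
`|T : N| = p`. Let `δ : T → T/N ≅ ℤ/p`. The plan is to realize `F` by conjugation in a group `Γ`
with a homomorphism `deg : Γ → ℤ/p` that restricts to a nonzero multiple of `δ` on `T`, and to take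
for `F_N` the morphisms realized in degree zero. Here `Γ` consists of the permutations of a finite
`T × T`-set `Ω` that commute with the right factor. The stabilizers in `Ω` are graphs of morphisms,
graphs with equal second projection have equally many fixed points, and the number of right orbits
is prime to `p`. By Burnside's theorem on marks, twisting the left action by a morphism gives an
isomorphic set, so each morphism is realized in `Γ`. As `F` preserves `δ`, there is `φ : Ω → ℤ/p`
with `φ((a,b)ω) = δ a - δ b + φ ω`; the degree of `e` is the transfer-like sum of `φ(eω) - φ(ω)`
over the right orbits.

The decisive point is `sum_orbitDiff_eq_zero`: the degree vanishes on the centralizer of `P` in `Γ`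
if every element of `T` centralizing an image of `P` lies in `N`. Hence a dichotomy for `P ≤ N`:
either the degree of a realizing element depends only on the morphism, or elements centralizing `P`
attain all degrees and every `F`-morphism from `P` into `N` lies in `F_N`. In both cases the
saturation axioms of `F` can be corrected to degree zero (`saturated_subsystem`).

The set `Ω` is built from the top down (`Saturated.exists_isAdmissible`): starting from a set made
from `Aut_F(T)`, orbits `(T × T)/D` are added for graphs `D` of decreasing order until the fixed
point counts agree. Congruences between marks show that the deficits are divisible by the available
increments. -/

namespace FusionSystem

/-! ### Morphisms as functions on the ambient group -/

variable {G : Type*} [Group G] {T : Subgroup G}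

/-- The function `f : G → G` restricts on `P` to a morphism of the fusion system. -/
def IsMap (F : FusionSystem T) (P : Subgroup G) (f : G → G) : Prop :=
  ∃ Q : Subgroup G, ∃ φ ∈ F.hom P Q, ∀ x : P, (φ x : G) = f x

/-- The function `f : G → G` restricts to an isomorphism from `P` onto `Q` in the fusion system. -/
def IsIso (F : FusionSystem T) (P Q : Subgroup G) (f : G → G) : Prop :=
  F.IsMap P f ∧ ∀ y, y ∈ Q ↔ ∃ x ∈ P, f x = y

variable {F : FusionSystem T} {P Q R : Subgroup G} {f g : G → G}

theorem IsMap.le (h : F.IsMap P f) : P ≤ T := by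
  obtain ⟨Q, φ, hφ, -⟩ := h
  exact (F.le_of_mem hφ).1

theorem IsMap.mem (h : F.IsMap P f) {x : G} (hx : x ∈ P) : f x ∈ T := by
  obtain ⟨Q, φ, hφ, h⟩ := h
  have := h ⟨x, hx⟩
  exact this ▸ (F.le_of_mem hφ).2 (φ ⟨x, hx⟩).2

theorem IsMap.map_mul (h : F.IsMap P f) {x y : G} (hx : x ∈ P) (hy : y ∈ P) :
    f (x * y) = f x * f y := by
  obtain ⟨Q, φ, hφ, h⟩ := h
  rw [← h ⟨x, hx⟩, ← h ⟨y, hy⟩, ← h ⟨x * y, P.mul_mem hx hy⟩, ← Subgroup.coe_mul, ← _root_.map_mul]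
  rfl

theorem IsMap.map_one (h : F.IsMap P f) : f 1 = 1 := by
  have := h.map_mul P.one_mem P.one_mem
  simpa using this

theorem IsMap.map_inv (h : F.IsMap P f) {x : G} (hx : x ∈ P) : f x⁻¹ = (f x)⁻¹ := by
  have := h.map_mul (P.inv_mem hx) hx
  rw [inv_mul_cancel, h.map_one] at this
  exact eq_inv_of_mul_eq_one_left this.symm

theorem IsMap.map_conj (h : F.IsMap P f) {x y : G} (hx : x ∈ P) (hy : y ∈ P) :
    f (x * y * x⁻¹) = f x * f y * (f x)⁻¹ := by
  rw [h.map_mul (P.mul_mem hx hy) (P.inv_mem hx), h.map_mul hx hy, h.map_inv hx]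

theorem IsMap.inj (h : F.IsMap P f) {x y : G} (hx : x ∈ P) (hy : y ∈ P) (hxy : f x = f y) :
    x = y := by
  obtain ⟨Q, φ, hφ, h⟩ := h
  have := F.injective hφ (a₁ := ⟨x, hx⟩) (a₂ := ⟨y, hy⟩) (Subtype.ext (by rw [h, h, hxy]))
  exact congrArg Subtype.val this

theorem IsMap.congr (h : F.IsMap P f) (hfg : ∀ x ∈ P, f x = g x) : F.IsMap P g := by
  obtain ⟨Q, φ, hφ, h⟩ := h
  exact ⟨Q, φ, hφ, fun x => (h x).trans (hfg x x.2)⟩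

theorem isMap_conj (F : FusionSystem T) (hP : P ≤ T) {s : G} (hs : s ∈ T) :
    F.IsMap P (fun x => s * x * s⁻¹) := by
  let φ : P →* T :=
    { toFun := fun x => ⟨s * x * s⁻¹, T.mul_mem (T.mul_mem hs (hP x.2)) (T.inv_mem hs)⟩
      map_one' := by ext; simp
      map_mul' := fun x y => by ext; simp [mul_assoc] }
  exact ⟨T, φ, F.conj_mem hP le_rfl φ s hs fun x => rfl, fun x => rfl⟩

theorem isMap_id (F : FusionSystem T) (hP : P ≤ T) : F.IsMap P id :=
  (F.isMap_conj hP T.one_mem).congr fun x _ => by simp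

theorem inclusion_mem (F : FusionSystem T) (hPQ : P ≤ Q) (hQ : Q ≤ T) :
    Subgroup.inclusion hPQ ∈ F.hom P Q :=
  F.conj_mem (hPQ.trans hQ) hQ _ 1 T.one_mem fun x => by simp

theorem IsMap.restrict (h : F.IsMap P f) (hQ : Q ≤ P) : F.IsMap Q f := by
  obtain ⟨R, φ, hφ, h⟩ := h
  exact ⟨R, φ.comp (Subgroup.inclusion hQ),
    F.comp_mem (F.inclusion_mem hQ (F.le_of_mem hφ).1) hφ, fun x => h _⟩

theorem IsIso.le (h : F.IsIso P Q f) : P ≤ T := h.1.le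

theorem IsIso.le' (h : F.IsIso P Q f) : Q ≤ T := fun y hy => by
  obtain ⟨x, hx, rfl⟩ := (h.2 y).1 hy
  exact h.1.mem hx

theorem IsIso.mem (h : F.IsIso P Q f) {x : G} (hx : x ∈ P) : f x ∈ Q := (h.2 _).2 ⟨x, hx, rfl⟩

theorem IsIso.congr (h : F.IsIso P Q f) (hfg : ∀ x ∈ P, f x = g x) : F.IsIso P Q g :=
  ⟨h.1.congr hfg, fun y => (h.2 y).trans
    ⟨fun ⟨x, hx, e⟩ => ⟨x, hx, (hfg x hx) ▸ e⟩, fun ⟨x, hx, e⟩ => ⟨x, hx, (hfg x hx).symm ▸ e⟩⟩⟩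

theorem IsMap.exists_isIso (h : F.IsMap P f) : ∃ Q, F.IsIso P Q f := by
  refine ⟨⟨⟨⟨f '' P, ?_⟩, ?_⟩, ?_⟩, h, fun y => Iff.rfl⟩
  · rintro _ _ ⟨x, hx, rfl⟩ ⟨y, hy, rfl⟩
    exact ⟨x * y, P.mul_mem hx hy, h.map_mul hx hy⟩
  · exact ⟨1, P.one_mem, h.map_one⟩
  · rintro _ ⟨x, hx, rfl⟩
    exact ⟨x⁻¹, P.inv_mem hx, h.map_inv hx⟩

/-- The isomorphism between `P` and `Q` given by `f`. -/
theorem IsIso.exists_mulEquiv (h : F.IsIso P Q f) :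
    ∃ e : P ≃* Q, e.toMonoidHom ∈ F.hom P Q ∧ ∀ x : P, (e x : G) = f x := by
  let φ : P →* Q :=
    { toFun := fun x => ⟨f x, h.mem x.2⟩
      map_one' := by ext; exact h.1.map_one
      map_mul' := fun x y => by ext; exact h.1.map_mul x.2 y.2 }
  have hφ : Function.Bijective φ := by
    constructor
    · intro x y hxy
      exact Subtype.ext (h.1.inj x.2 y.2 (congrArg Subtype.val hxy))
    · rintro ⟨y, hy⟩
      obtain ⟨x, hx, rfl⟩ := (h.2 y).1 hy
      exact ⟨⟨x, hx⟩, rfl⟩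
  have hx : ∀ x : P, ((MulEquiv.ofBijective φ hφ) x : G) = f x := fun x => rfl
  obtain ⟨R, ψ, hψ, h'⟩ := h.1
  exact ⟨MulEquiv.ofBijective φ hφ, (F.iso_mem hψ _ fun x => by rw [hx, h']).1, hx⟩

theorem isMap_of_mem {φ : P →* Q} (hφ : φ ∈ F.hom P Q) (hf : ∀ x : P, (φ x : G) = f x) :
    F.IsMap P f := ⟨Q, φ, hφ, hf⟩

theorem isIso_of_mem {e : P ≃* Q} (he : e.toMonoidHom ∈ F.hom P Q)
    (hf : ∀ x : P, (e x : G) = f x) : F.IsIso P Q f := by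
  refine ⟨⟨Q, _, he, hf⟩, fun y => ⟨fun hy => ⟨e.symm ⟨y, hy⟩, (e.symm ⟨y, hy⟩).2, ?_⟩, ?_⟩⟩
  · rw [← hf, e.apply_symm_apply]
  · rintro ⟨x, hx, rfl⟩
    rw [← hf ⟨x, hx⟩]
    exact (e ⟨x, hx⟩).2

theorem IsMap.mem_hom (h : F.IsMap P f) (hQ : Q ≤ T) {φ : P →* Q}
    (hf : ∀ x : P, (φ x : G) = f x) : φ ∈ F.hom P Q := by
  obtain ⟨R, hR⟩ := h.exists_isIso
  obtain ⟨e, he, hef⟩ := hR.exists_mulEquiv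
  have hRQ : R ≤ Q := fun y hy => by
    obtain ⟨x, hx, rfl⟩ := (hR.2 y).1 hy
    rw [← hf ⟨x, hx⟩]
    exact (φ ⟨x, hx⟩).2
  have : φ = (Subgroup.inclusion hRQ).comp e.toMonoidHom := by
    ext x
    rw [hf, ← hef]
    rfl
  rw [this]
  exact F.comp_mem he (F.inclusion_mem hRQ hQ)

/-- A hom between subgroups as a function on the ambient group. -/
theorem exists_extend (φ : P →* Q) : ∃ f : G → G, ∀ x : P, (φ x : G) = f x := by
  classical
  exact ⟨fun x => if h : x ∈ P then φ ⟨x, h⟩ else 1, fun x => by simp⟩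

theorem IsMap.comp (h : F.IsMap P f) (h' : F.IsMap Q g) (hfQ : ∀ x ∈ P, f x ∈ Q) :
    F.IsMap P (fun x => g (f x)) := by
  obtain ⟨R, hR⟩ := h.exists_isIso
  obtain ⟨e, he, hef⟩ := hR.exists_mulEquiv
  have hRQ : R ≤ Q := fun y hy => by
    obtain ⟨x, hx, rfl⟩ := (hR.2 y).1 hy
    exact hfQ x hx
  obtain ⟨Z, φ, hφ, hφg⟩ := h'.restrict hRQ
  exact ⟨Z, φ.comp e.toMonoidHom, F.comp_mem he hφ, fun x => by
    have := hφg (e x)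
    rw [hef] at this
    exact this⟩

theorem IsIso.comp (h : F.IsIso P Q f) (h' : F.IsIso Q R g) :
    F.IsIso P R (fun x => g (f x)) := by
  refine ⟨h.1.comp h'.1 fun x hx => h.mem hx, fun y => ⟨fun hy => ?_, ?_⟩⟩
  · obtain ⟨z, hz, rfl⟩ := (h'.2 y).1 hy
    obtain ⟨x, hx, rfl⟩ := (h.2 z).1 hz
    exact ⟨x, hx, rfl⟩
  · rintro ⟨x, hx, rfl⟩
    exact h'.mem (h.mem hx)

theorem IsIso.symm (h : F.IsIso P Q f) :
    ∃ g : G → G, F.IsIso Q P g ∧ (∀ x ∈ P, g (f x) = x) ∧ ∀ y ∈ Q, f (g y) = y := by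
  obtain ⟨e, he, hef⟩ := h.exists_mulEquiv
  obtain ⟨g, hg⟩ := exists_extend e.symm.toMonoidHom
  have hg' : ∀ x : Q, (e.symm x : G) = g x := hg
  refine ⟨g, isIso_of_mem (F.iso_mem he e fun _ => rfl).2 hg', fun x hx => ?_, fun y hy => ?_⟩
  · rw [← hef ⟨x, hx⟩, ← hg' (e ⟨x, hx⟩), e.symm_apply_apply]
  · rw [← hg' ⟨y, hy⟩, ← hef, e.apply_symm_apply]

theorem IsIso.conjugate (h : F.IsIso P Q f) : F.Conjugate P Q := by
  obtain ⟨e, he, -⟩ := h.exists_mulEquiv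
  exact ⟨e, he⟩

theorem Conjugate.exists_isIso (h : F.Conjugate P Q) : ∃ f, F.IsIso P Q f := by
  obtain ⟨e, he⟩ := h
  obtain ⟨f, hf⟩ := exists_extend e.toMonoidHom
  exact ⟨f, isIso_of_mem he hf⟩

theorem isIso_id (F : FusionSystem T) (hP : P ≤ T) : F.IsIso P P id :=
  ⟨F.isMap_id hP, fun y => ⟨fun hy => ⟨y, hy, rfl⟩, fun ⟨_, hx, e⟩ => e ▸ hx⟩⟩

theorem isIso_conj (F : FusionSystem T) (hP : P ≤ T) {s : G} (hs : s ∈ T) :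
    ∃ Q, F.IsIso P Q (fun x => s * x * s⁻¹) := (F.isMap_conj hP hs).exists_isIso

/-- An isomorphism preserves the property of an element to normalize the domain. -/
theorem IsIso.map_mem_normalizer [Finite G] (h : F.IsIso P Q f) (hPR : P ≤ R) (hR : F.IsMap R f)
    {x : G} (hx : x ∈ R) (hxP : x ∈ Subgroup.normalizer (P : Set G)) :
    f x ∈ Subgroup.normalizer (Q : Set G) := by
  rw [Subgroup.mem_normalizer_iff] at hxP ⊢
  have key : ∀ x ∈ R, (∀ y, y ∈ P ↔ x * y * x⁻¹ ∈ P) → ∀ y ∈ Q, f x * y * (f x)⁻¹ ∈ Q := by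
    intro x hx hxP y hy
    obtain ⟨z, hz, rfl⟩ := (h.2 y).1 hy
    rw [← hR.map_conj hx (hPR hz)]
    exact h.mem ((hxP z).1 hz)
  intro y
  refine ⟨key x hx hxP y, fun hy => ?_⟩
  have := key x⁻¹ (R.inv_mem hx) (fun y => ?_) _ hy
  · rw [hR.map_inv hx] at this
    simpa [mul_assoc] using this
  · rw [hxP (x⁻¹ * y * x⁻¹⁻¹)]
    simp [mul_assoc]

theorem IsMap.ext_hom {N : Subgroup G} {H : FusionSystem N} {K : FusionSystem N}
    (h : ∀ P f, H.IsMap P f ↔ K.IsMap P f) : H = K := by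
  have key : ∀ (H K : FusionSystem N), (∀ P f, H.IsMap P f ↔ K.IsMap P f) →
      ∀ P Q, H.hom P Q ⊆ K.hom P Q := by
    intro H K h P Q φ hφ
    obtain ⟨f, hf⟩ := exists_extend φ
    exact ((h P f).1 ⟨Q, φ, hφ, hf⟩).mem_hom (H.le_of_mem hφ).2 hf
  ext P Q φ
  exact ⟨fun a => key H K h P Q a, fun a => key K H (fun P f => (h P f).symm) P Q a⟩

theorem IsSubsystem.isMap {N : Subgroup G} {H : FusionSystem N} (h : H.IsSubsystem F)
    (hf : H.IsMap P f) : F.IsMap P f := by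
  obtain ⟨Q, φ, hφ, hf⟩ := hf
  exact ⟨Q, φ, h.2 _ _ hφ, hf⟩

theorem IsSubsystem.isIso {N : Subgroup G} {H : FusionSystem N} (h : H.IsSubsystem F)
    (hf : H.IsIso P Q f) : F.IsIso P Q f := ⟨h.isMap hf.1, hf.2⟩

theorem IsMap.exists_hom (h : F.IsMap P f) : ∃ φ ∈ F.hom P T, ∀ x : P, (φ x : G) = f x := by
  obtain ⟨Q, φ, hφ, hf⟩ := h
  exact ⟨_, F.comp_mem hφ (F.inclusion_mem (F.le_of_mem hφ).2 le_rfl), hf⟩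

end FusionSystem

/-! ### Counting with injective maps -/

section Card

variable {G : Type*} [Group G] [Finite G]

theorem Subgroup.card_le_of_injOn {A B : Subgroup G} (f : G → G) (hf : ∀ x ∈ A, f x ∈ B)
    (hinj : ∀ x ∈ A, ∀ y ∈ A, f x = f y → x = y) : Nat.card A ≤ Nat.card B :=
  Nat.card_le_card_of_injective (fun x : A => (⟨f x, hf x x.2⟩ : B)) fun x y hxy =>
    Subtype.ext (hinj x x.2 y y.2 (congrArg Subtype.val hxy))

theorem Subgroup.exists_of_card_le {A B : Subgroup G} (f : G → G) (hf : ∀ x ∈ A, f x ∈ B)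
    (hinj : ∀ x ∈ A, ∀ y ∈ A, f x = f y → x = y) (hc : Nat.card B ≤ Nat.card A) {y : G}
    (hy : y ∈ B) : ∃ x ∈ A, f x = y := by
  have hi : Function.Injective (fun x : A => (⟨f x, hf x x.2⟩ : B)) := fun x y hxy =>
    Subtype.ext (hinj x x.2 y y.2 (congrArg Subtype.val hxy))
  have hb := (Nat.bijective_iff_injective_and_card _).2
    ⟨hi, le_antisymm (Nat.card_le_card_of_injective _ hi) hc⟩
  obtain ⟨x, hx⟩ := hb.2 ⟨y, hy⟩
  exact ⟨x, x.2, congrArg Subtype.val hx⟩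

end Card

/-! ### Consequences of the saturation axioms -/

namespace FusionSystem

variable {G : Type*} [Group G] {T : Subgroup G}
variable {F : FusionSystem T} {P Q R : Subgroup G} {f g : G → G} {p : ℕ}

theorem Conjugate.trans (h : F.Conjugate P Q) (h' : F.Conjugate Q R) : F.Conjugate P R := by
  obtain ⟨f, hf⟩ := h.exists_isIso
  obtain ⟨g, hg⟩ := h'.exists_isIso
  exact (hf.comp hg).conjugate

theorem Conjugate.symm (h : F.Conjugate P Q) : F.Conjugate Q P := by
  obtain ⟨f, hf⟩ := h.exists_isIso
  obtain ⟨g, hg, -⟩ := hf.symm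
  exact hg.conjugate

theorem exists_fullyNormalized [Finite G] (F : FusionSystem T) (hP : P ≤ T) :
    ∃ Q, F.Conjugate P Q ∧ F.FullyNormalized Q := by
  obtain ⟨Q, hQ, hmax⟩ := Set.exists_max_image {Q | F.Conjugate P Q}
    (fun Q => Nat.card ↥(T ⊓ Subgroup.normalizer (Q : Set G))) (Set.toFinite _)
    ⟨P, (F.isIso_id hP).conjugate⟩
  exact ⟨Q, hQ, fun R hR => hmax R (hQ.trans hR)⟩

/-- The extension axiom for functions. -/
theorem Saturated.exists_extension (hF : F.Saturated p) {K : Subgroup G} (hf : F.IsIso P Q f)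
    (hQ : F.FullyCentralized Q) (hPK : P ≤ K) (hK : K ≤ T)
    (h : ∀ a ∈ K, a ∈ Subgroup.normalizer (P : Set G) ∧
      ∃ b ∈ T, ∀ x ∈ P, f (a * x * a⁻¹) = b * f x * b⁻¹) :
    ∃ k, F.IsMap K k ∧ ∀ x ∈ P, k x = f x := by
  obtain ⟨e, he, hef⟩ := hf.exists_mulEquiv
  obtain ⟨ψ, hψ, hx⟩ := hF.extend P Q e he hQ
  obtain ⟨k, hk⟩ := exists_extend ψ
  have hKe : K ≤ extensionDomain T e := by
    intro a ha
    obtain ⟨hn, b, hb, hab⟩ := h a ha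
    refine ⟨hK ha, hn, b, hb, fun x y hxy => ?_⟩
    rw [hef, hef, hxy]
    exact hab x x.2
  refine ⟨k, (isMap_of_mem hψ hk).restrict hKe, fun x hxP => ?_⟩
  rw [← hk ⟨x, hKe (hPK hxP)⟩, hx ⟨x, hxP⟩ ⟨x, hKe (hPK hxP)⟩ rfl, hef]

theorem mem_aut_of_isIso {hP : P ≤ T} {α : MulAut P} (h : F.IsIso P P f)
    (hα : ∀ x : P, (α x : G) = f x) : α ∈ F.aut P hP :=
  h.1.mem_hom hP hα

theorem exists_isIso_of_mem_aut {hP : P ≤ T} {α : MulAut P} (hα : α ∈ F.aut P hP) :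
    ∃ f, F.IsIso P P f ∧ ∀ x : P, (α x : G) = f x := by
  obtain ⟨f, hf⟩ := exists_extend α.toMonoidHom
  exact ⟨f, isIso_of_mem hα hf, hf⟩

theorem isPGroup_autConj (hT : IsPGroup p T) : IsPGroup p (autConj T P) := by
  rintro ⟨α, s, hs, hα⟩
  obtain ⟨k, hk⟩ := hT ⟨s, hs⟩
  have hk : s ^ p ^ k = 1 := congrArg Subtype.val hk
  have key : ∀ n : ℕ, ∀ x : P, ((α ^ n) x : G) = s ^ n * x * (s ^ n)⁻¹ := by
    intro n
    induction n with
    | zero => simp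
    | succ n ih =>
      intro x
      rw [pow_succ', MulAut.mul_apply, hα, ih, pow_succ']
      simp [mul_assoc]
  refine ⟨k, Subtype.ext (MulEquiv.ext fun x => Subtype.ext ?_)⟩
  have := key (p ^ k) x
  rw [hk] at this
  simpa using this

theorem autConj_le_aut (hP : P ≤ T) : autConj T P ≤ F.aut P hP := by
  rintro α ⟨s, hs, hα⟩
  exact F.conj_mem hP hP _ s hs hα

/-- Every `p`-subgroup of `Aut_F(P)` becomes a group of automorphisms induced by `T` after
transport to a fully normalized subgroup. -/
theorem Saturated.exists_isIso_autConj [Finite G] [Fact p.Prime] (hF : F.Saturated p)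
    (hP : P ≤ T) (hPQ : F.Conjugate P Q) (hQ : F.FullyNormalized Q) (B : Subgroup (MulAut P))
    (hB : B ≤ F.aut P hP) (hBp : IsPGroup p B) :
    ∃ f, F.IsIso P Q f ∧ ∀ β ∈ B, ∃ t ∈ T, ∀ x : P, f (β x) = t * f x * t⁻¹ := by
  obtain ⟨f, hf⟩ := hPQ.exists_isIso
  obtain ⟨e, he, hef⟩ := hf.exists_mulEquiv
  obtain ⟨A, hA⟩ := hF.sylow Q hf.le' hQ
  have he' := (F.iso_mem he e fun _ => rfl).2
  have hcongr : ∀ β ∈ B, MulAut.congr e β ∈ F.aut Q hf.le' := fun β hβ =>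
    F.comp_mem he' (F.comp_mem (hB hβ) he)
  let C : Subgroup (F.aut Q hf.le') := (B.map (MulAut.congr e).toMonoidHom).subgroupOf _
  have hC : IsPGroup p C := by
    refine IsPGroup.comap_of_injective ?_ _ Subtype.val_injective
    exact hBp.map _
  -- Sylow's theorem conjugates the transported `p`-group into the Sylow subgroup `Aut_T(Q)`; the
  -- conjugating automorphism `γ` is absorbed into the isomorphism.
  obtain ⟨A', hA'⟩ := hC.exists_le_sylow
  obtain ⟨γ, hγ⟩ := MulAction.exists_smul_eq (F.aut Q hf.le') A' A
  obtain ⟨c, hc, hcγ⟩ := exists_isIso_of_mem_aut γ.2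
  refine ⟨fun x => c (f x), hf.comp hc, fun β hβ => ?_⟩
  have h1 : (⟨MulAut.congr e β, hcongr β hβ⟩ : F.aut Q hf.le') ∈ (A' : Subgroup _) :=
    hA' ⟨β, hβ, rfl⟩
  have h2 : γ * ⟨MulAut.congr e β, hcongr β hβ⟩ * γ⁻¹ ∈ (A : Subgroup _) := by
    rw [← hγ, Sylow.coe_subgroup_smul]
    exact Subgroup.smul_mem_pointwise_smul _ (MulAut.conj γ) _ h1
  rw [hA] at h2
  obtain ⟨t, ht, h3⟩ := h2
  refine ⟨t, ht, fun x => ?_⟩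
  have h4 := h3 (γ.1 (e x))
  simp only [← hef, ← hcγ]
  rw [← h4]
  simp [MulAut.congr]

/-- A subgroup is isomorphic to each fully normalized conjugate by a morphism that extends to
its normalizer. -/
theorem Saturated.exists_map_normalizer [Finite G] [Fact p.Prime] (hT : IsPGroup p T)
    (hF : F.Saturated p) (hP : P ≤ T) (hPQ : F.Conjugate P Q) (hQ : F.FullyNormalized Q) :
    ∃ f, F.IsIso P Q f ∧ F.IsMap (T ⊓ Subgroup.normalizer (P : Set G)) f := by
  -- With `Aut_T(P)` carried into `Aut_T(Q)`, every element of `N_T(P)` meets the condition of the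
  -- extension axiom.
  obtain ⟨f, hf, h⟩ := hF.exists_isIso_autConj hP hPQ hQ (autConj T P)
    (autConj_le_aut hP) (isPGroup_autConj hT)
  obtain ⟨k, hk, hkf⟩ := hF.exists_extension (K := T ⊓ Subgroup.normalizer (P : Set G)) hf
    (hF.fullyCentralized Q hf.le' hQ) (le_inf hP Subgroup.le_normalizer) inf_le_left
    (by
      rintro a ⟨ha, haP⟩
      refine ⟨haP, ?_⟩
      obtain ⟨t, ht, h'⟩ := h (P.normalizerMonoidHom ⟨a, haP⟩) ⟨a, ha, fun x => rfl⟩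
      exact ⟨t, ht, fun x hx => h' ⟨x, hx⟩⟩)
  exact ⟨k, hf.congr fun x hx => (hkf x hx).symm, hk⟩

/-- Conjugation with an element of `T` preserves fully normalized subgroups. -/
theorem FullyNormalized.conj [Finite G] (hP : F.FullyNormalized P) {s : G} (hs : s ∈ T)
    (h : F.IsIso P Q (fun x => s * x * s⁻¹)) : F.FullyNormalized Q := by
  intro R hR
  refine (hP R (h.conjugate.trans hR)).trans ?_
  refine Subgroup.card_le_of_injOn (fun x => s * x * s⁻¹) ?_ (fun x _ y _ hxy => by simpa using hxy)
  rintro x ⟨hx, hxP⟩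
  refine ⟨T.mul_mem (T.mul_mem hs hx) (T.inv_mem hs), ?_⟩
  exact h.map_mem_normalizer (R := T) h.le (F.isMap_conj le_rfl hs) hx hxP

theorem fullyNormalized_top [Finite G] (F : FusionSystem T) : F.FullyNormalized T := fun _ _ =>
  Subgroup.card_le_of_le (inf_le_left.trans (le_inf le_rfl Subgroup.le_normalizer))

theorem mem_extensionDomain_iff {e : P ≃* Q} (hef : ∀ x : P, (e x : G) = f x) {a : G} :
    a ∈ extensionDomain T e ↔ a ∈ T ∧ a ∈ Subgroup.normalizer (P : Set G) ∧
      ∃ b ∈ T, ∀ x ∈ P, f (a * x * a⁻¹) = b * f x * b⁻¹ := by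
  refine and_congr_right fun _ => and_congr_right fun hn => exists_congr fun b =>
    and_congr_right fun _ => ⟨fun h x hx => ?_, fun h x y hxy => ?_⟩
  · have := h ⟨x, hx⟩ ⟨_, (Subgroup.mem_normalizer_iff.1 hn x).1 hx⟩ rfl
    rwa [hef, hef] at this
  · rw [hef, hef, hxy]
    exact h x x.2

/-- In a fully centralized target, centralizers extend. -/
theorem Saturated.exists_map_centralizer [Finite G] (hF : F.Saturated p) (hf : F.IsIso P Q f)
    (hQ : F.FullyCentralized Q) :
    ∃ k, F.IsMap (P ⊔ T ⊓ Subgroup.centralizer (P : Set G)) k ∧ (∀ x ∈ P, k x = f x) ∧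
      ∀ x ∈ T ⊓ Subgroup.centralizer (P : Set G), k x ∈ T ⊓ Subgroup.centralizer (Q : Set G) := by
  have hcn : T ⊓ Subgroup.centralizer (P : Set G) ≤ Subgroup.normalizer (P : Set G) :=
    inf_le_right.trans (Subgroup.centralizer_le_normalizer _)
  obtain ⟨k, hk, hkf⟩ := hF.exists_extension (K := P ⊔ T ⊓ Subgroup.centralizer (P : Set G)) hf
    hQ le_sup_left (sup_le hf.le inf_le_left)
    (by
      intro a ha
      obtain ⟨e, -, hef⟩ := hf.exists_mulEquiv
      -- An element `b` of `P` corresponds to `f b` on the target side, an element of the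
      -- centralizer to `1`.
      have hle : P ⊔ T ⊓ Subgroup.centralizer (P : Set G) ≤ extensionDomain T e := sup_le ?_ ?_
      · exact ((mem_extensionDomain_iff hef).1 (hle ha)).2
      · intro b hb
        exact (mem_extensionDomain_iff hef).2 ⟨hf.le hb, Subgroup.le_normalizer hb, f b,
          hf.1.mem hb, fun x hx => hf.1.map_conj hb hx⟩
      · intro b hb
        refine (mem_extensionDomain_iff hef).2 ⟨hb.1, hcn hb, 1, T.one_mem, fun x hx => ?_⟩
        rw [← Subgroup.mem_centralizer_iff.1 hb.2 x hx]
        simp)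
  refine ⟨k, hk, hkf, fun x hx => ⟨hk.mem ((le_sup_right : _ ≤ P ⊔ _) hx), ?_⟩⟩
  refine Subgroup.mem_centralizer_iff.2 ?_
  intro y hy
  obtain ⟨z, hz, rfl⟩ := (hf.2 y).1 hy
  rw [← hkf z hz, ← hk.map_mul ((le_sup_left : _ ≤ P ⊔ _) hz) ((le_sup_right : _ ≤ P ⊔ _) hx),
    ← hk.map_mul ((le_sup_right : _ ≤ P ⊔ _) hx) ((le_sup_left : _ ≤ P ⊔ _) hz),
    Subgroup.mem_centralizer_iff.1 hx.2 z hz]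

end FusionSystem

/-! ### Generation of `O^p` by elements of order prime to `p` -/

section PResidual

variable {A : Type*} [Group A] {p : ℕ}

/-- The subgroup generated by the elements of order prime to `p`. -/
def pPrimeClosure (p : ℕ) (A : Type*) [Group A] : Subgroup A :=
  Subgroup.closure {a | ∃ k : ℕ, k.Coprime p ∧ a ^ k = 1}

instance : (pPrimeClosure p A).Normal := by
  refine ⟨fun a ha b => ?_⟩
  induction ha using Subgroup.closure_induction with
  | mem x hx =>
    obtain ⟨k, hk, hx⟩ := hx
    exact Subgroup.subset_closure ⟨k, hk, by rw [conj_pow, hx]; simp⟩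
  | one => simp
  | mul x y _ _ hx hy =>
    have := Subgroup.mul_mem _ hx hy
    simpa [mul_assoc] using this
  | inv x _ hx =>
    have := Subgroup.inv_mem _ hx
    simpa [mul_assoc] using this

theorem exists_index_pPrimeClosure [Finite A] [hp : Fact p.Prime] :
    ∃ n : ℕ, (pPrimeClosure p A).index = p ^ n := by
  have : IsPGroup p (A ⧸ pPrimeClosure p A) := by
    intro a
    obtain ⟨a, rfl⟩ := QuotientGroup.mk_surjective a
    -- For `a` of order `p ^ k * m` with `m` prime to `p`, the power `a ^ p ^ k` has order prime to
    -- `p` and dies in the quotient.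
    obtain ⟨k, m, hm, h⟩ := Nat.exists_eq_pow_mul_and_not_dvd (orderOf_pos a).ne' p hp.out.ne_one
    refine ⟨k, ?_⟩
    rw [← QuotientGroup.mk_pow, QuotientGroup.eq_one_iff]
    refine Subgroup.subset_closure ⟨m, ((Nat.Prime.coprime_iff_not_dvd hp.out).2 hm).symm, ?_⟩
    rw [← pow_mul, ← h, pow_orderOf_eq_one]
  exact IsPGroup.iff_card.1 this

/-- In a quotient of `p`-power order an element killed by an exponent prime to `p` is trivial. The
description by generators allows conditions on `O^p(Aut_F(P))` to be tested on single automorphisms.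
-/
theorem pResidual_eq_pPrimeClosure [Finite A] [hp : Fact p.Prime] :
    pResidual p A = pPrimeClosure p A := by
  apply le_antisymm
  · exact sInf_le ⟨inferInstance, exists_index_pPrimeClosure⟩
  · refine le_sInf ?_
    rintro K ⟨hK, n, hn⟩
    refine (Subgroup.closure_le _).2 ?_
    rintro a ⟨k, hk, ha⟩
    have h1 : (QuotientGroup.mk a : A ⧸ K) ^ k = 1 := by
      rw [← QuotientGroup.mk_pow, ha]; rfl
    have h2 : (QuotientGroup.mk a : A ⧸ K) ^ p ^ n = 1 := by
      rw [← hn]; exact pow_card_eq_one'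
    have h3 : (QuotientGroup.mk a : A ⧸ K) = 1 := by
      have h := pow_gcd_eq_one.2 ⟨h1, h2⟩
      rwa [Nat.Coprime.pow_right n hk, pow_one] at h
    exact (QuotientGroup.eq_one_iff a).1 h3

/-- The index of `K` is a power of `p` because of the `p'`-elements and prime to `p` because of the
Sylow subgroup. -/
theorem Subgroup.eq_top_of_sylow_le [Finite A] [hp : Fact p.Prime] {K : Subgroup A} (P : Sylow p A)
    (hP : (P : Subgroup A) ≤ K) (h : ∀ a : A, (∃ k : ℕ, k.Coprime p ∧ a ^ k = 1) → a ∈ K) :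
    K = ⊤ := by
  obtain ⟨n, hn⟩ := exists_index_pPrimeClosure (p := p) (A := A)
  have h1 : K.index ∣ p ^ n := hn ▸ Subgroup.index_dvd_of_le ((Subgroup.closure_le _).2 h)
  have h2 : K.index ∣ (P : Subgroup A).index := Subgroup.index_dvd_of_le hP
  have h3 : ¬ p ∣ K.index := fun h => P.not_dvd_index (h.trans h2)
  have h4 : (K.index).Coprime (p ^ n) :=
    (((Nat.Prime.coprime_iff_not_dvd hp.out).2 h3).symm).pow_right n
  exact Subgroup.index_eq_one.1 (Nat.Coprime.eq_one_of_dvd h4 h1)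

end PResidual

/-! ### Growth of normalizers and Alperin's fusion theorem -/

theorem Subgroup.card_lt_of_lt {G : Type*} [Group G] [Finite G] {A B : Subgroup G} (h : A < B) :
    Nat.card A < Nat.card B := by
  by_contra! hc
  exact h.ne (Subgroup.eq_of_le_of_card_ge h.le hc)

/-- Normalizers grow in `p`-groups. -/
theorem Subgroup.lt_inf_normalizer {G : Type*} [Group G] [Finite G] {p : ℕ} [Fact p.Prime]
    {T P : Subgroup G} (hT : IsPGroup p T) (hP : P < T) :
    P < T ⊓ Subgroup.normalizer (P : Set G) := by
  refine lt_of_le_of_ne (le_inf hP.le Subgroup.le_normalizer) fun h => ?_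
  have := hT.isNilpotent
  have hlt : P.subgroupOf T < ⊤ := by
    refine lt_of_le_of_ne le_top fun h => hP.not_ge ?_
    exact Subgroup.subgroupOf_eq_top.1 h
  obtain ⟨t, ht, htP⟩ := SetLike.exists_of_lt
    (Group.normalizerCondition_of_isNilpotent (G := T) _ hlt)
  refine htP (Subgroup.mem_subgroupOf.2 ?_)
  rw [h]
  refine ⟨t.2, Subgroup.mem_normalizer_iff.2 fun x => ?_⟩
  rw [Subgroup.mem_normalizer_iff] at ht
  have hc : ∀ x ∈ T, x ∈ P ↔ t * x * (t : G)⁻¹ ∈ P := fun x hx => ht ⟨x, hx⟩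
  refine ⟨fun hx => (hc x (hP.le hx)).1 hx, fun hx => (hc x ?_).2 hx⟩
  have := T.mul_mem (T.mul_mem (T.inv_mem t.2) (hP.le hx)) t.2
  simpa [mul_assoc] using this

namespace FusionSystem

variable {G : Type*} [Group G] {T : Subgroup G}
variable {F : FusionSystem T} {P Q R : Subgroup G} {f g : G → G} {p : ℕ}

theorem coe_pow_apply {α : MulAut P} (hf : ∀ x : P, (α x : G) = f x) (n : ℕ) (x : P) :
    ((α ^ n) x : G) = f^[n] x := by
  induction n with
  | zero => simp
  | succ n ih => rw [pow_succ', MulAut.mul_apply, hf, ih, Function.iterate_succ_apply']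

/-- The automorphisms of order prime to `p` lie in `O^p(Aut_F(P))`. -/
theorem mem_pResidualAut [Finite G] [Fact p.Prime] {hP : P ≤ T} {α : MulAut P}
    (h : F.IsIso P P f) (hα : ∀ x : P, (α x : G) = f x) {k : ℕ} (hk : k.Coprime p)
    (hfk : ∀ x ∈ P, f^[k] x = x) : α ∈ F.pResidualAut p P hP := by
  refine ⟨⟨α, mem_aut_of_isIso h hα⟩, ?_, rfl⟩
  rw [pResidual_eq_pPrimeClosure]
  refine Subgroup.subset_closure ⟨k, hk, Subtype.ext (MulEquiv.ext fun x => Subtype.ext ?_)⟩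
  exact (coe_pow_apply hα k x).trans (hfk x x.2)

theorem pResidualAut_le_iff [Finite G] [Fact p.Prime] {hP : P ≤ T} {K : Subgroup (MulAut P)} :
    F.pResidualAut p P hP ≤ K ↔ ∀ (f : G → G) (k : ℕ) (α : MulAut P), F.IsIso P P f →
      (∀ x : P, (α x : G) = f x) → k.Coprime p → (∀ x ∈ P, f^[k] x = x) → α ∈ K := by
  constructor
  · intro h f k α hf hα hk hfk
    exact h (mem_pResidualAut hf hα hk hfk)
  · intro h
    rw [pResidualAut, pResidual_eq_pPrimeClosure, Subgroup.map_le_iff_le_comap, pPrimeClosure,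
      Subgroup.closure_le]
    rintro ⟨α, hα⟩ ⟨k, hk, hαk⟩
    obtain ⟨f, hf, hαf⟩ := exists_isIso_of_mem_aut hα
    refine h f k α hf hαf hk fun x hx => ?_
    have hαk : α ^ k = 1 := congrArg Subtype.val hαk
    rw [← coe_pow_apply hαf k ⟨x, hx⟩, hαk]
    rfl

theorem hyperfocal_mem [Finite G] [Fact p.Prime] (h : F.IsIso P P f) {k : ℕ} (hk : k.Coprime p)
    (hfk : ∀ x ∈ P, f^[k] x = x) {x : G} (hx : x ∈ P) : x⁻¹ * f x ∈ F.hyperfocal p := by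
  obtain ⟨e, he, hef⟩ := h.exists_mulEquiv
  refine Subgroup.subset_closure ⟨P, h.le, e, mem_pResidualAut h hef hk hfk, ⟨x, hx⟩, ?_⟩
  rw [hef]

theorem hyperfocal_le_of [Finite G] [Fact p.Prime] {N : Subgroup G}
    (h : ∀ (P : Subgroup G) (f : G → G) (k : ℕ), F.IsIso P P f → k.Coprime p →
      (∀ x ∈ P, f^[k] x = x) → ∀ x ∈ P, x⁻¹ * f x ∈ N) : F.hyperfocal p ≤ N := by
  refine (Subgroup.closure_le _).2 ?_
  rintro _ ⟨P, hP, α, hα, x, rfl⟩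
  -- Closure under products comes from `x⁻¹ α(β x) = (x⁻¹ β x) · ((β x)⁻¹ α(β x))`, so only the
  -- generators of `O^p(Aut_F(P))` need checking.
  let K : Subgroup (MulAut P) :=
    { carrier := {α | ∀ x : P, (x : G)⁻¹ * α x ∈ N}
      one_mem' := fun x => by simp
      mul_mem' := fun {α β} hα hβ x => by
        simpa [mul_assoc] using N.mul_mem (hβ x) (hα (β x))
      inv_mem' := fun {α} hα x => by
        have := N.inv_mem (hα (α⁻¹ x))
        rw [MulAut.apply_inv_self] at this
        simpa using this }
  refine (pResidualAut_le_iff (K := K)).2 (fun f k β hf hβ hk hfk y => ?_) hα x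
  rw [hβ]
  exact h P f k hf hk hfk y y.2

/-- This matches the generators in `Saturated.induction`: the condition concerns one automorphism of
order prime to `p` at a time. -/
theorem isPPowerIndex_iff [Finite G] [Fact p.Prime] {N : Subgroup G} {H : FusionSystem N} :
    H.IsPPowerIndex F p ↔ H.IsSubsystem F ∧ F.hyperfocal p ≤ N ∧
      ∀ (P : Subgroup G) (f : G → G) (k : ℕ), P ≤ N → F.IsIso P P f → k.Coprime p →
        (∀ x ∈ P, f^[k] x = x) → H.IsMap P f := by
  refine and_congr_right fun hs => and_congr_right fun _ => ⟨fun h P f k hPN hf hk hfk => ?_,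
    fun h P hN hT => pResidualAut_le_iff.2 fun f k α hf hα hk hfk => ?_⟩
  · obtain ⟨e, he, hef⟩ := hf.exists_mulEquiv
    exact ⟨P, _, pResidualAut_le_iff.1 (h P hPN hf.le) f k e hf hef hk hfk, hef⟩
  · exact (h P f k hN hf hk hfk).mem_hom hN hα

/-- Alperin's fusion theorem: a class of morphisms that is closed under restriction, composition and
inversion and that contains the conjugations and the automorphisms of order prime to `p` contains
all morphisms. -/
theorem Saturated.induction [Finite G] [Fact p.Prime] (hT : IsPGroup p T) (hF : F.Saturated p)
    {C : Subgroup G → (G → G) → Prop}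
    (congr : ∀ {P f g}, C P f → (∀ x ∈ P, f x = g x) → C P g)
    (restrict : ∀ {P Q f}, F.IsMap P f → C P f → Q ≤ P → C Q f)
    (comp : ∀ {P Q R f g}, F.IsIso P Q f → C P f → F.IsIso Q R g → C Q g →
      C P (fun x => g (f x)))
    (symm : ∀ {P Q f g}, F.IsIso P Q f → C P f → F.IsIso Q P g → (∀ x ∈ P, g (f x) = x) →
      (∀ y ∈ Q, f (g y) = y) → C Q g)
    (conj : ∀ s ∈ T, C T (fun x => s * x * s⁻¹))
    (pprime : ∀ {P f k}, F.IsIso P P f → Nat.Coprime k p → (∀ x ∈ P, f^[k] x = x) → C P f)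
    (h : F.IsMap P f) : C P f := by
  -- The automorphisms of `R` in the class form a subgroup. It contains the Sylow subgroup
  -- `Aut_T(R)` and all elements of order prime to `p`, hence it is all of `Aut_F(R)`.
  have haut : ∀ {R f}, F.FullyNormalized R → F.IsIso R R f → C R f := by
    intro R f hR hf
    let K : Subgroup (F.aut R hf.le) :=
      { carrier := {α | ∀ f : G → G, (∀ x : R, (α.1 x : G) = f x) → C R f}
        one_mem' := fun f hf' => congr (restrict (F.isMap_conj le_rfl T.one_mem)
          (conj 1 T.one_mem) hf.le) fun x hx => by simpa using hf' ⟨x, hx⟩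
        mul_mem' := by
          intro α β hα hβ f' hf'
          obtain ⟨a, ha, hαa⟩ := exists_isIso_of_mem_aut α.2
          obtain ⟨b, hb, hβb⟩ := exists_isIso_of_mem_aut β.2
          refine congr (comp hb (hβ b hβb) ha (hα a hαa)) fun x hx => ?_
          rw [← hf' ⟨x, hx⟩, ← hβb ⟨x, hx⟩, ← hαa]
          rfl
        inv_mem' := by
          intro α hα f' hf'
          obtain ⟨a, ha, hαa⟩ := exists_isIso_of_mem_aut α.2
          have hf' : ∀ x : R, (α.1⁻¹ x : G) = f' x := hf'
          refine symm ha (hα a hαa) (isIso_of_mem (α⁻¹).2 hf') (fun x hx => ?_)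
            fun x hx => ?_
          · rw [← hαa ⟨x, hx⟩, ← hf']
            simp
          · rw [← hf' ⟨x, hx⟩, ← hαa]
            simp }
    obtain ⟨A, hA⟩ := hF.sylow R hf.le hR
    have hK : K = ⊤ := by
      refine Subgroup.eq_top_of_sylow_le A ?_ ?_
      · intro α hα f' hf'
        rw [hA] at hα
        obtain ⟨s, hs, h⟩ := hα
        refine congr (restrict (F.isMap_conj le_rfl hs) (conj s hs) hf.le) fun x hx => ?_
        rw [← hf' ⟨x, hx⟩]
        exact (h ⟨x, hx⟩).symm
      · rintro α ⟨k, hk, hα⟩ f' hf'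
        refine pprime (isIso_of_mem α.2 hf') hk fun x hx => ?_
        rw [← coe_pow_apply hf' k ⟨x, hx⟩, ← Subgroup.coe_pow, hα]
        rfl
    obtain ⟨e, he, hef⟩ := hf.exists_mulEquiv
    have : (⟨e, he⟩ : F.aut R hf.le) ∈ K := hK ▸ Subgroup.mem_top _
    exact this f hef
  -- Normalizers grow, so induction on `|T| - |P|` may be applied to morphisms defined on `N_T(P)`.
  have key : ∀ {P : Subgroup G}, P < T →
      Nat.card T - Nat.card ↥(T ⊓ Subgroup.normalizer (P : Set G)) < Nat.card T - Nat.card P := by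
    intro P hP
    have h1 : Nat.card P < Nat.card ↥(T ⊓ Subgroup.normalizer (P : Set G)) :=
      Subgroup.card_lt_of_lt (Subgroup.lt_inf_normalizer hT hP)
    have h2 : Nat.card ↥(T ⊓ Subgroup.normalizer (P : Set G)) ≤ Nat.card T :=
      Subgroup.card_le_of_le inf_le_left
    omega
  generalize hn : Nat.card T - Nat.card P = n
  induction n using Nat.strong_induction_on generalizing P f with
  | _ n ih =>
    by_cases hPT : P = T
    · subst hPT
      obtain ⟨Q, hQ⟩ := h.exists_isIso
      have hQP : Q = P := by
        refine Subgroup.eq_of_le_of_card_ge hQ.le' ?_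
        exact Subgroup.card_le_of_injOn f (fun x hx => hQ.mem hx) fun x hx y hy => h.inj hx hy
      subst hQP
      exact haut F.fullyNormalized_top hQ
    · have hlt : P < T := lt_of_le_of_ne h.le hPT
      obtain ⟨Q, hQ⟩ := h.exists_isIso
      -- With `k : P → R` and `l : Q → R` extending to the normalizers, `f = l⁻¹ ∘ (l ∘ f ∘ k⁻¹) ∘
      -- k`. The outer factors are covered by induction, the middle one is an automorphism of the
      -- fully normalized `R`.
      obtain ⟨R, hPR, hR⟩ := F.exists_fullyNormalized h.le
      obtain ⟨k, hk, hkN⟩ := hF.exists_map_normalizer hT h.le hPR hR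
      obtain ⟨l, hl, hlN⟩ := hF.exists_map_normalizer hT hQ.le' (hQ.conjugate.symm.trans hPR) hR
      have hkC : C P k := restrict hkN (ih _ (by
        have := hn ▸ key hlt
        exact this) hkN rfl) (le_inf h.le Subgroup.le_normalizer)
      have hQT : Q < T := lt_of_le_of_ne hQ.le' fun h' => by
        have h1 : Nat.card Q ≤ Nat.card P := by
          obtain ⟨g, hg, -⟩ := hQ.symm
          exact Subgroup.card_le_of_injOn g (fun x hx => hg.mem hx) fun x hx y hy => hg.1.inj hx hy
        exact hPT (Subgroup.eq_of_le_of_card_ge h.le (h' ▸ h1))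
      have hQP : Nat.card P ≤ Nat.card Q :=
        Subgroup.card_le_of_injOn f (fun x hx => hQ.mem hx) fun x hx y hy => h.inj hx hy
      have hlC : C Q l := restrict hlN (ih _ (by
        have := key hQT
        omega) hlN rfl) (le_inf hQ.le' Subgroup.le_normalizer)
      obtain ⟨k', hk', hkk', hk'k⟩ := hk.symm
      obtain ⟨l', hl', hll', hl'l⟩ := hl.symm
      have hC := comp hk hkC ((hk'.comp hQ).comp hl) (haut hR ((hk'.comp hQ).comp hl))
      have hC := comp (hk.comp ((hk'.comp hQ).comp hl)) hC hl' (symm hl hlC hl' hll' hl'l)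
      refine congr hC fun x hx => ?_
      rw [hkk' x hx, hll' _ (hQ.mem hx)]

end FusionSystem

/-! ### Strong closure, uniqueness and invariance -/

namespace FusionSystem

variable {G : Type*} [Group G] [Finite G] {T N : Subgroup G} {p : ℕ} [Fact p.Prime]
variable {F : FusionSystem T} {P Q R : Subgroup G} {f g : G → G}

/-- Morphisms preserve a normal subgroup containing the hyperfocal subgroup. -/
theorem Saturated.map_mem_iff (hT : IsPGroup p T) (hF : F.Saturated p)
    (hN : ∀ t ∈ T, ∀ x ∈ N, t * x * t⁻¹ ∈ N) (hyp : F.hyperfocal p ≤ N)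
    (h : F.IsMap P f) : ∀ x ∈ P, (f x ∈ N ↔ x ∈ N) := by
  refine hF.induction hT (C := fun P f => ∀ x ∈ P, (f x ∈ N ↔ x ∈ N)) ?_ ?_ ?_ ?_ ?_ ?_ h
  · intro P f g h hfg x hx
    rw [← hfg x hx, h x hx]
  · intro P Q f _ h hQ x hx
    exact h x (hQ hx)
  · intro P Q R f g hf h hg h' x hx
    rw [h' _ (hf.mem hx), h x hx]
  · intro P Q f g hf h hg _ hfg x hx
    rw [← h _ (hg.mem hx), hfg x hx]
  · intro s hs x hx
    refine ⟨fun h => ?_, hN s hs x⟩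
    simpa [mul_assoc] using hN s⁻¹ (T.inv_mem hs) _ h
  · intro P f k hf hk hfk x hx
    -- `f x` and `x` differ by the factor `x⁻¹ f(x)`, which is hyperfocal and so lies in `N`.
    have := hyp (hyperfocal_mem hf hk hfk hx)
    refine ⟨fun h => ?_, fun h => ?_⟩
    · have := N.mul_mem h (N.inv_mem this)
      simpa using this
    · simpa using N.mul_mem h this

theorem Saturated.stronglyClosed (hT : IsPGroup p T) (hF : F.Saturated p) (hNT : N ≤ T)
    (hN : ∀ t ∈ T, ∀ x ∈ N, t * x * t⁻¹ ∈ N) (hyp : F.hyperfocal p ≤ N) :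
    F.StronglyClosed N := by
  refine ⟨hNT, fun P Q hP φ hφ x => ?_⟩
  obtain ⟨f, hf⟩ := exists_extend φ
  rw [hf]
  exact (hF.map_mem_iff hT hN hyp ⟨Q, φ, hφ, hf⟩ x x.2).2 (hP x.2)

/-- A saturated subsystem on `N` is contained in every subsystem on `N` of `p`-power index. -/
theorem Saturated.isMap_of_isPPowerIndex (hN : IsPGroup p N) {H K : FusionSystem N}
    (hH : H.Saturated p) (hHF : H.IsSubsystem F) (hK : K.IsPPowerIndex F p)
    (h : H.IsMap P f) : K.IsMap P f := by
  rw [isPPowerIndex_iff] at hK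
  refine hH.induction hN (C := fun P f => K.IsMap P f) ?_ ?_ ?_ ?_ ?_ ?_ h
  · exact fun h hfg => h.congr hfg
  · exact fun _ h hQ => h.restrict hQ
  · exact fun hf h hg h' => h.comp h' fun x hx => hf.mem hx
  · intro P Q f g hf h hg hgf hfg
    obtain ⟨g', hg', -, hfg'⟩ := IsIso.symm ⟨h, hf.2⟩
    refine hg'.1.congr fun y hy => ?_
    exact hf.1.inj (hg'.mem hy) (hg.mem hy) (by rw [hfg' y hy, hfg y hy])
  · exact fun s hs => K.isMap_conj le_rfl hs
  · exact fun hf hk hfk => hK.2.2 _ _ _ hf.le (hHF.isIso hf) hk hfk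

theorem Saturated.unique (hN : IsPGroup p N) {H K : FusionSystem N}
    (hH : H.Saturated p) (hHF : H.IsPPowerIndex F p) (hK : K.Saturated p)
    (hKF : K.IsPPowerIndex F p) : H = K :=
  IsMap.ext_hom fun _ _ => ⟨hH.isMap_of_isPPowerIndex hN hHF.1 hKF,
    hK.isMap_of_isPPowerIndex hN hKF.1 hHF⟩

/-- Alperin's theorem inside `H` reduces to generators: a `T`-conjugate of a conjugation by `s ∈ N`
is conjugation by `t s t⁻¹ ∈ N`, and a `T`-conjugate of a `p'`-automorphism is a `p'`-automorphism
in `F` of a subgroup of `N`, hence lies in `H`. This supplies the conjugation case of invariance. -/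
theorem IsPPowerIndex.isMap_conj_conj (hNp : IsPGroup p N) {H : FusionSystem N}
    (hH : H.Saturated p) (hHF : H.IsPPowerIndex F p)
    (hN : ∀ t ∈ T, ∀ x ∈ N, t * x * t⁻¹ ∈ N) (h : H.IsMap P f) :
    ∀ t ∈ T, ∀ P' : Subgroup G, (∀ y, y ∈ P' ↔ t⁻¹ * y * t ∈ P) →
      H.IsMap P' (fun y => t * f (t⁻¹ * y * t) * t⁻¹) := by
  have hNT := hHF.1.1
  have hle : ∀ {P P' : Subgroup G} {t : G}, P ≤ N → t ∈ T → (∀ y, y ∈ P' ↔ t⁻¹ * y * t ∈ P) →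
      P' ≤ N := by
    intro P P' t hP ht h y hy
    simpa [mul_assoc] using hN t ht _ (hP ((h y).1 hy))
  have hex : ∀ (P : Subgroup G) (t : G), ∃ P' : Subgroup G, ∀ y, y ∈ P' ↔ t⁻¹ * y * t ∈ P :=
    fun P t => ⟨P.comap (MulAut.conj t⁻¹).toMonoidHom, fun y => by simp⟩
  rw [isPPowerIndex_iff] at hHF
  refine hH.induction hNp (C := fun P f => ∀ t ∈ T, ∀ P' : Subgroup G,
    (∀ y, y ∈ P' ↔ t⁻¹ * y * t ∈ P) → H.IsMap P' (fun y => t * f (t⁻¹ * y * t) * t⁻¹))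
    ?_ ?_ ?_ ?_ ?_ ?_ h
  · intro P f g h hfg t ht P' hP'
    exact (h t ht P' hP').congr fun x hx => by rw [hfg _ ((hP' x).1 hx)]
  · intro P Q f _ h hQ t ht Q' hQ'
    obtain ⟨P', hP'⟩ := hex P t
    exact (h t ht P' hP').restrict fun y hy => (hP' y).2 (hQ ((hQ' y).1 hy))
  · intro P Q R f g hf h hg h' t ht P' hP'
    obtain ⟨Q', hQ'⟩ := hex Q t
    refine ((h t ht P' hP').comp (h' t ht Q' hQ') fun x hx => (hQ' _).2 ?_).congr fun x hx => ?_
    · simpa [mul_assoc] using hf.mem ((hP' x).1 hx)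
    · simp [mul_assoc]
  · intro P Q f g hf h hg hgf hfg t ht Q' hQ'
    obtain ⟨P', hP'⟩ := hex P t
    obtain ⟨R, hR⟩ := (h t ht P' hP').exists_isIso
    obtain ⟨k, hk, -, hk'⟩ := hR.symm
    have hRQ : R = Q' := by
      ext y
      rw [hR.2, hQ', hf.2]
      constructor
      · rintro ⟨x, hx, rfl⟩
        exact ⟨_, (hP' x).1 hx, by simp [mul_assoc]⟩
      · rintro ⟨x, hx, hxy⟩
        have h1 : t⁻¹ * (t * x * t⁻¹) * t = x := by simp [mul_assoc]
        refine ⟨t * x * t⁻¹, (hP' _).2 (h1.symm ▸ hx), ?_⟩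
        dsimp only
        rw [h1, hxy]
        simp [mul_assoc]
    subst hRQ
    refine hk.1.congr fun y hy => ?_
    have hgy := hg.mem ((hQ' y).1 hy)
    have h1 : t⁻¹ * (t * g (t⁻¹ * y * t) * t⁻¹) * t = g (t⁻¹ * y * t) := by simp [mul_assoc]
    refine hR.1.inj (hk.mem hy) ((hP' _).2 (h1.symm ▸ hgy)) ?_
    rw [hk' y hy, h1, hfg _ ((hQ' y).1 hy)]
    simp [mul_assoc]
  · intro s hs t ht P' hP'
    refine (H.isMap_conj (hle le_rfl ht hP') (hN t ht s hs)).congr fun x hx => ?_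
    simp [mul_assoc]
  · intro P f k hf hk hfk t ht P' hP'
    have hP'N := hle hf.le ht hP'
    refine hHF.2.2 P' _ k hP'N ⟨?_, fun y => ?_⟩ hk fun x hx => ?_
    · refine ((((F.isMap_conj (hP'N.trans hNT) (T.inv_mem ht)).comp (hHF.1.isMap hf.1) ?_).comp
        (F.isMap_conj le_rfl ht) ?_)).congr fun x hx => ?_
      · intro x hx
        simpa using (hP' x).1 hx
      · intro x hx
        exact hNT (hf.le (hf.mem (by simpa using (hP' x).1 hx)))
      · simp
    · rw [hP', hf.2]
      constructor
      · rintro ⟨x, hx, hxy⟩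
        have h1 : t⁻¹ * (t * x * t⁻¹) * t = x := by simp [mul_assoc]
        refine ⟨t * x * t⁻¹, (hP' _).2 (h1.symm ▸ hx), ?_⟩
        dsimp only
        rw [h1, hxy]
        simp [mul_assoc]
      · rintro ⟨x, hx, rfl⟩
        exact ⟨_, (hP' x).1 hx, by simp [mul_assoc]⟩
    · have : ∀ n : ℕ, (fun y => t * f (t⁻¹ * y * t) * t⁻¹)^[n] x =
          t * f^[n] (t⁻¹ * x * t) * t⁻¹ := by
        intro n
        induction n with
        | zero => simp [mul_assoc]
        | succ n ih =>
          rw [Function.iterate_succ_apply', ih, Function.iterate_succ_apply']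
          simp [mul_assoc]
      rw [this, hfk _ ((hP' x).1 hx)]
      simp [mul_assoc]

/-- Here `χ` is `f ∘ ψ ∘ f⁻¹`, described without an inverse. An equivalence, rather than one
implication, makes the class of admissible `f` closed under inversion, as `Saturated.induction`
requires. -/
theorem IsPPowerIndex.isMap_iff_of_isMap (hT : IsPGroup p T) (hF : F.Saturated p)
    {H : FusionSystem N}
    (hH : H.Saturated p) (hHF : H.IsPPowerIndex F p)
    (hN : ∀ t ∈ T, ∀ x ∈ N, t * x * t⁻¹ ∈ N) (h : F.IsMap P f) :
    ∀ (U U' : Subgroup G) (ψ χ : G → G), U ≤ P ⊓ N → (∀ y, y ∈ U' ↔ ∃ x ∈ U, f x = y) →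
      (∀ u ∈ U, ψ u ∈ P) → (∀ u ∈ U, χ (f u) = f (ψ u)) → (H.IsMap U ψ ↔ H.IsMap U' χ) := by
  have hNT := hHF.1.1
  have hNp : IsPGroup p N := hT.to_le hNT
  have hconj := @IsPPowerIndex.isMap_conj_conj _ _ _ T N p _ F
  have hHF' := isPPowerIndex_iff.1 hHF
  have hsc : ∀ {P f}, F.IsMap P f → ∀ x ∈ P, (f x ∈ N ↔ x ∈ N) := fun h =>
    hF.map_mem_iff hT hN hHF.2.1 h
  refine hF.induction hT (C := fun P f => ∀ (U U' : Subgroup G) (ψ χ : G → G), U ≤ P ⊓ N →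
    (∀ y, y ∈ U' ↔ ∃ x ∈ U, f x = y) → (∀ u ∈ U, ψ u ∈ P) → (∀ u ∈ U, χ (f u) = f (ψ u)) →
    (H.IsMap U ψ ↔ H.IsMap U' χ)) ?_ ?_ ?_ ?_ ?_ ?_ h
  · intro P f g h hfg U U' ψ χ hU hU' hψ hχ
    refine h U U' ψ χ hU (fun y => (hU' y).trans ?_) hψ fun u hu => ?_
    · exact exists_congr fun x => and_congr_right fun hx => by rw [hfg x (hU hx).1]
    · rw [hfg u (hU hu).1, hfg _ (hψ u hu), hχ u hu]
  · intro P Q f _ h hQ U U' ψ χ hU hU' hψ hχ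
    exact h U U' ψ χ (hU.trans (inf_le_inf_right _ hQ)) hU' (fun u hu => hQ (hψ u hu)) hχ
  · intro P Q R f g hf h hg h' U U' ψ χ hU hU' hψ hχ
    obtain ⟨V, hV⟩ := (hf.1.restrict (hU.trans inf_le_left)).exists_isIso
    obtain ⟨f', hf', hff', hf'f⟩ := hf.symm
    refine (h U V ψ (fun x => f (ψ (f' x))) hU hV.2 hψ fun u hu => ?_).trans
      (h' V U' (fun x => f (ψ (f' x))) χ ?_ (fun y => (hU' y).trans ?_) ?_ ?_)
    · rw [hff' u (hU hu).1]
    · intro y hy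
      obtain ⟨x, hx, rfl⟩ := (hV.2 y).1 hy
      exact ⟨hf.mem (hU hx).1, (hsc hf.1 x (hU hx).1).2 (hU hx).2⟩
    · constructor
      · rintro ⟨x, hx, rfl⟩
        exact ⟨f x, hV.mem hx, rfl⟩
      · rintro ⟨x, hx, rfl⟩
        obtain ⟨z, hz, rfl⟩ := (hV.2 x).1 hx
        exact ⟨z, hz, rfl⟩
    · intro y hy
      obtain ⟨x, hx, rfl⟩ := (hV.2 y).1 hy
      rw [hff' x (hU hx).1]
      exact hf.mem (hψ x hx)
    · intro y hy
      obtain ⟨x, hx, rfl⟩ := (hV.2 y).1 hy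
      rw [hff' x (hU hx).1, hχ x hx]
  · intro P Q f g hf h hg hgf hfg U U' ψ χ hU hU' hψ hχ
    refine (h U' U χ ψ ?_ (fun y => ⟨fun hy => ?_, ?_⟩) ?_ ?_).symm
    · intro y hy
      obtain ⟨x, hx, rfl⟩ := (hU' y).1 hy
      exact ⟨hg.mem (hU hx).1, (hsc hg.1 x (hU hx).1).2 (hU hx).2⟩
    · exact ⟨g y, (hU' _).2 ⟨y, hy, rfl⟩, hfg y (hU hy).1⟩
    · rintro ⟨x, hx, rfl⟩
      obtain ⟨z, hz, rfl⟩ := (hU' x).1 hx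
      rwa [hfg z (hU hz).1]
    · intro y hy
      obtain ⟨x, hx, rfl⟩ := (hU' y).1 hy
      rw [hχ x hx]
      exact hg.mem (hψ x hx)
    · intro y hy
      obtain ⟨x, hx, rfl⟩ := (hU' y).1 hy
      rw [hχ x hx, hfg _ (hψ x hx), hfg _ (hU hx).1]
  · intro s hs U U' ψ χ hU hU' hψ hχ
    constructor
    · intro h
      refine (hconj hNp hH hHF hN h s hs U' fun y => ?_).congr fun y hy => ?_
      · rw [hU']
        constructor
        · rintro ⟨x, hx, rfl⟩
          simpa [mul_assoc] using hx
        · exact fun h => ⟨_, h, by simp [mul_assoc]⟩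
      · obtain ⟨x, hx, rfl⟩ := (hU' y).1 hy
        rw [hχ x hx]
        simp [mul_assoc]
    · intro h
      refine (hconj hNp hH hHF hN h s⁻¹ (T.inv_mem hs) U fun y => ?_).congr fun y hy => ?_
      · rw [hU']
        constructor
        · intro hy
          exact ⟨y, hy, by simp⟩
        · rintro ⟨x, hx, hxy⟩
          have : x = y := by simpa using hxy
          exact this ▸ hx
      · have := hχ y hy
        rw [inv_inv, this]
        simp [mul_assoc]
  · intro P f k hf hk hfk U U' ψ χ hU hU' hψ hχ
    -- Since `f` preserves membership in `N`, it restricts to a `p'`-automorphism of `P ⊓ N`, which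
    -- belongs to `H`. Transport by `f` then takes place inside `H`.
    have hfH : F.IsIso (P ⊓ N) (P ⊓ N) f := by
      refine ⟨hf.1.restrict inf_le_left, fun y => ⟨fun hy => ?_, ?_⟩⟩
      · obtain ⟨x, hx, rfl⟩ := (hf.2 y).1 hy.1
        exact ⟨x, ⟨hx, (hsc hf.1 x hx).1 hy.2⟩, rfl⟩
      · rintro ⟨x, hx, rfl⟩
        exact ⟨hf.mem hx.1, (hsc hf.1 x hx.1).2 hx.2⟩
    have hfH : H.IsIso (P ⊓ N) (P ⊓ N) f :=
      ⟨hHF'.2.2 _ f k inf_le_right hfH hk fun x hx => hfk x hx.1, hfH.2⟩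
    obtain ⟨g, hg, hgf, hfg⟩ := hfH.symm
    have hU'P : U' ≤ P ⊓ N := by
      intro y hy
      obtain ⟨x, hx, rfl⟩ := (hU' y).1 hy
      exact hfH.mem (hU hx)
    constructor
    · intro h
      refine (((hg.1.restrict hU'P).comp h ?_).comp hfH.1 ?_).congr ?_
      · intro y hy
        obtain ⟨x, hx, rfl⟩ := (hU' y).1 hy
        rwa [hgf x (hU hx)]
      · intro y hy
        obtain ⟨x, hx, rfl⟩ := (hU' y).1 hy
        rw [hgf x (hU hx)]
        exact ⟨hψ x hx, h.mem hx⟩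
      · intro y hy
        obtain ⟨x, hx, rfl⟩ := (hU' y).1 hy
        rw [hgf x (hU hx), hχ x hx]
    · intro h
      have hfu : ∀ u ∈ U, f u ∈ U' := fun u hu => (hU' _).2 ⟨u, hu, rfl⟩
      -- That `ψ u` lies in `N` is not given in this direction; it follows from `f (ψ u) = χ (f u) ∈
      -- N`.
      have hψN : ∀ u ∈ U, ψ u ∈ P ⊓ N := fun u hu => by
        refine ⟨hψ u hu, (?_ : ψ u ∈ N)⟩
        rw [← hsc hf.1 _ (hψ u hu), ← hχ u hu]
        exact h.mem (hfu u hu)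
      refine (((hfH.1.restrict hU).comp h hfu).comp hg.1 fun u hu => ?_).congr fun u hu => ?_
      · rw [hχ u hu]
        exact hfH.mem (hψN u hu)
      · rw [hχ u hu, hgf _ (hψN u hu)]

theorem IsPPowerIndex.isInvariant (hT : IsPGroup p T) (hF : F.Saturated p)
    {H : FusionSystem N} (hH : H.Saturated p) (hHF : H.IsPPowerIndex F p)
    (hN : ∀ t ∈ T, ∀ x ∈ N, t * x * t⁻¹ ∈ N) : H.IsInvariant F := by
  refine ⟨hHF.1, hF.stronglyClosed hT hHF.1.1 hN hHF.2.1, ?_⟩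
  intro Q P φ hφ U V hU hV ψ hψ U' V' hU' hV' χ hχ
  obtain ⟨f, hf⟩ := exists_extend φ.toMonoidHom
  have hf : ∀ x : Q, (φ x : G) = f x := hf
  have hfi := isIso_of_mem hφ hf
  obtain ⟨a, ha⟩ := exists_extend ψ
  obtain ⟨b, hb⟩ := exists_extend χ
  have hmem : ∀ {W W' : Subgroup G}, W ≤ Q ⊓ N →
      W' = (W.subgroupOf Q).map (P.subtype.comp φ.toMonoidHom) →
      ∀ y, y ∈ W' ↔ ∃ x ∈ W, f x = y := by
    rintro W W' hW rfl y
    constructor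
    · rintro ⟨x, hx, rfl⟩
      exact ⟨x, hx, (hf x).symm⟩
    · rintro ⟨x, hx, rfl⟩
      exact ⟨⟨x, (hW hx).1⟩, hx, hf ⟨x, (hW hx).1⟩⟩
  have hψa : H.IsMap U a := ⟨V, ψ, hψ, ha⟩
  refine IsMap.mem_hom ((IsPPowerIndex.isMap_iff_of_isMap hT hF hH hHF hN hfi.1 U U' a b hU
    (hmem hU hU') ?_ ?_).1 hψa) ?_ hb
  · intro u hu
    rw [← ha ⟨u, hu⟩]
    exact (hV (ψ ⟨u, hu⟩).2).1
  · intro u hu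
    have h1 : f u ∈ U' := (hmem hU hU' _).2 ⟨u, hu, rfl⟩
    rw [← ha ⟨u, hu⟩, ← hb ⟨f u, h1⟩, hχ ⟨f u, h1⟩ ⟨u, (hU hu).1⟩ hu (hf ⟨u, (hU hu).1⟩).symm, hf]
  · intro y hy
    obtain ⟨x, hx, rfl⟩ := (hmem hV hV' y).1 hy
    exact (hF.map_mem_iff hT hN hHF.2.1 hfi.1 x (hV hx).1).2 (hV hx).2

end FusionSystem

/-! ### The subsystem of degree zero and its saturation -/

namespace FusionSystem

variable {G : Type*} [Group G] {T N : Subgroup G} {p : ℕ}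
variable {F : FusionSystem T} {P Q R K : Subgroup G} {f g : G → G}

/-- A realization of the fusion system `F` by conjugation in a group `Γ`, together with a
homomorphism `deg` from `Γ` to the integers modulo `p` that cuts out the subgroup `N` of `T`. -/
structure DegreeModel (F : FusionSystem T) (N : Subgroup G) (p : ℕ) (Γ : Type*) [Group Γ] where
  /-- The homomorphism from `T` to `Γ`, with arbitrary values outside `T`. -/
  ι : G → Γ
  /-- The degree. -/
  deg : Γ → ZMod p
  ι_mul : ∀ x ∈ T, ∀ y ∈ T, ι (x * y) = ι x * ι y
  deg_mul : ∀ g h, deg (g * h) = deg g + deg h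
  deg_ι : ∀ x ∈ T, deg (ι x) = 0 ↔ x ∈ N
  realize : ∀ {P : Subgroup G} {f : G → G}, F.IsMap P f → ∃ g, ∀ x ∈ P, g * ι x = ι (f x) * g
  -- If no image of `P` is centralized by an element of `T` outside `N`, then no element of `Γ`
  -- centralizing `P` has nonzero degree. This makes the degree an invariant of the morphism.
  deg_centralizer : ∀ {P : Subgroup G}, P ≤ T →
    (∀ ψ, F.IsMap P ψ → ∀ b ∈ T, (∀ x ∈ P, b * ψ x = ψ x * b) → b ∈ N) →
    ∀ g, (∀ x ∈ P, g * ι x = ι x * g) → deg g = 0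

namespace DegreeModel

variable {Γ : Type*} [Group Γ]

section

variable (d : F.DegreeModel N p Γ)

theorem deg_one : d.deg 1 = 0 := by
  have := d.deg_mul 1 1
  simpa using this

theorem deg_inv (g : Γ) : d.deg g⁻¹ = - d.deg g := by
  have := d.deg_mul g⁻¹ g
  rw [inv_mul_cancel, d.deg_one] at this
  exact eq_neg_of_add_eq_zero_left this.symm

theorem deg_pow (g : Γ) (n : ℕ) : d.deg (g ^ n) = n * d.deg g := by
  induction n with
  | zero => simp [d.deg_one]
  | succ n ih => rw [pow_succ, d.deg_mul, ih]; push_cast; ring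

theorem ι_one : d.ι 1 = 1 := by
  have := d.ι_mul 1 T.one_mem 1 T.one_mem
  simpa using this

theorem ι_pow {x : G} (hx : x ∈ T) (n : ℕ) : d.ι (x ^ n) = d.ι x ^ n := by
  induction n with
  | zero => simp [d.ι_one]
  | succ n ih => rw [pow_succ, d.ι_mul _ (T.pow_mem hx n) _ hx, ih, pow_succ]

theorem ι_conj {s x : G} (hs : s ∈ T) (hx : x ∈ T) :
    d.ι s * d.ι x = d.ι (s * x * s⁻¹) * d.ι s := by
  rw [← d.ι_mul s hs x hx, ← d.ι_mul _ (T.mul_mem (T.mul_mem hs hx) (T.inv_mem hs)) s hs]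
  simp

/-- Every degree is attained by a power of a given element outside `N`. -/
theorem exists_pow_deg [Fact p.Prime] {c : G} (hc : c ∈ T) (hcN : c ∉ N) (a : ZMod p) :
    ∃ i : ℕ, d.deg (d.ι (c ^ i)) = a := by
  have h : d.deg (d.ι c) ≠ 0 := fun h => hcN ((d.deg_ι c hc).1 h)
  refine ⟨(a / d.deg (d.ι c)).val, ?_⟩
  rw [d.ι_pow hc, d.deg_pow, ZMod.natCast_zmod_val, div_mul_cancel₀ _ h]

/-- The subsystem of the morphisms realized by elements of degree zero. -/
def subsystem (hN : N ≤ T) : FusionSystem N where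
  hom P Q := {φ | φ ∈ F.hom P Q ∧ (P ≤ N ∧ Q ≤ N) ∧
    ∃ g, d.deg g = 0 ∧ ∀ x : P, g * d.ι x = d.ι (φ x) * g}
  le_of_mem h := h.2.1
  injective h := F.injective h.1
  conj_mem := by
    intro P Q hP hQ φ s hs h
    refine ⟨F.conj_mem (hP.trans hN) (hQ.trans hN) φ s (hN hs) h, ⟨hP, hQ⟩, d.ι s,
      (d.deg_ι s (hN hs)).2 hs, fun x => ?_⟩
    rw [h]
    exact d.ι_conj (hN hs) (hN (hP x.2))
  comp_mem := by
    rintro P Q R φ ψ ⟨hφ, hPQ, g, hg, hgφ⟩ ⟨hψ, hQR, h, hh, hhψ⟩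
    refine ⟨F.comp_mem hφ hψ, ⟨hPQ.1, hQR.2⟩, h * g, by rw [d.deg_mul, hg, hh, add_zero],
      fun x => ?_⟩
    rw [mul_assoc, hgφ, ← mul_assoc, hhψ, mul_assoc]
    rfl
  iso_mem := by
    rintro P Q R φ ⟨hφ, hPQ, g, hg, hgφ⟩ e he
    have hR : R ≤ N := fun y hy => by
      have h1 := he (e.symm ⟨y, hy⟩)
      rw [e.apply_symm_apply] at h1
      rw [show y = _ from h1]
      exact hPQ.2 (φ _).2
    refine ⟨⟨(F.iso_mem hφ e he).1, ⟨hPQ.1, hR⟩, g, hg, fun x => ?_⟩,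
      ⟨(F.iso_mem hφ e he).2, ⟨hR, hPQ.1⟩, g⁻¹, by rw [d.deg_inv, hg, neg_zero], fun y => ?_⟩⟩
    · rw [hgφ]
      exact congrArg (fun z => d.ι z * g) (he x).symm
    · have h1 := hgφ (e.symm y)
      rw [← he, e.apply_symm_apply] at h1
      rw [inv_mul_eq_iff_eq_mul, ← mul_assoc]
      exact eq_mul_inv_of_mul_eq h1.symm

variable {d} {hN : N ≤ T}

theorem isSubsystem : (d.subsystem hN).IsSubsystem F := ⟨hN, fun _ _ _ h => h.1⟩

theorem exists_deg_of_isMap (h : (d.subsystem hN).IsMap P f) :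
    ∃ g, d.deg g = 0 ∧ ∀ x ∈ P, g * d.ι x = d.ι (f x) * g := by
  obtain ⟨Q, φ, ⟨-, -, g, hg, h⟩, hf⟩ := h
  exact ⟨g, hg, fun x hx => hf ⟨x, hx⟩ ▸ h ⟨x, hx⟩⟩

theorem isMap_of_deg (h : F.IsMap P f) (hP : P ≤ N) (hf : ∀ x ∈ P, f x ∈ N) {g : Γ}
    (hg : d.deg g = 0) (hgf : ∀ x ∈ P, g * d.ι x = d.ι (f x) * g) :
    (d.subsystem hN).IsMap P f := by
  obtain ⟨Q, hQ⟩ := h.exists_isIso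
  obtain ⟨e, he, hef⟩ := hQ.exists_mulEquiv
  refine ⟨Q, _, ⟨he, ⟨hP, fun y hy => ?_⟩, g, hg, fun x => ?_⟩, hef⟩
  · obtain ⟨x, hx, rfl⟩ := (hQ.2 y).1 hy
    exact hf x hx
  · refine (hgf x x.2).trans ?_
    rw [← hef]
    rfl

/-- The elements of `T` centralizing an image of `P` lie in `N`. -/
def _root_.FusionSystem.CentralizersLE (F : FusionSystem T) (N P : Subgroup G) : Prop :=
  ∀ ψ, F.IsMap P ψ → ∀ b ∈ T, (∀ x ∈ P, b * ψ x = ψ x * b) → b ∈ N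

/-- Two elements realizing the same morphism differ by an element centralizing the image of `P` in
`Γ`, which has degree zero. -/
theorem deg_eq (hP : P ≤ T) (h : F.CentralizersLE N P) {g g' : Γ}
    (hg : ∀ x ∈ P, g * d.ι x = d.ι (f x) * g) (hg' : ∀ x ∈ P, g' * d.ι x = d.ι (f x) * g') :
    d.deg g = d.deg g' := by
  have := d.deg_centralizer hP h (g⁻¹ * g') fun x hx => by
    rw [mul_assoc, hg' x hx, inv_mul_eq_iff_eq_mul, ← mul_assoc, ← mul_assoc, hg x hx]
    simp [mul_assoc]
  rw [d.deg_mul, d.deg_inv] at this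
  linear_combination -this

/-- Some `b ∉ N` centralizes an image `ψ(P)`. If `g` realizes `ψ`, then `g⁻¹ ι(b ^ i) g` centralizes
`P` and has degree `i * deg(ι b)`, with `deg(ι b)` invertible. -/
theorem exists_centralizer_deg [Fact p.Prime] (h : ¬ F.CentralizersLE N P) (a : ZMod p) :
    ∃ g, (∀ x ∈ P, g * d.ι x = d.ι x * g) ∧ d.deg g = a := by
  simp only [CentralizersLE, not_forall] at h
  obtain ⟨ψ, hψ, b, hb, hbψ, hbN⟩ := h
  obtain ⟨g, hg⟩ := d.realize hψ
  obtain ⟨i, hi⟩ := d.exists_pow_deg hb hbN a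
  refine ⟨g⁻¹ * d.ι (b ^ i) * g, fun x hx => ?_, ?_⟩
  · have h1 : d.ι (b ^ i) * d.ι (ψ x) = d.ι (ψ x) * d.ι (b ^ i) := by
      rw [d.ι_pow hb]
      refine Commute.pow_left (?_ : Commute _ _) i
      rw [Commute, SemiconjBy, ← d.ι_mul b hb _ (hψ.mem hx), hbψ x hx,
        d.ι_mul _ (hψ.mem hx) b hb]
    have h2 : d.ι x = g⁻¹ * d.ι (ψ x) * g := by
      rw [mul_assoc, ← hg x hx]; simp
    rw [h2]
    simp only [mul_assoc, mul_inv_cancel_left]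
    rw [← mul_assoc (d.ι (b ^ i)), h1, mul_assoc]
  · rw [d.deg_mul, d.deg_mul, d.deg_inv, hi]
    ring

end

variable {d : F.DegreeModel N p Γ} {hNT : N ≤ T}

theorem isMap_of_not_centralizersLE [Fact p.Prime] (h : ¬ F.CentralizersLE N P)
    (hf : F.IsMap P f) (hP : P ≤ N) (hfN : ∀ x ∈ P, f x ∈ N) : (d.subsystem hNT).IsMap P f := by
  obtain ⟨g, hg⟩ := d.realize hf
  obtain ⟨c, hc, hcd⟩ := exists_centralizer_deg (d := d) h (- d.deg g)
  refine isMap_of_deg hf hP hfN (g := g * c) (by rw [d.deg_mul, hcd]; ring) fun x hx => ?_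
  rw [mul_assoc, hc x hx, ← mul_assoc, hg x hx, mul_assoc]

/-- If `f ^ k = 1` on `P` and `g` realizes `f`, then `g ^ k` centralizes `P`. In the rigid case of
the dichotomy this gives `k * deg g = 0` with `k` prime to `p`; in the other case every morphism
into `N` is admitted. -/
theorem isPPowerIndex [Finite G] [Fact p.Prime] (hyp : F.hyperfocal p ≤ N)
    (hcl : ∀ {P f}, F.IsMap P f → ∀ x ∈ P, (f x ∈ N ↔ x ∈ N)) :
    (d.subsystem hNT).IsPPowerIndex F p := by
  rw [isPPowerIndex_iff]
  refine ⟨isSubsystem, hyp, fun P f k hP hf hk hfk => ?_⟩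
  have hfN : ∀ x ∈ P, f x ∈ N := fun x hx => (hcl hf.1 x hx).2 (hP hx)
  by_cases h : F.CentralizersLE N P
  · obtain ⟨g, hg⟩ := d.realize hf.1
    refine isMap_of_deg hf.1 hP hfN ?_ hg
    have h1 : ∀ n : ℕ, ∀ x ∈ P, f^[n] x ∈ P ∧ g ^ n * d.ι x = d.ι (f^[n] x) * g ^ n := by
      intro n x hx
      induction n with
      | zero => simpa using hx
      | succ n ih =>
        rw [Function.iterate_succ_apply', pow_succ', mul_assoc, ih.2, ← mul_assoc, hg _ ih.1,
          mul_assoc]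
        exact ⟨hf.mem ih.1, rfl⟩
    have h2 := d.deg_centralizer hf.le h (g ^ k) fun x hx => by rw [(h1 k x hx).2, hfk x hx]
    rw [d.deg_pow] at h2
    refine (mul_eq_zero.1 h2).resolve_left fun h0 => ?_
    rw [ZMod.natCast_eq_zero_iff] at h0
    exact (Nat.Prime.coprime_iff_not_dvd Fact.out).1 hk.symm h0
  · exact isMap_of_not_centralizersLE h hf.1 hP hfN

/-- Adjust a morphism onto a fully normalized subgroup by a conjugation to obtain degree zero. -/
theorem exists_conj_deg [Finite G] [Fact p.Prime] (hne : ¬ T ≤ N) (hf : F.IsIso P Q f)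
    (hK : F.IsMap K f) (hQ : F.FullyNormalized Q) :
    ∃ s ∈ T, ∃ Q', F.IsIso P Q' (fun x => s * f x * s⁻¹) ∧ F.FullyNormalized Q' ∧
      F.IsMap K (fun x => s * f x * s⁻¹) ∧
      ∃ g, d.deg g = 0 ∧ ∀ x ∈ K, g * d.ι x = d.ι (s * f x * s⁻¹) * g := by
  obtain ⟨c, hc, hcN⟩ := SetLike.not_le_iff_exists.1 hne
  obtain ⟨g, hg⟩ := d.realize hK
  obtain ⟨i, hi⟩ := d.exists_pow_deg hc hcN (- d.deg g)
  have hs := T.pow_mem hc i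
  obtain ⟨Q', hQ'⟩ := F.isIso_conj hf.le' hs
  refine ⟨c ^ i, hs, Q', hf.comp hQ', hQ.conj hs hQ',
    hK.comp (F.isMap_conj le_rfl hs) fun x hx => hK.mem hx, d.ι (c ^ i) * g,
    by rw [d.deg_mul, hi]; ring, fun x hx => ?_⟩
  rw [mul_assoc, hg x hx, ← mul_assoc, d.ι_conj hs (hK.mem hx), mul_assoc]

/-- The element `b ∉ N` centralizing an image `R` of `P` is carried along: the isomorphism `R → Q`
extends to `R C_T(R)` because `Q` is fully centralized, and the extension preserves non-membership
in `N`. -/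
theorem exists_mem_centralizer [Finite G] (hF : F.Saturated p)
    (hcl : ∀ {P f}, F.IsMap P f → ∀ x ∈ P, (f x ∈ N ↔ x ∈ N))
    (h : ¬ F.CentralizersLE N P) (hPQ : F.IsIso P Q f) (hQ : F.FullyCentralized Q) :
    ∃ c ∈ T ⊓ Subgroup.centralizer (Q : Set G), c ∉ N := by
  simp only [CentralizersLE, not_forall] at h
  obtain ⟨ψ, hψ, b, hb, hbψ, hbN⟩ := h
  obtain ⟨R, hR⟩ := hψ.exists_isIso
  obtain ⟨ψ', hψ', -⟩ := hR.symm
  obtain ⟨k, hk, -, hkc⟩ := hF.exists_map_centralizer (hψ'.comp hPQ) hQ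
  have hbR : b ∈ T ⊓ Subgroup.centralizer (R : Set G) := by
    refine ⟨hb, Subgroup.mem_centralizer_iff.2 fun y hy => ?_⟩
    obtain ⟨x, hx, rfl⟩ := (hR.2 y).1 hy
    exact (hbψ x hx).symm
  exact ⟨k b, hkc b hbR, fun h => hbN ((hcl hk b ((le_sup_right : _ ≤ R ⊔ _) hbR)).1 h)⟩

/-- This corrects an `F`-extension to degree zero. In the rigid case its degree is already
determined by the restriction to `P`; otherwise it is followed by conjugation with an element of
`C_T(Q)` of suitable degree, which does not change it on `P`. -/
theorem exists_centralizer_isMap [Finite G] [Fact p.Prime] (hF : F.Saturated p)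
    (hcl : ∀ {P f}, F.IsMap P f → ∀ x ∈ P, (f x ∈ N ↔ x ∈ N))
    (hf : (d.subsystem hNT).IsIso P Q f) (hQ : F.FullyCentralized Q) (hPK : P ≤ K) (hKN : K ≤ N)
    (hg : F.IsMap K g) (hgf : ∀ x ∈ P, g x = f x) :
    ∃ k, (d.subsystem hNT).IsMap K k ∧ ∀ x ∈ P, k x = f x := by
  have hfF := isSubsystem.isIso hf
  have hgN : ∀ x ∈ K, g x ∈ N := fun x hx => (hcl hg x hx).2 (hKN hx)
  obtain ⟨a, ha⟩ := d.realize hg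
  by_cases h : F.CentralizersLE N P
  · obtain ⟨b, hb, hbf⟩ := exists_deg_of_isMap hf.1
    refine ⟨g, isMap_of_deg hg hKN hgN (g := a) ?_ ha, hgf⟩
    rw [← hb]
    refine deg_eq (f := f) hfF.le h (fun x hx => ?_) hbf
    rw [← hgf x hx]
    exact ha x (hPK hx)
  · obtain ⟨c, hc, hcN⟩ := exists_mem_centralizer hF hcl h hfF hQ
    obtain ⟨i, hi⟩ := d.exists_pow_deg hc.1 hcN (- d.deg a)
    have hs := pow_mem hc i
    have hcg : F.IsMap K (fun x => c ^ i * g x * (c ^ i)⁻¹) :=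
      hg.comp (F.isMap_conj le_rfl hs.1) fun x hx => hg.mem hx
    refine ⟨_, isMap_of_deg hcg hKN (fun x hx => (hcl hcg x hx).2 (hKN hx))
      (g := d.ι (c ^ i) * a) (by rw [d.deg_mul, hi]; ring) fun x hx => ?_, fun x hx => ?_⟩
    · rw [mul_assoc, ha x hx, ← mul_assoc, d.ι_conj hs.1 (hg.mem hx), mul_assoc]
    · rw [hgf x hx, ← Subgroup.mem_centralizer_iff.1 hs.2 _ (hf.mem hx)]
      simp

/-- A morphism from a fully normalized subgroup of the subsystem that extends to the normalizer
maps onto the normalizer. -/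
theorem exists_mem_normalizer [Finite G]
    (hcl : ∀ {P f}, F.IsMap P f → ∀ x ∈ P, (f x ∈ N ↔ x ∈ N))
    (hP : (d.subsystem hNT).FullyNormalized P) (hf : (d.subsystem hNT).IsIso P Q f)
    (hfN : F.IsMap (N ⊓ Subgroup.normalizer (P : Set G)) f) {y : G}
    (hy : y ∈ N ⊓ Subgroup.normalizer (Q : Set G)) :
    ∃ x ∈ N ⊓ Subgroup.normalizer (P : Set G), f x = y := by
  refine Subgroup.exists_of_card_le f (fun x hx => Subgroup.mem_inf.2 ⟨(hcl hfN x hx).2 hx.1, ?_⟩)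
    (fun x hx y hy => hfN.inj hx hy) (hP Q hf.conjugate) hy
  exact (isSubsystem.isIso hf).map_mem_normalizer (le_inf hf.le Subgroup.le_normalizer) hfN hx hx.2

/-- The comparison device for saturation: any `P ≤ N` is linked within the subsystem, on all of
`N_N(P)`, to a subgroup fully normalized in the large system `F`. -/
theorem exists_fullyNormalized_subsystem [Finite G] [Fact p.Prime] (hT : IsPGroup p T)
    (hF : F.Saturated p) (hne : ¬ T ≤ N)
    (hcl : ∀ {P f}, F.IsMap P f → ∀ x ∈ P, (f x ∈ N ↔ x ∈ N)) (hP : P ≤ N) :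
    ∃ Q f, F.FullyNormalized Q ∧ (d.subsystem hNT).IsIso P Q f ∧
      F.IsMap (T ⊓ Subgroup.normalizer (P : Set G)) f ∧
      (d.subsystem hNT).IsMap (N ⊓ Subgroup.normalizer (P : Set G)) f := by
  obtain ⟨Q, hPQ, hQ⟩ := F.exists_fullyNormalized (hP.trans hNT)
  obtain ⟨f, hf, hfN⟩ := hF.exists_map_normalizer hT (hP.trans hNT) hPQ hQ
  obtain ⟨s, hs, R, hR, hRn, hsK, g, hg, hgf⟩ := exists_conj_deg (d := d) hne hf
    hfN hQ
  have hle := inf_le_inf_right (Subgroup.normalizer (P : Set G)) hNT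
  have hm := isMap_of_deg (hN := hNT) (hsK.restrict hle) inf_le_left
    (fun x hx => (hcl hsK x (hle hx)).2 hx.1) hg fun x hx => hgf x (hle hx)
  exact ⟨R, _, hRn, ⟨hm.restrict (le_inf hP Subgroup.le_normalizer), hR.2⟩, hsK, hm⟩

/-- For a conjugate `R` of `P`, the extension axiom of `F` embeds `C_N(R)` into `C_N(Q)`. Full
normalization of `P` makes `N_N(P) → N_N(Q)` surjective, so `C_N(Q)` pulls back into `C_N(P)`. -/
theorem fullyCentralized_subsystem [Finite G] [Fact p.Prime] (hT : IsPGroup p T)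
    (hF : F.Saturated p) (hne : ¬ T ≤ N)
    (hcl : ∀ {P f}, F.IsMap P f → ∀ x ∈ P, (f x ∈ N ↔ x ∈ N)) (hP : P ≤ N)
    (hPn : (d.subsystem hNT).FullyNormalized P) : (d.subsystem hNT).FullyCentralized P := by
  obtain ⟨Q, f, hQ, hf, hfT, hfN⟩ := exists_fullyNormalized_subsystem (d := d) (hNT := hNT)
    hT hF hne hcl hP
  have hQc := hF.fullyCentralized Q (isSubsystem.isIso hf).le' hQ
  have hfFN := isSubsystem.isMap hfN
  intro R hR
  obtain ⟨r, hr⟩ := (hR.symm.trans hf.conjugate).exists_isIso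
  obtain ⟨k, hk, -, hkc⟩ := hF.exists_map_centralizer (isSubsystem.isIso hr) hQc
  have hRT : T ⊓ Subgroup.centralizer (R : Set G) ≤ R ⊔ T ⊓ Subgroup.centralizer (R : Set G) :=
    le_sup_right
  have hRN := inf_le_inf_right (Subgroup.centralizer (R : Set G)) hNT
  have h1 : Nat.card ↥(N ⊓ Subgroup.centralizer (R : Set G)) ≤
      Nat.card ↥(N ⊓ Subgroup.centralizer (Q : Set G)) := by
    refine Subgroup.card_le_of_injOn k (fun x hx => Subgroup.mem_inf.2 ⟨?_, ?_⟩) ?_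
    · exact (hcl hk x (hRT (hRN hx))).2 hx.1
    · exact (hkc x (hRN hx)).2
    · exact fun x hx y hy => hk.inj (hRT (hRN hx)) (hRT (hRN hy))
  refine h1.trans ?_
  obtain ⟨W, hW⟩ := hfFN.exists_isIso
  obtain ⟨k, hk, hkf, hfk⟩ := hW.symm
  have hCW : ∀ y ∈ N ⊓ Subgroup.centralizer (Q : Set G), y ∈ W := fun y hy =>
    (hW.2 y).2 (exists_mem_normalizer hcl hPn hf hfFN
      (Subgroup.mem_inf.2 ⟨hy.1, Subgroup.centralizer_le_normalizer _ hy.2⟩))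
  refine Subgroup.card_le_of_injOn k (fun y hy => Subgroup.mem_inf.2 ⟨?_, ?_⟩) ?_
  · exact (hk.mem (hCW y hy)).1
  · refine Subgroup.mem_centralizer_iff.2 fun x hx => ?_
    have hxN := (le_inf hP Subgroup.le_normalizer : P ≤ N ⊓ Subgroup.normalizer (P : Set G)) hx
    refine hfFN.inj (mul_mem hxN (hk.mem (hCW y hy))) (mul_mem (hk.mem (hCW y hy)) hxN) ?_
    rw [hfFN.map_mul hxN (hk.mem (hCW y hy)), hfFN.map_mul (hk.mem (hCW y hy)) hxN,
      hfk y (hCW y hy), Subgroup.mem_centralizer_iff.1 hy.2 _ (hf.mem hx)]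
  · exact fun x hx y hy => hk.1.inj (hCW x hx) (hCW y hy)

/-- The target `Q` is only fully centralized in the subsystem, so `f` is first composed with `c : Q
→ R`, where `R` is fully normalized in `F`. The composite extends to `K`, and `c` is removed again
after the image of `K` is shown to lie in `c(N_N(Q))`. -/
theorem extend_subsystem [Finite G] [Fact p.Prime] (hT : IsPGroup p T)
    (hF : F.Saturated p) (hne : ¬ T ≤ N)
    (hcl : ∀ {P f}, F.IsMap P f → ∀ x ∈ P, (f x ∈ N ↔ x ∈ N))
    (hf : (d.subsystem hNT).IsIso P Q f) (hQ : (d.subsystem hNT).FullyCentralized Q)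
    (hPK : P ≤ K) (hK : K ≤ N) (h : ∀ a ∈ K, a ∈ Subgroup.normalizer (P : Set G) ∧
      ∃ b ∈ N, ∀ x ∈ P, f (a * x * a⁻¹) = b * f x * b⁻¹) :
    ∃ k, (d.subsystem hNT).IsMap K k ∧ ∀ x ∈ P, k x = f x := by
  obtain ⟨R, c, hR, hc, hcT, hcN⟩ := exists_fullyNormalized_subsystem (d := d) (hNT := hNT)
    hT hF hne hcl hf.le'
  have hRc := hF.fullyCentralized R (isSubsystem.isIso hc).le' hR
  have hfc := hf.comp hc
  have hbn : ∀ a ∈ Subgroup.normalizer (P : Set G), ∀ b : G,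
      (∀ x ∈ P, f (a * x * a⁻¹) = b * f x * b⁻¹) → b ∈ Subgroup.normalizer (Q : Set G) := by
    intro a ha b hb
    refine Subgroup.mem_normalizer_fintype fun y hy => ?_
    obtain ⟨x, hx, rfl⟩ := (hf.2 y).1 hy
    rw [← hb x hx]
    exact hf.mem ((Subgroup.mem_normalizer_iff.1 ha x).1 hx)
  have hQN : Q ≤ N ⊓ Subgroup.normalizer (Q : Set G) := le_inf hf.le' Subgroup.le_normalizer
  obtain ⟨k, hk, hkf⟩ := hF.exists_extension (isSubsystem.isIso hfc) hRc hPK (hK.trans hNT)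
    (by
      intro a ha
      obtain ⟨haP, b, hb, hab⟩ := h a ha
      have hbQ := Subgroup.mem_inf.2 ⟨hb, hbn a haP b hab⟩
      refine ⟨haP, c b, hNT (hcN.mem hbQ), fun x hx => ?_⟩
      rw [hab x hx, hcN.map_conj hbQ (hQN (hf.mem hx))])
  obtain ⟨k, hk, hkf⟩ := exists_centralizer_isMap hF hcl hfc hRc hPK hK hk hkf
  -- `k a` and `c b` act alike on `R`, so `(c b)⁻¹ k a ∈ C_N(R)`. By counting, `c` maps `C_N(Q)`
  -- onto `C_N(R)` since `Q` is fully centralized.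
  have hkW : ∀ a ∈ K, ∃ y ∈ N ⊓ Subgroup.normalizer (Q : Set G), c y = k a := by
    intro a ha
    obtain ⟨haP, b, hb, hab⟩ := h a ha
    have hbQ := Subgroup.mem_inf.2 ⟨hb, hbn a haP b hab⟩
    have hz : (c b)⁻¹ * k a ∈ N ⊓ Subgroup.centralizer (R : Set G) := by
      refine Subgroup.mem_inf.2 ⟨mul_mem (inv_mem (hcN.mem hbQ)) (hk.mem ha),
        Subgroup.mem_centralizer_iff.2 fun y hy => ?_⟩
      obtain ⟨x, hx, rfl⟩ := (hfc.2 y).1 hy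
      dsimp only
      have h1 : k (a * x * a⁻¹) = k a * k x * (k a)⁻¹ := hk.map_conj ha (hPK hx)
      have h2 := (Subgroup.mem_normalizer_iff.1 haP x).1 hx
      rw [hkf _ h2, hkf x hx, hab x hx, hcN.map_conj hbQ (hQN (hf.mem hx)),
        mul_inv_eq_iff_eq_mul] at h1
      have h3 : c (f x) = (c b)⁻¹ * (k a * c (f x) * (k a)⁻¹ * c b) := by
        rw [← h1, inv_mul_cancel_left]
      nth_rewrite 1 [h3]
      group
    obtain ⟨z, hz, hcz⟩ := Subgroup.exists_of_card_le (A := N ⊓ Subgroup.centralizer (Q : Set G)) c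
      (fun x hx => Subgroup.mem_inf.2 ⟨hcN.mem (Subgroup.mem_inf.2 ⟨hx.1,
        Subgroup.centralizer_le_normalizer _ hx.2⟩), Subgroup.mem_centralizer_iff.2 fun y hy => by
          obtain ⟨w, hw, rfl⟩ := (hc.2 y).1 hy
          have hxQ := Subgroup.mem_inf.2 ⟨hx.1, Subgroup.centralizer_le_normalizer _ hx.2⟩
          rw [← hcN.map_mul (hQN hw) hxQ, ← hcN.map_mul hxQ (hQN hw),
            Subgroup.mem_centralizer_iff.1 hx.2 w hw]⟩)
      (fun x hx y hy => hcN.inj (Subgroup.mem_inf.2 ⟨hx.1,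
        Subgroup.centralizer_le_normalizer _ hx.2⟩) (Subgroup.mem_inf.2 ⟨hy.1,
        Subgroup.centralizer_le_normalizer _ hy.2⟩)) (hQ R hc.conjugate) hz
    have hzQ := Subgroup.mem_inf.2 ⟨hz.1, Subgroup.centralizer_le_normalizer _ hz.2⟩
    refine ⟨b * z, mul_mem hbQ hzQ, ?_⟩
    rw [hcN.map_mul hbQ hzQ, hcz, mul_inv_cancel_left]
  obtain ⟨W, hW⟩ := hcN.exists_isIso
  obtain ⟨c', hc', hc'c, -⟩ := hW.symm
  refine ⟨fun x => c' (k x), hk.comp hc'.1 fun x hx => (hW.2 _).2 (hkW x hx), fun x hx => ?_⟩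
  dsimp only
  rw [hkf x hx, hc'c _ (hQN (hf.mem hx))]

/-- This is the maximality of `Aut_N(P)` among `p`-subgroups. On a subgroup `R` fully normalized in
`F`, the group `B` acts through `T`, by a degree argument even through `N`; surjectivity of `N_N(P)
→ N_N(R)` brings the conjugating elements back. -/
theorem autConj_subsystem_of_le [Finite G] [Fact p.Prime] (hF : F.Saturated p) (hne : ¬ T ≤ N)
    (hcl : ∀ {P f}, F.IsMap P f → ∀ x ∈ P, (f x ∈ N ↔ x ∈ N)) (hP : P ≤ N)
    (hPn : (d.subsystem hNT).FullyNormalized P) (B : Subgroup (MulAut P))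
    (hB : B ≤ (d.subsystem hNT).aut P hP) (hBp : IsPGroup p B) (hPB : autConj N P ≤ B) :
    B ≤ autConj N P := by
  obtain ⟨Q, hPQ, hQ⟩ := F.exists_fullyNormalized (hP.trans hNT)
  obtain ⟨f, hf, hfB⟩ := hF.exists_isIso_autConj (hP.trans hNT) hPQ hQ B
    (fun β hβ => (hB hβ).1) hBp
  obtain ⟨s, hs, R, hR, hRn, -, g, hg, hgf⟩ := exists_conj_deg (d := d) hne hf hf.1 hQ
  have hfB : ∀ β ∈ B, ∃ t ∈ T, ∀ x : P,
      s * f (β x) * s⁻¹ = t * (s * f x * s⁻¹) * t⁻¹ := by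
    intro β hβ
    obtain ⟨t, ht, h⟩ := hfB β hβ
    refine ⟨s * t * s⁻¹, mul_mem (mul_mem hs ht) (inv_mem hs), fun x => ?_⟩
    rw [h x]
    group
  generalize hk : (fun x => s * f x * s⁻¹) = k at hR
  have hkx : ∀ x, s * f x * s⁻¹ = k x := fun x => congrFun hk x
  simp only [hkx] at hfB hgf
  have hRc := hF.fullyCentralized R hR.le' hRn
  have hkN : (d.subsystem hNT).IsIso P R k := ⟨isMap_of_deg hR.1 hP
    (fun x hx => (hcl hR.1 x hx).2 (hP hx)) hg hgf, hR.2⟩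
  -- In the rigid case `t` must have degree zero, as `β` and `k` do. Otherwise `t` is multiplied by
  -- an element of `C_T(R)` that cancels its degree.
  have hfB' : ∀ β ∈ B, ∃ t ∈ N, ∀ x : P, k (β x) = t * k x * t⁻¹ := by
    intro β hβ
    obtain ⟨t, ht, h⟩ := hfB β hβ
    obtain ⟨b, hb, hβb⟩ := exists_isIso_of_mem_aut (hB hβ)
    by_cases hc : F.CentralizersLE N P
    · obtain ⟨a, ha, hab⟩ := exists_deg_of_isMap hb.1
      refine ⟨t, (d.deg_ι t ht).1 ?_, h⟩
      have h1 := deg_eq (d := d) (f := fun x => k (b x)) hR.le hc (g := g * a)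
        (g' := d.ι t * g) (fun x hx => ?_) fun x hx => ?_
      · rw [d.deg_mul, d.deg_mul, ha, hg] at h1
        simpa using h1.symm
      · rw [mul_assoc, hab x hx, ← mul_assoc, hgf _ (hb.mem hx), mul_assoc]
      · rw [mul_assoc, hgf x hx, ← mul_assoc, d.ι_conj ht (hR.1.mem hx), ← hβb ⟨x, hx⟩,
          h ⟨x, hx⟩, mul_assoc]
    · obtain ⟨c, hc, hcN⟩ := exists_mem_centralizer hF hcl hc hR hRc
      obtain ⟨i, hi⟩ := d.exists_pow_deg hc.1 hcN (- d.deg (d.ι t))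
      have hci := pow_mem hc i
      refine ⟨t * c ^ i, (d.deg_ι _ (mul_mem ht hci.1)).1 ?_, fun x => ?_⟩
      · rw [d.ι_mul t ht _ hci.1, d.deg_mul, hi]
        ring
      · have h1 := Subgroup.mem_centralizer_iff.1 hci.2 _ (hR.mem x.2)
        have h2 : t * c ^ i * k x * (t * c ^ i)⁻¹ = t * (c ^ i * k x) * (c ^ i)⁻¹ * t⁻¹ := by
          group
        rw [h x, h2, ← h1]
        group
  have hPN : P ≤ N ⊓ Subgroup.normalizer (P : Set G) := le_inf hP Subgroup.le_normalizer
  obtain ⟨l, hl, hlk⟩ := hF.exists_extension hR hRc hPN (inf_le_left.trans hNT) (by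
    rintro a ⟨ha, haP⟩
    obtain ⟨t, ht, h⟩ := hfB' (P.normalizerMonoidHom ⟨a, haP⟩) (hPB ⟨a, ha, fun x => rfl⟩)
    exact ⟨haP, t, hNT ht, fun x hx => h ⟨x, hx⟩⟩)
  intro β hβ
  obtain ⟨t, ht, h⟩ := hfB' β hβ
  have htR : t ∈ Subgroup.normalizer (R : Set G) := by
    refine Subgroup.mem_normalizer_fintype fun y hy => ?_
    obtain ⟨x, hx, rfl⟩ := (hR.2 y).1 hy
    rw [← h ⟨x, hx⟩]
    exact hR.mem (β ⟨x, hx⟩).2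
  obtain ⟨x, hx, hxt⟩ := exists_mem_normalizer hcl hPn
    (hkN.congr fun x hx => (hlk x hx).symm) hl (Subgroup.mem_inf.2 ⟨ht, htR⟩)
  refine ⟨x, hx.1, fun y => hl.inj (hPN (β y).2) ?_ ?_⟩
  · exact hPN ((Subgroup.mem_normalizer_iff.1 hx.2 y).1 y.2)
  · rw [hl.map_conj hx (hPN y.2), hxt, hlk _ (β y).2, hlk _ y.2, h]

theorem saturated_subsystem [Finite G] [Fact p.Prime] (hT : IsPGroup p T)
    (hF : F.Saturated p) (hne : ¬ T ≤ N)
    (hcl : ∀ {P f}, F.IsMap P f → ∀ x ∈ P, (f x ∈ N ↔ x ∈ N)) :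
    (d.subsystem hNT).Saturated p where
  fullyCentralized P hP hPn := fullyCentralized_subsystem hT hF hne hcl hP hPn
  sylow P hP hPn := by
    refine ⟨⟨(autConj N P).subgroupOf ((d.subsystem hNT).aut P hP), ?_, ?_⟩, rfl⟩
    · exact (isPGroup_autConj (hT.to_le hNT)).comap_of_injective _ Subtype.val_injective
    · intro B hB hle
      refine le_antisymm ?_ hle
      refine Subgroup.map_le_iff_le_comap.1 ?_
      refine autConj_subsystem_of_le hF hne hcl hP hPn _ ?_ (hB.map _) ?_
      · rintro _ ⟨β, -, rfl⟩
        exact β.2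
      · intro β hβ
        exact ⟨⟨β, autConj_le_aut hP hβ⟩, hle hβ, rfl⟩
  extend P Q e he hQ := by
    obtain ⟨f, hf⟩ := exists_extend e.toMonoidHom
    have hf : ∀ x : P, (e x : G) = f x := hf
    have hfi := isIso_of_mem he hf
    have hPe : P ≤ extensionDomain N e := fun a ha => (mem_extensionDomain_iff hf).2
      ⟨hfi.le ha, Subgroup.le_normalizer ha, f a, hfi.1.mem ha, fun x hx => hfi.1.map_conj ha hx⟩
    obtain ⟨k, hk, hkf⟩ := extend_subsystem hT hF hne hcl hfi hQ (K := extensionDomain N e)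
      hPe (fun a ha => ((mem_extensionDomain_iff hf).1 ha).1)
      fun a ha => ((mem_extensionDomain_iff hf).1 ha).2
    obtain ⟨ψ, hψ, hψk⟩ := hk.exists_hom
    refine ⟨ψ, hψ, fun x y hxy => ?_⟩
    rw [hψk, hxy, hkf x x.2, hf]

end DegreeModel

end FusionSystem

/-! ### Cocycles, marks and fixed points of group actions -/

section Actions

/-- A homomorphism to an additive group that is trivial on the stabilizers in an orbit is the
coboundary of a function on that orbit. -/
theorem exists_equivariant {L X A : Type*} [Group L] [AddCommGroup A] (ρ : L →* Equiv.Perm X)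
    (κ : L → A) (hκ : ∀ g h, κ (g * h) = κ g + κ h) :
    ∃ φ : X → A, ∀ x, (∀ g, ρ g x = x → κ g = 0) → ∀ g, φ (ρ g x) = κ g + φ x := by
  let s : Setoid X :=
    { r := fun x y => ∃ g, ρ g x = y
      iseqv := ⟨fun x => ⟨1, by simp⟩, fun {x y} ⟨g, hg⟩ => ⟨g⁻¹, by simp [← hg]⟩,
        fun {x y z} ⟨g, hg⟩ ⟨h, hh⟩ => ⟨h * g, by simp [hg, hh]⟩⟩ }
  have hrep : ∀ x : X, ∃ g, ρ g (Quotient.mk s x).out = x := fun x =>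
    (Quotient.exact (Quotient.out_eq (Quotient.mk s x)) : s.r _ _)
  choose l hl using hrep
  refine ⟨fun x => κ (l x), fun x hx g => ?_⟩
  have h1 : (Quotient.mk s (ρ g x)) = Quotient.mk s x :=
    Quotient.sound (show s.r _ _ from ⟨g⁻¹, by simp⟩)
  have h2 := hl (ρ g x)
  rw [h1] at h2
  have h3 : κ 1 = 0 := by
    have := hκ 1 1
    simpa using this
  have hinv : ∀ a, κ a⁻¹ = - κ a := fun a => by
    have := hκ a⁻¹ a
    rw [inv_mul_cancel, h3] at this
    exact eq_neg_of_add_eq_zero_left this.symm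
  -- Both `l x` and `l (ρ g x)` start from the same orbit representative, so this element fixes `x`
  -- and its value under `κ` vanishes.
  have h4 := hx (l x * ((l (ρ g x))⁻¹ * g)) (by
    rw [map_mul, map_mul, Equiv.Perm.mul_apply, Equiv.Perm.mul_apply, map_inv,
      Equiv.Perm.inv_eq_iff_eq.2 h2.symm, hl x])
  rw [hκ, hκ, hinv] at h4
  have h5 : κ (l (ρ g x)) = κ g + κ (l x) := by
    rw [← sub_eq_zero, ← neg_eq_zero, ← h4]
    abel
  exact h5

/-- A partial form of Burnside's theorem on marks. -/
theorem exists_equivariant_injOn {L X : Type*} [Group L] [Finite L] [Finite X]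
    (ρ σ : L →* Equiv.Perm X) (A B : Set X)
    (hA : ∀ l, ∀ x ∈ A, ρ l x ∈ A) (hB : ∀ l, ∀ x ∈ B, σ l x ∈ B)
    (h : ∀ K : Subgroup L, {x ∈ A | ∀ k ∈ K, ρ k x = x}.ncard =
      {y ∈ B | ∀ k ∈ K, σ k y = y}.ncard) :
    ∃ e : X → X, (∀ x ∈ A, e x ∈ B) ∧ Set.InjOn e A ∧ ∀ l, ∀ x ∈ A, e (ρ l x) = σ l (e x) := by
  classical
  generalize hn : A.ncard = n
  induction n using Nat.strong_induction_on generalizing A B with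
  | _ n ih =>
    rcases A.eq_empty_or_nonempty with rfl | hne
    · exact ⟨id, by simp, by simp, by simp⟩
    · let st : X → Subgroup L := fun x =>
        { carrier := {l | ρ l x = x}
          one_mem' := by simp
          mul_mem' := fun {a b} (ha : ρ a x = x) (hb : ρ b x = x) => by simp [ha, hb]
          inv_mem' := fun {a} (ha : ρ a x = x) => by
            change ρ a⁻¹ x = x
            rw [map_inv, Equiv.Perm.inv_eq_iff_eq, ha] }
      let st' : X → Subgroup L := fun x =>
        { carrier := {l | σ l x = x}
          one_mem' := by simp
          mul_mem' := fun {a b} (ha : σ a x = x) (hb : σ b x = x) => by simp [ha, hb]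
          inv_mem' := fun {a} (ha : σ a x = x) => by
            change σ a⁻¹ x = x
            rw [map_inv, Equiv.Perm.inv_eq_iff_eq, ha] }
      -- For a maximal stabilizer, equality of marks gives `y ∈ B` with at least the stabilizer of
      -- `x`, and then a point of `A` with at least that of `y`. So the stabilizers of `x` and `y`
      -- coincide, and both orbits can be split off.
      obtain ⟨x, hxA, hx⟩ := Set.exists_max_image A (fun x => Nat.card (st x)) (Set.toFinite _) hne
      have hpos : 0 < {y ∈ B | ∀ k ∈ st x, σ k y = y}.ncard := by
        rw [← h, Set.ncard_pos]
        exact ⟨x, hxA, fun k hk => hk⟩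
      obtain ⟨y, hyB, hy⟩ := (Set.ncard_pos (Set.toFinite _)).1 hpos
      have hpos' : 0 < {x ∈ A | ∀ k ∈ st' y, ρ k x = x}.ncard := by
        rw [h, Set.ncard_pos]
        exact ⟨y, hyB, fun k hk => hk⟩
      obtain ⟨x', hxA', hx'⟩ := (Set.ncard_pos (Set.toFinite _)).1 hpos'
      have hst : st x = st' y := by
        refine Subgroup.eq_of_le_of_card_ge hy ?_
        exact (Subgroup.card_le_of_le hx').trans (hx x' hxA')
      have hst : ∀ l, ρ l x = x ↔ σ l y = y := fun l => (SetLike.ext_iff.1 hst l)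
      have hst2 : ∀ l m, ρ l x = ρ m x ↔ σ l y = σ m y := by
        intro l m
        have := hst (m⁻¹ * l)
        rw [map_mul, map_mul, Equiv.Perm.mul_apply, Equiv.Perm.mul_apply, map_inv, map_inv,
          Equiv.Perm.inv_eq_iff_eq, Equiv.Perm.inv_eq_iff_eq] at this
        exact this
      have hstk : ∀ k l, ρ k (ρ l x) = ρ l x ↔ σ k (σ l y) = σ l y := by
        intro k l
        have := hst2 (k * l) l
        rwa [map_mul, map_mul] at this
      let t : X → X := fun z => if hz : ∃ l, ρ l x = z then σ hz.choose y else y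
      have ht : ∀ l, t (ρ l x) = σ l y := by
        intro l
        have hz : ∃ m, ρ m x = ρ l x := ⟨l, rfl⟩
        have : t (ρ l x) = σ hz.choose y := dif_pos hz
        rw [this, ← hst2, hz.choose_spec]
      have hOA : ∀ K : Subgroup L, {z ∈ A | ∀ k ∈ K, ρ k z = z}.ncard =
          {z ∈ A \ Set.range (fun l => ρ l x) | ∀ k ∈ K, ρ k z = z}.ncard +
          {z ∈ Set.range (fun l => ρ l x) | ∀ k ∈ K, ρ k z = z}.ncard := by
        intro K
        rw [← Set.ncard_union_eq]
        · congr 1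
          ext z
          simp only [Set.mem_ofPred_eq, Set.mem_union, Set.mem_sdiff]
          have : z ∈ Set.range (fun l => ρ l x) → z ∈ A := by
            rintro ⟨l, rfl⟩
            exact hA l x hxA
          tauto
        · refine Set.disjoint_left.2 fun z hz hz' => hz.1.2 hz'.1
      have hOB : ∀ K : Subgroup L, {z ∈ B | ∀ k ∈ K, σ k z = z}.ncard =
          {z ∈ B \ Set.range (fun l => σ l y) | ∀ k ∈ K, σ k z = z}.ncard +
          {z ∈ Set.range (fun l => σ l y) | ∀ k ∈ K, σ k z = z}.ncard := by
        intro K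
        rw [← Set.ncard_union_eq]
        · congr 1
          ext z
          simp only [Set.mem_ofPred_eq, Set.mem_union, Set.mem_sdiff]
          have : z ∈ Set.range (fun l => σ l y) → z ∈ B := by
            rintro ⟨l, rfl⟩
            exact hB l y hyB
          tauto
        · refine Set.disjoint_left.2 fun z hz hz' => hz.1.2 hz'.1
      have hO : ∀ K : Subgroup L, {z ∈ Set.range (fun l => ρ l x) | ∀ k ∈ K, ρ k z = z}.ncard =
          {z ∈ Set.range (fun l => σ l y) | ∀ k ∈ K, σ k z = z}.ncard := by
        intro K
        refine Set.ncard_congr (fun z _ => t z) ?_ ?_ ?_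
        · rintro _ ⟨⟨l, rfl⟩, hl⟩
          refine ⟨⟨l, (ht l).symm⟩, fun k hk => ?_⟩
          have := hl k hk
          dsimp only at this ⊢
          rw [ht, ← hstk, this]
        · rintro _ _ ⟨⟨l, rfl⟩, -⟩ ⟨⟨m, rfl⟩, -⟩ hlm
          dsimp only at hlm ⊢
          rwa [ht, ht, ← hst2] at hlm
        · rintro _ ⟨⟨l, rfl⟩, hl⟩
          exact ⟨ρ l x, ⟨⟨l, rfl⟩, fun k hk => (hstk k l).2 (hl k hk)⟩, ht l⟩
      obtain ⟨e, he, hei, hee⟩ := ih _ (by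
        rw [← hn]
        refine Set.ncard_lt_ncard ?_
        refine Set.sdiff_ssubset_left_iff.2 ⟨x, hxA, 1, by simp⟩)
        (A \ Set.range (fun l => ρ l x)) (B \ Set.range (fun l => σ l y))
        (by
          rintro l z ⟨hz, hz'⟩
          refine ⟨hA l z hz, ?_⟩
          rintro ⟨m, hm⟩
          refine hz' ⟨l⁻¹ * m, ?_⟩
          dsimp only at hm ⊢
          rw [map_mul, map_inv, Equiv.Perm.mul_apply, hm]
          simp)
        (by
          rintro l z ⟨hz, hz'⟩
          refine ⟨hB l z hz, ?_⟩
          rintro ⟨m, hm⟩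
          refine hz' ⟨l⁻¹ * m, ?_⟩
          dsimp only at hm ⊢
          rw [map_mul, map_inv, Equiv.Perm.mul_apply, hm]
          simp)
        (fun K => by
          have h1 := h K
          rw [hOA, hOB, hO] at h1
          exact Nat.add_right_cancel h1) rfl
      refine ⟨fun z => if z ∈ Set.range (fun l => ρ l x) then t z else e z, ?_, ?_, ?_⟩
      · intro z hz
        dsimp only
        split_ifs with hzr
        · obtain ⟨l, rfl⟩ := hzr
          dsimp only
          rw [ht]
          exact hB l y hyB
        · exact (he z ⟨hz, hzr⟩).1
      · intro z hz w hw hzw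
        dsimp only at hzw
        split_ifs at hzw with h1 h2 h2
        · obtain ⟨l, rfl⟩ := h1
          obtain ⟨m, rfl⟩ := h2
          dsimp only at hzw ⊢
          rwa [ht, ht, ← hst2] at hzw
        · obtain ⟨l, rfl⟩ := h1
          dsimp only at hzw
          rw [ht] at hzw
          exact absurd ⟨l, hzw⟩ (he w ⟨hw, h2⟩).2
        · obtain ⟨l, rfl⟩ := h2
          dsimp only at hzw
          rw [ht] at hzw
          exact absurd ⟨l, hzw.symm⟩ (he z ⟨hz, h1⟩).2
        · exact hei ⟨hz, h1⟩ ⟨hw, h2⟩ hzw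
      · intro l z hz
        dsimp only
        have hiff : ρ l z ∈ Set.range (fun l => ρ l x) ↔ z ∈ Set.range (fun l => ρ l x) := by
          constructor
          · rintro ⟨m, hm⟩
            refine ⟨l⁻¹ * m, ?_⟩
            dsimp only at hm ⊢
            rw [map_mul, map_inv, Equiv.Perm.mul_apply, hm]
            simp
          · rintro ⟨m, rfl⟩
            exact ⟨l * m, by simp⟩
        by_cases hzr : z ∈ Set.range (fun l => ρ l x)
        · rw [if_pos hzr, if_pos (hiff.2 hzr)]
          obtain ⟨m, rfl⟩ := hzr
          dsimp only
          rw [ht, ← Equiv.Perm.mul_apply, ← map_mul, ht, map_mul, Equiv.Perm.mul_apply]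
        · rw [if_neg hzr, if_neg (mt hiff.1 hzr)]
          exact hee l z ⟨hz, hzr⟩

/-- Two actions of a finite group on a finite set are isomorphic if all subgroups have the same
number of fixed points. -/
theorem exists_equivariant_perm {L X : Type*} [Group L] [Finite L] [Finite X]
    (ρ σ : L →* Equiv.Perm X) (h : ∀ K : Subgroup L, {x | ∀ k ∈ K, ρ k x = x}.ncard =
      {x | ∀ k ∈ K, σ k x = x}.ncard) :
    ∃ e : Equiv.Perm X, ∀ l x, e (ρ l x) = σ l (e x) := by
  obtain ⟨e, -, hei, hee⟩ := exists_equivariant_injOn ρ σ Set.univ Set.univ (by simp) (by simp)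
    (by simpa using h)
  have hb : Function.Bijective e := Finite.injective_iff_bijective.1 (Set.injOn_univ.1 hei)
  exact ⟨Equiv.ofBijective e hb, fun l x => hee l x (Set.mem_univ _)⟩

/-- The sum of an invariant function modulo `p` is concentrated on the fixed points. -/
theorem IsPGroup.sum_eq_sum_fixed {Q B : Type*} [Group Q] [MulAction Q B] [Fintype B] {p : ℕ}
    [Fact p.Prime] (hQ : IsPGroup p Q) (d : B → ZMod p) (hd : ∀ (q : Q) b, d (q • b) = d b)
    [DecidablePred fun b : B => ∀ q : Q, q • b = b] :
    ∑ b, d b = ∑ b with ∀ q : Q, q • b = b, d b := by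
  classical
  -- Grouping by values reduces the claim to the fixed point congruence on each level set of `d`.
  have key : ∀ s : Finset B, ∑ b ∈ s, d b = ∑ c, ((s.filter (fun b => d b = c)).card : ZMod p) * c := by
    intro s
    rw [← Finset.sum_fiberwise s d d]
    refine Finset.sum_congr rfl fun c _ => ?_
    rw [Finset.sum_congr rfl (g := fun _ => c) fun b hb => (Finset.mem_filter.1 hb).2]
    simp
  rw [key, key]
  refine Finset.sum_congr rfl fun c _ => ?_
  congr 1
  rw [ZMod.natCast_eq_natCast_iff]
  let X : SubMulAction Q B := ⟨{b | d b = c}, fun q {b} hb => (hd q b).trans hb⟩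
  have h1 := hQ.card_modEq_card_fixedPoints X
  have h2 : Nat.card X = (Finset.univ.filter fun b => d b = c).card := by
    rw [← Fintype.card_subtype, ← Nat.card_eq_fintype_card]
    rfl
  have h3 : Nat.card (MulAction.fixedPoints Q X) =
      ((Finset.univ.filter fun b : B => ∀ q : Q, q • b = b).filter fun b => d b = c).card := by
    rw [Finset.filter_filter, ← Fintype.card_subtype, ← Nat.card_eq_fintype_card]
    refine Nat.card_congr ⟨fun x => ⟨x.1.1, fun q => congrArg Subtype.val (x.2 q), x.1.2⟩,
      fun x => ⟨⟨x.1, x.2.2⟩, fun q => Subtype.ext (x.2.1 q)⟩, fun x => rfl, fun x => rfl⟩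
  rwa [h2, h3] at h1

end Actions

/-! ### Stable sets with graph stabilizers -/

namespace FusionSystem

variable {G : Type*} [Group G] {T N : Subgroup G} {p : ℕ}
variable {F : FusionSystem T} {P Q R K : Subgroup G} {f g : G → G}

/-- The subgroup `D` of `T × T` is the graph of a morphism of `F`. -/
def IsGraph (F : FusionSystem T) (D : Subgroup (T × T)) : Prop :=
  ∃ P f, F.IsMap P f ∧ ∀ d : T × T, d ∈ D ↔ (d.1 : G) ∈ P ∧ (d.2 : G) = f d.1

/-- The fixed points of a subgroup of `T × T`. -/
def fixedSet {H : Type*} [Group H] (D : Subgroup H) (Ω : Type*) [MulAction H Ω] : Set Ω :=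
  {ω | ∀ d ∈ D, d • ω = ω}

/-- All stabilizers of points are graphs of morphisms of `F`. -/
def HasGraphStabilizers (F : FusionSystem T) (Ω : Type*) [MulAction (T × T) Ω] : Prop :=
  ∀ ω : Ω, F.IsGraph (MulAction.stabilizer (T × T) ω)

/-- Graphs of order greater than `n` with the same second projection have the same number of
fixed points. -/
def StableAbove (F : FusionSystem T) (Ω : Type*) [MulAction (T × T) Ω] (n : ℕ) : Prop :=
  ∀ D D' : Subgroup (T × T), F.IsGraph D → F.IsGraph D' → n < Nat.card D →
    D.map (MonoidHom.snd T T) = D'.map (MonoidHom.snd T T) →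
    (fixedSet D Ω).ncard = (fixedSet D' Ω).ncard

/-- `D'` is obtained from `D` by applying `f` to the first coordinate. -/
def IsTwist (f : G → G) (D D' : Subgroup (T × T)) : Prop :=
  ∀ e : T × T, e ∈ D' ↔ ∃ d ∈ D, (e.1 : G) = f d.1 ∧ e.2 = d.2

variable {D D' : Subgroup (T × T)}

theorem IsGraph.of_le (h : F.IsGraph D) (hD : D' ≤ D) : F.IsGraph D' := by
  obtain ⟨P, f, hf, h⟩ := h
  have hle : (D'.map (MonoidHom.fst T T)).map T.subtype ≤ P := by
    rintro _ ⟨_, ⟨d, hd, rfl⟩, rfl⟩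
    exact ((h d).1 (hD hd)).1
  refine ⟨(D'.map (MonoidHom.fst T T)).map T.subtype, f, hf.restrict hle, fun d => ?_⟩
  constructor
  · intro hd
    exact ⟨⟨_, ⟨d, hd, rfl⟩, rfl⟩, ((h d).1 (hD hd)).2⟩
  · rintro ⟨⟨_, ⟨e, he, rfl⟩, h1⟩, h2⟩
    have h1 : e.1 = d.1 := Subtype.ext h1
    have h3 := ((h e).1 (hD he)).2
    have : d = e := Prod.ext h1.symm (Subtype.ext (by rw [h2, h3, h1]))
    exact this ▸ he

theorem IsTwist.isGraph_iff (hf : F.IsMap P f) (hD : ∀ d ∈ D, (d.1 : G) ∈ P)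
    (h : IsTwist f D D') : F.IsGraph D ↔ F.IsGraph D' := by
  constructor
  · rintro ⟨Q, k, hk, hkD⟩
    have hQP : Q ≤ P := fun x hx => hD (⟨x, hk.le hx⟩, ⟨k x, hk.mem hx⟩) ((hkD _).2 ⟨hx, rfl⟩)
    obtain ⟨R, hR⟩ := (hf.restrict hQP).exists_isIso
    obtain ⟨f', hf', hff', -⟩ := hR.symm
    refine ⟨R, fun x => k (f' x), hf'.1.comp hk fun x hx => hf'.mem hx, fun e => ?_⟩
    rw [h]
    constructor
    · rintro ⟨d, hd, h1, h2⟩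
      have hd' := (hkD d).1 hd
      rw [h1, h2]
      dsimp only
      rw [hff' _ hd'.1]
      exact ⟨hR.mem hd'.1, hd'.2⟩
    · rintro ⟨h1, h2⟩
      obtain ⟨x, hx, hxe⟩ := (hR.2 _).1 h1
      dsimp only at h2
      rw [← hxe, hff' x hx] at h2
      exact ⟨(⟨x, hk.le hx⟩, e.2), (hkD _).2 ⟨hx, h2⟩, hxe.symm, rfl⟩
  · rintro ⟨Q, k, hk, hkD⟩
    let P' := (D.map (MonoidHom.fst T T)).map T.subtype
    have hP' : P' ≤ P := by
      rintro _ ⟨_, ⟨d, hd, rfl⟩, rfl⟩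
      exact hD d hd
    have hmem : ∀ d ∈ D, f d.1 ∈ Q ∧ (d.2 : G) = k (f d.1) := fun d hd =>
      (hkD (⟨f d.1, hf.mem (hD d hd)⟩, d.2)).1 ((h _).2 ⟨d, hd, rfl, rfl⟩)
    refine ⟨P', fun x => k (f x), (hf.restrict hP').comp hk ?_, fun d => ⟨fun hd => ?_, ?_⟩⟩
    · rintro _ ⟨_, ⟨d, hd, rfl⟩, rfl⟩
      exact (hmem d hd).1
    · exact ⟨⟨_, ⟨d, hd, rfl⟩, rfl⟩, (hmem d hd).2⟩
    · rintro ⟨⟨_, ⟨e, he, rfl⟩, h1⟩, h2⟩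
      have h1 : e.1 = d.1 := Subtype.ext h1
      have h3 := (hmem e he).2
      have : d = e := Prod.ext h1.symm (Subtype.ext (by rw [h2, h3, h1]))
      exact this ▸ he

theorem IsTwist.map_snd (hf : F.IsMap P f) (hD : ∀ d ∈ D, (d.1 : G) ∈ P) (h : IsTwist f D D') :
    D.map (MonoidHom.snd T T) = D'.map (MonoidHom.snd T T) := by
  ext b
  constructor
  · rintro ⟨d, hd, rfl⟩
    exact ⟨(⟨f d.1, hf.mem (hD d hd)⟩, d.2), (h _).2 ⟨d, hd, rfl, rfl⟩, rfl⟩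
  · rintro ⟨e, he, rfl⟩
    obtain ⟨d, hd, -, h2⟩ := (h e).1 he
    exact ⟨d, hd, h2.symm⟩

theorem HasGraphStabilizers.fixedSet_eq_empty {Ω : Type*} [MulAction (T × T) Ω]
    (hΩ : F.HasGraphStabilizers Ω) (hD : ¬ F.IsGraph D) : fixedSet D Ω = ∅ := by
  rw [Set.eq_empty_iff_forall_notMem]
  intro ω hω
  exact hD ((hΩ ω).of_le fun d hd => hω d hd)

/-- Stability speaks only of graphs, but a subgroup that is not a graph has no fixed points, and
twisting preserves being a graph. So all subgroups are covered, as Burnside's theorem demands. -/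
theorem StableAbove.ncard_twist {Ω : Type*} [MulAction (T × T) Ω] {n : ℕ}
    (hΩ : F.HasGraphStabilizers Ω) (hs : F.StableAbove Ω n) (hf : F.IsMap P f)
    (hD : ∀ d ∈ D, (d.1 : G) ∈ P) (h : IsTwist f D D') (hn : n < Nat.card D) :
    (fixedSet D Ω).ncard = (fixedSet D' Ω).ncard := by
  by_cases hg : F.IsGraph D
  · exact hs D D' hg ((h.isGraph_iff hf hD).1 hg) hn (h.map_snd hf hD)
  · rw [hΩ.fixedSet_eq_empty hg, hΩ.fixedSet_eq_empty (mt (h.isGraph_iff hf hD).2 hg)]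

theorem HasGraphStabilizers.right_free {Ω : Type*} [MulAction (T × T) Ω]
    (hΩ : F.HasGraphStabilizers Ω) {b : T} {ω : Ω} (h : ((1, b) : T × T) • ω = ω) : b = 1 := by
  obtain ⟨P, f, hf, hD⟩ := hΩ ω
  have := ((hD (1, b)).1 h).2
  exact Subtype.ext (this.trans hf.map_one)

/-- The homomorphism applying `f` to the first coordinate. -/
def IsMap.twist (hf : F.IsMap P f) : ((P.subgroupOf T).prod (⊤ : Subgroup T)) →* T × T where
  toFun d := (⟨f d.1.1, hf.mem d.2.1⟩, d.1.2)
  map_one' := Prod.ext (Subtype.ext hf.map_one) rfl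
  map_mul' d e := Prod.ext (Subtype.ext (hf.map_mul d.2.1 e.2.1)) rfl

/-- In a stable set, morphisms are realized by permutations commuting with the right action. -/
theorem StableAbove.exists_perm [Finite G] {Ω : Type*} [Finite Ω] [MulAction (T × T) Ω]
    (hΩ : F.HasGraphStabilizers Ω) (hs : F.StableAbove Ω 0) (hf : F.IsMap P f) :
    ∃ e : Equiv.Perm Ω, ∀ (a b a' : T) (ω : Ω), (a : G) ∈ P → (a' : G) = f a →
      e ((a, b) • ω) = (a', b) • e ω := by
  let L := (P.subgroupOf T).prod (⊤ : Subgroup T)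
  -- The two actions of `P × T` on `Ω`, the given one and the one twisted by `f`, have equal marks.
  obtain ⟨e, he⟩ := exists_equivariant_perm (L := L) (X := Ω)
    ((MulAction.toPermHom (T × T) Ω).comp L.subtype)
    ((MulAction.toPermHom (T × T) Ω).comp hf.twist) (fun K => by
      have := hs.ncard_twist hΩ hf (D := K.map L.subtype) (D' := K.map hf.twist) ?_ ?_ Nat.card_pos
      · convert this using 2
        · ext ω
          constructor
          · rintro h _ ⟨d, hd, rfl⟩
            exact h d hd
          · intro h k hk
            exact h k ⟨k, hk, rfl⟩
        · ext ω
          constructor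
          · rintro h _ ⟨d, hd, rfl⟩
            exact h d hd
          · intro h k hk
            exact h _ ⟨k, hk, rfl⟩
      · rintro _ ⟨d, -, rfl⟩
        exact d.2.1
      · intro e
        constructor
        · rintro ⟨d, hd, rfl⟩
          exact ⟨d, ⟨d, hd, rfl⟩, rfl, rfl⟩
        · rintro ⟨_, ⟨d, hd, rfl⟩, h1, h2⟩
          exact ⟨d, hd, Prod.ext (Subtype.ext h1.symm) h2.symm⟩)
  refine ⟨e, fun a b a' ω ha ha' => ?_⟩
  have h1 := he ⟨(a, b), ⟨ha, Subgroup.mem_top _⟩⟩ ω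
  have h2 : a' = ⟨f a, hf.mem ha⟩ := Subtype.ext ha'
  rw [h2]
  exact h1

end FusionSystem

/-! ### Right equivariant permutations and their degree -/

namespace FusionSystem

variable {G : Type*} [Group G] {T N : Subgroup G} {p : ℕ}
variable {F : FusionSystem T} {P Q R K : Subgroup G} {f g : G → G}

section RightEquivariant

variable (T) (Ω : Type*) [MulAction (T × T) Ω]

/-- The permutations commuting with the right action. -/
def rightEquivariant : Subgroup (Equiv.Perm Ω) where
  carrier := {e | ∀ (b : T) ω, e (((1, b) : T × T) • ω) = ((1, b) : T × T) • e ω}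
  one_mem' := fun b ω => rfl
  mul_mem' := fun {e e'} he he' b ω => by
    rw [Equiv.Perm.mul_apply, he', he, Equiv.Perm.mul_apply]
  inv_mem' := fun {e} he b ω => by
    rw [Equiv.Perm.inv_eq_iff_eq, he, ← Equiv.Perm.mul_apply, mul_inv_cancel, Equiv.Perm.one_apply]

/-- The orbit relation of the right action. -/
def rightSetoid : Setoid Ω where
  r ω ω' := ∃ b : T, ((1, b) : T × T) • ω = ω'
  iseqv :=
    ⟨fun ω => ⟨1, one_smul (T × T) ω⟩,
      fun {ω ω'} ⟨b, hb⟩ => ⟨b⁻¹, by rw [← hb, smul_smul]; simp [← Prod.one_eq_mk]⟩,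
      fun {ω ω' ω''} ⟨b, hb⟩ ⟨c, hc⟩ => ⟨c * b, by rw [← hc, ← hb, smul_smul]; simp⟩⟩

variable {T Ω}

theorem rightEquivariant_apply (e : rightEquivariant T Ω) (b : T) (ω : Ω) :
    e.1 (((1, b) : T × T) • ω) = ((1, b) : T × T) • e.1 ω := e.2 b ω

/-- The permutation of the right orbits induced by a right equivariant permutation. -/
def orbitMap (e : rightEquivariant T Ω) :
    Quotient (rightSetoid T Ω) → Quotient (rightSetoid T Ω) :=
  Quotient.map e.1 fun ω ω' ⟨b, hb⟩ => ⟨b, by rw [← hb, rightEquivariant_apply]⟩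

theorem orbitMap_mul (e e' : rightEquivariant T Ω)
    (b : Quotient (rightSetoid T Ω)) : orbitMap (e * e') b = orbitMap e (orbitMap e' b) := by
  induction b using Quotient.inductionOn
  rfl

theorem orbitMap_one (b : Quotient (rightSetoid T Ω)) :
    orbitMap (1 : rightEquivariant T Ω) b = b := by
  induction b using Quotient.inductionOn
  rfl

theorem orbitMap_bijective (e : rightEquivariant T Ω) :
    Function.Bijective (orbitMap e) := by
  refine Function.bijective_iff_has_inverse.2 ⟨orbitMap e⁻¹, fun b => ?_, fun b => ?_⟩
  · rw [← orbitMap_mul, inv_mul_cancel, orbitMap_one]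
  · rw [← orbitMap_mul, mul_inv_cancel, orbitMap_one]

variable {A : Type*} [AddCommGroup A] (φ : Ω → A)

/-- The difference `φ (e ω) - φ ω` as a function on the right orbits. -/
def orbitDiff (hφ : ∃ κ : T → A, ∀ (b : T) ω, φ (((1, b) : T × T) • ω) = κ b + φ ω)
    (e : rightEquivariant T Ω) : Quotient (rightSetoid T Ω) → A :=
  Quotient.lift (fun ω => φ (e.1 ω) - φ ω) (by
    rintro ω _ ⟨b, rfl⟩
    obtain ⟨κ, hκ⟩ := hφ
    simp only [rightEquivariant_apply, hκ]
    abel)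

theorem orbitDiff_mul (hφ : ∃ κ : T → A, ∀ (b : T) ω, φ (((1, b) : T × T) • ω) = κ b + φ ω)
    (e e' : rightEquivariant T Ω) (b : Quotient (rightSetoid T Ω)) :
    orbitDiff φ hφ (e * e') b = orbitDiff φ hφ e (orbitMap e' b) + orbitDiff φ hφ e' b := by
  induction b using Quotient.inductionOn with
  | _ ω =>
    change φ (e.1 (e'.1 ω)) - φ ω = φ (e.1 (e'.1 ω)) - φ (e'.1 ω) + (φ (e'.1 ω) - φ ω)
    abel

theorem card_eq_card_mul_card_rightOrbits [Finite Ω]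
    (hfree : ∀ (b : T) (ω : Ω), ((1, b) : T × T) • ω = ω → b = 1) :
    Nat.card Ω = Nat.card T * Nat.card (Quotient (rightSetoid T Ω)) := by
  rw [← Nat.card_prod]
  refine (Nat.card_congr (Equiv.ofBijective
    (fun x : T × Quotient (rightSetoid T Ω) => ((1, x.1) : T × T) • x.2.out) ⟨?_, ?_⟩)).symm
  · rintro ⟨a, x⟩ ⟨b, y⟩ h
    have hxy : x = y := by
      have h1 : ∀ (c : T) (z : Quotient (rightSetoid T Ω)),
          Quotient.mk (rightSetoid T Ω) (((1, c) : T × T) • z.out) = z := fun c z => by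
        conv_rhs => rw [← Quotient.out_eq z]
        exact (Quotient.sound (show (rightSetoid T Ω).r _ _ from ⟨c, rfl⟩)).symm
      rw [← h1 a x, ← h1 b y]
      exact congrArg _ h
    subst hxy
    dsimp only at h
    have := hfree (b⁻¹ * a) x.out (by
      have h2 := congrArg (fun z => ((1, b⁻¹) : T × T) • z) h
      simp only [smul_smul, Prod.mk_mul_mk, mul_one, inv_mul_cancel] at h2
      rw [h2]
      exact one_smul (T × T) _)
    rw [inv_mul_eq_one.1 this]
  · intro ω
    obtain ⟨b, hb⟩ : (rightSetoid T Ω).r (Quotient.mk (rightSetoid T Ω) ω).out ω :=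
      Quotient.exact (Quotient.out_eq _)
    exact ⟨(b, _), hb⟩

end RightEquivariant

section Degree

variable {Ω : Type*} [MulAction (T × T) Ω]

/-- Left multiplication by an element of `T`. -/
def leftMul (T : Subgroup G) (Ω : Type*) [MulAction (T × T) Ω] (a : T) : rightEquivariant T Ω :=
  ⟨MulAction.toPerm ((a, 1) : T × T), fun b ω => by simp [smul_smul]⟩

/-- The vanishing of the degree on centralizers. -/
theorem sum_orbitDiff_eq_zero [Fact p.Prime] [Finite Ω] [Fintype (Quotient (rightSetoid T Ω))]
    (hT : IsPGroup p T)
    (hΩ : F.HasGraphStabilizers Ω) {δ : T → ZMod p} (hδ : ∀ a b, δ (a * b) = δ a + δ b)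
    (hδN : ∀ a : T, (a : G) ∈ N → δ a = 0) {φ : Ω → ZMod p}
    (hφ : ∀ (a b : T) ω, φ (((a, b) : T × T) • ω) = (δ a - δ b) + φ ω)
    (hφ' : ∃ κ : T → ZMod p, ∀ (b : T) ω, φ (((1, b) : T × T) • ω) = κ b + φ ω)
    (hP : P ≤ T) (hPN : F.CentralizersLE N P) (e : rightEquivariant T Ω)
    (he : ∀ x : T, (x : G) ∈ P → e * leftMul T Ω x = leftMul T Ω x * e) :
    ∑ b, orbitDiff φ hφ' e b = 0 := by
  classical
  have he' : ∀ x : T, (x : G) ∈ P → ∀ ω, e.1 (((x, 1) : T × T) • ω) = ((x, 1) : T × T) • e.1 ω :=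
    fun x hx ω => DFunLike.congr_fun (congrArg Subtype.val (he x hx)) ω
  let _ : MulAction T (Quotient (rightSetoid T Ω)) :=
    { smul := fun a => orbitMap (leftMul T Ω a)
      one_smul := fun b => by
        induction b using Quotient.inductionOn with
        | _ ω => exact congrArg (Quotient.mk _) (one_smul (T × T) ω)
      mul_smul := fun a a' b => by
        induction b using Quotient.inductionOn with
        | _ ω =>
          refine congrArg (Quotient.mk _) ?_
          change ((a * a', 1) : T × T) • ω = ((a, 1) : T × T) • ((a', 1) : T × T) • ω
          simp [smul_smul] }
  have hsmul : ∀ (a : T) (ω : Ω), a • (Quotient.mk (rightSetoid T Ω) ω) =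
      Quotient.mk (rightSetoid T Ω) (((a, 1) : T × T) • ω) := fun a ω => rfl
  -- As `e` commutes with `P`, the summand is `P`-invariant, and modulo `p` only the right orbits
  -- fixed by `P` contribute.
  rw [(hT.to_subgroup (P.subgroupOf T)).sum_eq_sum_fixed (orbitDiff φ hφ' e) (by
    rintro ⟨q, hq⟩ b
    induction b using Quotient.inductionOn with
    | _ ω =>
      change φ (e.1 (((q, 1) : T × T) • ω)) - φ (((q, 1) : T × T) • ω) = φ (e.1 ω) - φ ω
      rw [he' q hq, hφ, hφ]
      ring)]
  -- a cocycle on the fixed points that only depends on the associated morphism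
  let C : Subgroup (rightEquivariant T Ω) :=
    { carrier := {e | ∀ x : T, (x : G) ∈ P → ∀ ω, e.1 (((x, 1) : T × T) • ω) =
        ((x, 1) : T × T) • e.1 ω}
      one_mem' := fun x _ ω => rfl
      mul_mem' := fun {e e'} he he' x hx ω => by
        change e.1 (e'.1 _) = _ • e.1 (e'.1 _)
        rw [he' x hx, he x hx]
      inv_mem' := fun {e} he x hx ω => by
        change e.1⁻¹ _ = _ • e.1⁻¹ _
        rw [Equiv.Perm.inv_eq_iff_eq, he x hx, ← Equiv.Perm.mul_apply, mul_inv_cancel,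
          Equiv.Perm.one_apply] }
  let ρ : C × T →* Equiv.Perm Ω :=
    MonoidHom.noncommCoprod ((rightEquivariant T Ω).subtype.comp C.subtype)
      ((MulAction.toPermHom (T × T) Ω).comp (MonoidHom.inr T T)) (by
        intro c b
        ext ω
        exact c.1.2 b ω)
  have hρ : ∀ (c : C) (b : T) (ω : Ω), ρ (c, b) ω = c.1.1 (((1, b) : T × T) • ω) :=
    fun c b ω => rfl
  have hδ1 : δ 1 = 0 := hδN 1 N.one_mem
  obtain ⟨θ, hθ⟩ := exists_equivariant ρ (fun x => - δ x.2) (fun x y => by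
    rw [Prod.snd_mul, hδ]; ring)
  -- The points whose right orbit is fixed by `P`; their stabilizers are graphs of morphisms defined
  -- on `P`.
  let Y : Set Ω := {ω | ∀ x : T, (x : G) ∈ P → ∃ b : T, ((x, b) : T × T) • ω = ω}
  -- If `(c, b)` fixes `ω` and the stabilizer of `ω` is the graph of `f`, comparing the actions of
  -- `(x, f x)` and using freeness on the right shows that `b` commutes with `f x` for `x ∈ P`.
  -- Hence `b ∈ N` by the centralizer hypothesis.
  have hY : ∀ ω ∈ Y, ∀ g, ρ g ω = ω → - δ g.2 = 0 := by
    rintro ω hω ⟨c, b⟩ hcb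
    rw [hρ, rightEquivariant_apply] at hcb
    obtain ⟨P', f, hf, hst⟩ := hΩ ω
    have hPP' : P ≤ P' := fun x hx => by
      obtain ⟨b, hb⟩ := hω ⟨x, hP hx⟩ hx
      exact ((hst _).1 hb).1
    rw [hδN, neg_zero]
    refine hPN f (hf.restrict hPP') b b.2 fun x hx => ?_
    let y : T := ⟨f x, hf.mem (hPP' hx)⟩
    have h1 : ((⟨x, hP hx⟩, y) : T × T) • ω = ω := (hst _).2 ⟨hPP' hx, rfl⟩
    have h2 : ((⟨x, hP hx⟩, 1) : T × T) • ω = ((1, y⁻¹) : T × T) • ω := by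
      conv_rhs => rw [← h1]
      simp [smul_smul]
    have h3 : ((⟨x, hP hx⟩, y) : T × T) • c.1.1 ω = c.1.1 ω := by
      have h4 : ((⟨x, hP hx⟩, y) : T × T) • c.1.1 ω =
          ((1, y) : T × T) • ((⟨x, hP hx⟩, 1) : T × T) • c.1.1 ω := by simp [smul_smul]
      rw [h4, ← c.2 _ hx, ← rightEquivariant_apply, h2, smul_smul]
      simp [← Prod.one_eq_mk]
    have h5 : ((1, y * b * y⁻¹ * b⁻¹) : T × T) • ω = ω := by
      have h6 : ω = ((1, b) : T × T) • c.1.1 ω := hcb.symm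
      have h7 : ((1, b⁻¹) : T × T) • ω = c.1.1 ω := by
        conv_lhs => rw [h6]
        simp [smul_smul, ← Prod.one_eq_mk]
      have h8 : ((1, y * b * y⁻¹ * b⁻¹) : T × T) • ω =
          ((1, y * b * y⁻¹) : T × T) • ((1, b⁻¹) : T × T) • ω := by simp [smul_smul]
      rw [h8, h7, ← h3, smul_smul]
      have h9 : ((1, y * b * y⁻¹) : T × T) * (⟨x, hP hx⟩, y) =
        (⟨x, hP hx⟩, y) * (1, b) := by ext <;> simp
      rw [h9, mul_smul, hcb, h1]
    have h6 := hΩ.right_free h5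
    have h7 : b * y = y * b := by
      rw [mul_inv_eq_one, mul_inv_eq_iff_eq_mul] at h6
      exact h6.symm
    exact congrArg Subtype.val h7
  have hθ' : ∀ ω ∈ Y, ∀ (c : C) (b : T), θ (c.1.1 (((1, b) : T × T) • ω)) = - δ b + θ ω :=
    fun ω hω c b => hθ ω (hY ω hω) (c, b)
  have hYfix : ∀ ω, (∀ q : P.subgroupOf T, q • (Quotient.mk (rightSetoid T Ω) ω) =
      Quotient.mk (rightSetoid T Ω) ω) → ω ∈ Y := by
    intro ω h x hx
    obtain ⟨b, hb⟩ : (rightSetoid T Ω).r (((x, 1) : T × T) • ω) ω := Quotient.exact (h ⟨x, hx⟩)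
    exact ⟨b, by simpa [smul_smul] using hb⟩
  -- On `Y` the functions `φ` and `θ` transform alike on the right, and `θ` is unchanged by `e`. So
  -- the summand is `u(e b) - u(b)` on fixed orbits, and the sum telescopes because `e` permutes
  -- them.
  let u : Quotient (rightSetoid T Ω) → ZMod p := fun b => φ b.out - θ b.out
  have hu : ∀ ω ∈ Y, u (Quotient.mk _ ω) = φ ω - θ ω := by
    intro ω hω
    obtain ⟨b, hb⟩ : (rightSetoid T Ω).r ω (Quotient.mk (rightSetoid T Ω) ω).out :=
      Quotient.exact (Quotient.out_eq _).symm
    have h1 := hθ' ω hω 1 b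
    have h2 := hφ 1 b ω
    change θ (((1, b) : T × T) • ω) = _ at h1
    rw [hb] at h1 h2
    change φ _ - θ _ = _
    rw [h1, h2, hδ1]
    ring
  have hYe : ∀ ω ∈ Y, e.1 ω ∈ Y := by
    intro ω hω x hx
    obtain ⟨b, hb⟩ := hω x hx
    refine ⟨b, ?_⟩
    have h4 : ((x, b) : T × T) • e.1 ω = ((1, b) : T × T) • ((x, 1) : T × T) • e.1 ω := by
      simp [smul_smul]
    rw [h4, ← he' x hx, ← rightEquivariant_apply, smul_smul]
    simpa using congrArg e.1 hb
  have hd : ∀ b : Quotient (rightSetoid T Ω), (∀ q : P.subgroupOf T, q • b = b) →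
      orbitDiff φ hφ' e b = u (orbitMap e b) - u b := by
    intro b
    induction b using Quotient.inductionOn with
    | _ ω =>
      intro hb
      have hω := hYfix ω hb
      change φ (e.1 ω) - φ ω = u (Quotient.mk _ (e.1 ω)) - u (Quotient.mk _ ω)
      have h1 := hθ' ω hω ⟨e, he'⟩ 1
      have h2 : ((1, 1) : T × T) • ω = ω := one_smul (T × T) ω
      rw [h2, hδ1] at h1
      change θ (e.1 ω) = _ at h1
      rw [hu _ hω, hu _ (hYe ω hω), h1]
      ring
  rw [Finset.sum_congr rfl fun b hb => hd b (Finset.mem_filter.1 hb).2, Finset.sum_sub_distrib,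
    sub_eq_zero]
  refine Finset.sum_bijective (orbitMap e) (orbitMap_bijective e) (fun b => ?_) fun b _ => rfl
  simp only [Finset.mem_filter, Finset.mem_univ, true_and]
  refine forall_congr' fun q => ?_
  have h1 : q • orbitMap e b = orbitMap e (q • b) := by
    induction b using Quotient.inductionOn with
    | _ ω => exact congrArg (Quotient.mk _) (he' q.1 q.2 ω).symm
  rw [h1, (orbitMap_bijective e).1.eq_iff]

/-- A stable set provides a realization with a degree. -/
theorem exists_degreeModel [Finite G] [hp : Fact p.Prime] [Finite Ω] (hT : IsPGroup p T)
    (hΩ : F.HasGraphStabilizers Ω) (hs : F.StableAbove Ω 0)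
    (hcard : ¬ p * Nat.card T ∣ Nat.card Ω) {δ : T → ZMod p}
    (hδ : ∀ a b, δ (a * b) = δ a + δ b) (hδN : ∀ a : T, δ a = 0 ↔ (a : G) ∈ N)
    (hδf : ∀ P f, F.IsMap P f → ∀ a b : T, (a : G) ∈ P → (b : G) = f a → δ b = δ a) :
    Nonempty (F.DegreeModel N p (rightEquivariant T Ω)) := by
  classical
  have := Fintype.ofFinite (Quotient (rightSetoid T Ω))
  have hδ1 : δ 1 = 0 := (hδN 1).2 N.one_mem
  -- The cocycle `δ a - δ b` is trivial on stabilizers because these are graphs of morphisms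
  -- preserving `δ`.
  obtain ⟨φ, hφ⟩ := exists_equivariant (MulAction.toPermHom (T × T) Ω)
    (fun d => δ d.1 - δ d.2) (fun x y => by
      rw [Prod.fst_mul, Prod.snd_mul, hδ, hδ]; ring)
  have hφ : ∀ (a b : T) ω, φ (((a, b) : T × T) • ω) = (δ a - δ b) + φ ω := by
    intro a b ω
    refine hφ ω ?_ (a, b)
    intro d hd
    obtain ⟨P, f, hf, hst⟩ := hΩ ω
    have h := (hst d).1 hd
    rw [hδf P f hf d.1 d.2 h.1 h.2, sub_self]
  have hφ' : ∃ κ : T → ZMod p, ∀ (b : T) ω, φ (((1, b) : T × T) • ω) = κ b + φ ω :=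
    ⟨fun b => δ 1 - δ b, fun b ω => hφ 1 b ω⟩
  have hmul : ∀ (a b : T), leftMul T Ω (a * b) = leftMul T Ω a * leftMul T Ω b := by
    intro a b
    ext ω
    change ((a * b, 1) : T × T) • ω = ((a, 1) : T × T) • ((b, 1) : T × T) • ω
    simp [smul_smul]
  have hcard' : ((Nat.card (Quotient (rightSetoid T Ω)) : ℕ) : ZMod p) ≠ 0 := by
    rw [Ne, ZMod.natCast_eq_zero_iff]
    intro h
    refine hcard ?_
    rw [card_eq_card_mul_card_rightOrbits (fun b ω => hΩ.right_free), mul_comm]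
    exact mul_dvd_mul_left _ h
  refine ⟨⟨fun x => if hx : x ∈ T then leftMul T Ω ⟨x, hx⟩ else 1,
    fun e => ∑ b, orbitDiff φ hφ' e b, ?_, ?_, ?_, ?_, ?_⟩⟩
  · intro x hx y hy
    rw [dif_pos hx, dif_pos hy, dif_pos (T.mul_mem hx hy), ← hmul]
    rfl
  · intro e e'
    simp only [orbitDiff_mul, Finset.sum_add_distrib]
    congr 1
    exact Function.Bijective.sum_comp (orbitMap_bijective e') (fun b => orbitDiff φ hφ' e b)
  · intro x hx
    -- Left multiplication by `x` shifts `φ` by the constant `δ x`, so its degree is `δ x` times the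
    -- number of right orbits, which is invertible modulo `p`.
    rw [dif_pos hx, ← hδN ⟨x, hx⟩, Finset.sum_congr rfl (g := fun _ => δ ⟨x, hx⟩)]
    · rw [Finset.sum_const, Finset.card_univ, ← Nat.card_eq_fintype_card, nsmul_eq_mul,
        mul_eq_zero, or_iff_right hcard']
    · intro b _
      induction b using Quotient.inductionOn with
      | _ ω =>
        change φ (((⟨x, hx⟩, 1) : T × T) • ω) - φ ω = _
        rw [hφ, hδ1]
        ring
  · intro P f hf
    obtain ⟨e, he⟩ := hs.exists_perm hΩ hf
    refine ⟨⟨e, fun b ω => he 1 b 1 ω P.one_mem hf.map_one.symm⟩, fun x hx => ?_⟩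
    rw [dif_pos (hf.le hx), dif_pos (hf.mem hx)]
    ext ω
    exact he ⟨x, hf.le hx⟩ 1 ⟨f x, hf.mem hx⟩ ω hx rfl
  · intro P hP hPN e he
    refine sum_orbitDiff_eq_zero hT hΩ hδ (fun a ha => (hδN a).2 ha) hφ hφ' hP hPN e fun x hx => ?_
    have := he x hx
    rwa [dif_pos x.2] at this

end Degree

end FusionSystem

/-! ### A congruence between marks -/

section Marks

/-- The orbit counting lemma for `E` acting on the fixed points of `D`: there `e` fixes exactly the
points fixed by `D` and `e` together. -/
theorem card_dvd_sum_fixed {E X : Type*} [Group E] [Fintype E] [Finite X] (ρ : E →* Equiv.Perm X)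
    (D : Subgroup E) [D.Normal] :
    Fintype.card E ∣ ∑ e : E, {x | ∀ d ∈ D ⊔ Subgroup.zpowers e, ρ d x = x}.ncard := by
  classical
  have hinv : ∀ (e : E) (x : {x | ∀ d ∈ D, ρ d x = x}), ∀ d ∈ D, ρ d (ρ e x) = ρ e x := by
    intro e x d hd
    have h1 := x.2 (e⁻¹ * d * e) (by simpa using ‹D.Normal›.conj_mem d hd e⁻¹)
    rw [map_mul, map_mul, Equiv.Perm.mul_apply, Equiv.Perm.mul_apply, map_inv,
      Equiv.Perm.inv_eq_iff_eq] at h1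
    exact h1
  let _ : MulAction E {x | ∀ d ∈ D, ρ d x = x} :=
    { smul := fun e x => ⟨ρ e x, hinv e x⟩
      one_smul := fun x => Subtype.ext (by change ρ 1 x.1 = x.1; simp)
      mul_smul := fun e e' x => Subtype.ext (by change ρ (e * e') x.1 = ρ e (ρ e' x.1); simp) }
  have := Fintype.ofFinite {x | ∀ d ∈ D, ρ d x = x}
  have := Fintype.ofFinite (Quotient (MulAction.orbitRel E {x | ∀ d ∈ D, ρ d x = x}))
  have h := MulAction.sum_card_fixedBy_eq_card_orbits_mul_card_group E {x | ∀ d ∈ D, ρ d x = x}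
  rw [Finset.sum_congr rfl (g := fun e : E =>
    Fintype.card (MulAction.fixedBy {x | ∀ d ∈ D, ρ d x = x} e))]
  · exact h ▸ dvd_mul_left _ _
  · intro e _
    rw [← Nat.card_eq_fintype_card]
    change Nat.card {x | ∀ d ∈ D ⊔ Subgroup.zpowers e, ρ d x = x} = _
    refine Nat.card_congr ⟨fun x => ⟨⟨x.1, fun d hd => x.2 d (Subgroup.mem_sup_left hd)⟩,
      Subtype.ext (x.2 e (Subgroup.mem_sup_right (Subgroup.mem_zpowers e)))⟩,
      fun x => ⟨x.1.1, ?_⟩, fun x => rfl, fun x => rfl⟩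
    let S : Subgroup E :=
      { carrier := {l | ρ l x.1.1 = x.1.1}
        one_mem' := by simp
        mul_mem' := fun {a b} (ha : ρ a _ = _) (hb : ρ b _ = _) => by simp [ha, hb]
        inv_mem' := fun {a} (ha : ρ a _ = _) => by
          change ρ a⁻¹ _ = _
          rw [map_inv, Equiv.Perm.inv_eq_iff_eq, ha] }
    have hle : D ⊔ Subgroup.zpowers e ≤ S := by
      refine sup_le (fun d hd => x.1.2 d hd) ((Subgroup.zpowers_le).2 ?_)
      exact congrArg Subtype.val x.2
    exact fun d hd => hle hd

/-- If two actions have the same number of fixed points for all subgroups strictly containing the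
normal subgroup `D`, then the numbers of fixed points of `D` are congruent. -/
theorem card_mul_ncard_fixed_modEq {E X : Type*} [Group E] [Finite E] [Finite X]
    (ρ σ : E →* Equiv.Perm X) (D : Subgroup E) [D.Normal]
    (h : ∀ Z : Subgroup E, D < Z → {x | ∀ d ∈ Z, ρ d x = x}.ncard =
      {x | ∀ d ∈ Z, σ d x = x}.ncard) :
    Nat.card D * {x | ∀ d ∈ D, ρ d x = x}.ncard ≡
      Nat.card D * {x | ∀ d ∈ D, σ d x = x}.ncard [MOD Nat.card E] := by
  classical
  have := Fintype.ofFinite E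
  -- The elements of `D` contribute `|D|` equal terms; every other term belongs to a subgroup
  -- strictly above `D`, where the two actions agree.
  have key : ∀ ρ : E →* Equiv.Perm X,
      ∑ e : E, {x | ∀ d ∈ D ⊔ Subgroup.zpowers e, ρ d x = x}.ncard =
        Nat.card D * {x | ∀ d ∈ D, ρ d x = x}.ncard +
          ∑ e : E with e ∉ D, {x | ∀ d ∈ D ⊔ Subgroup.zpowers e, ρ d x = x}.ncard := by
    intro ρ
    rw [← Finset.sum_filter_add_sum_filter_not Finset.univ (fun e => e ∈ D)]
    congr 1
    rw [Finset.sum_congr rfl (g := fun _ => {x | ∀ d ∈ D, ρ d x = x}.ncard)]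
    · rw [Finset.sum_const, smul_eq_mul, ← Fintype.card_subtype, ← Nat.card_eq_fintype_card]
    · intro e he
      rw [sup_eq_left.2 ((Subgroup.zpowers_le).2 (Finset.mem_filter.1 he).2)]
  have h1 := (Nat.modEq_zero_iff_dvd.2 (card_dvd_sum_fixed ρ D)).trans
    (Nat.modEq_zero_iff_dvd.2 (card_dvd_sum_fixed σ D)).symm
  rw [key ρ, key σ, Finset.sum_congr rfl fun e he => h (D ⊔ Subgroup.zpowers e) ?_] at h1
  · rw [← Nat.card_eq_fintype_card] at h1
    exact Nat.ModEq.add_right_cancel' _ h1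
  · refine lt_of_le_of_ne le_sup_left fun h => (Finset.mem_filter.1 he).2 ?_
    rw [h]
    exact Subgroup.mem_sup_right (Subgroup.mem_zpowers e)

end Marks

/-! ### Fixed points on coset spaces and congruences between graphs -/

namespace FusionSystem

section FixedSet

variable {H : Type*} [Group H] {Ω Ω' : Type*} [MulAction H Ω] [MulAction H Ω']

theorem ncard_fixedSet_sum [Finite Ω] [Finite Ω'] (D : Subgroup H) :
    (fixedSet D (Ω ⊕ Ω')).ncard = (fixedSet D Ω).ncard + (fixedSet D Ω').ncard := by
  have : fixedSet D (Ω ⊕ Ω') = Sum.inl '' fixedSet D Ω ∪ Sum.inr '' fixedSet D Ω' := by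
    ext (x | x) <;> simp [fixedSet]
  rw [this, Set.ncard_union_eq, Set.ncard_image_of_injective _ Sum.inl_injective,
    Set.ncard_image_of_injective _ Sum.inr_injective]
  exact Set.disjoint_left.2 (by rintro _ ⟨x, -, rfl⟩ ⟨y, -, h⟩; simp at h)

theorem ncard_fixedSet_conj (D : Subgroup H) (h : H) :
    (fixedSet (D.map (MulAut.conj h).toMonoidHom) Ω).ncard = (fixedSet D Ω).ncard := by
  have : fixedSet (D.map (MulAut.conj h).toMonoidHom) Ω = (fun ω => h • ω) '' fixedSet D Ω := by
    ext ω
    constructor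
    · intro hω
      refine ⟨h⁻¹ • ω, fun d hd => ?_, by simp⟩
      have := hω _ ⟨d, hd, rfl⟩
      simp only [MulEquiv.coe_toMonoidHom, MulAut.conj_apply, mul_smul] at this
      exact eq_inv_smul_iff.2 this
    · rintro ⟨ω, hω, rfl⟩ _ ⟨d, hd, rfl⟩
      simp only [MulEquiv.coe_toMonoidHom, MulAut.conj_apply, smul_smul, inv_mul_cancel_right]
      rw [mul_smul, hω d hd]
  rw [this, Set.ncard_image_of_injective _ (MulAction.injective h)]

theorem ncard_fixedSet_quotient [Finite H] (D : Subgroup H) :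
    (fixedSet D (H ⧸ D)).ncard * Nat.card D = Nat.card (Subgroup.normalizer (D : Set H)) := by
  have h1 : (fixedSet D (H ⧸ D)).ncard =
      Nat.card (Subgroup.normalizer (D : Set H) ⧸ D.subgroupOf (Subgroup.normalizer (D : Set H))) := by
    refine Eq.trans ?_ (Nat.card_congr (Sylow.fixedPointsMulLeftCosetsEquivQuotient D))
    change Nat.card (fixedSet D (H ⧸ D)) = _
    exact Nat.card_congr ⟨fun x => ⟨x.1, fun d => x.2 d d.2⟩, fun x => ⟨x.1, fun d hd => x.2 ⟨d, hd⟩⟩,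
      fun x => rfl, fun x => rfl⟩
  rw [h1, Subgroup.card_eq_card_quotient_mul_card_subgroup
    (D.subgroupOf (Subgroup.normalizer (D : Set H)))]
  congr 1
  exact (Nat.card_congr (Subgroup.subgroupOfEquivOfLe Subgroup.le_normalizer).toEquiv).symm

/-- A fixed coset `hD` puts `D'` inside the conjugate of `D` by `h`, and the orders force equality.
So an added orbit `H / D` affects, among subgroups of order at least `|D|`, only the conjugates of
`D`. -/
theorem exists_conj_of_fixedSet_quotient [Finite H] {D D' : Subgroup H}
    (hc : Nat.card D ≤ Nat.card D') (h : (fixedSet D' (H ⧸ D)).Nonempty) :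
    ∃ h, D' = D.map (MulAut.conj h).toMonoidHom := by
  obtain ⟨x, hx⟩ := h
  obtain ⟨h, rfl⟩ := QuotientGroup.mk_surjective x
  refine ⟨h, Subgroup.eq_of_le_of_card_ge (fun d hd => ?_) ?_⟩
  · have := hx d hd
    have h1 : ((d * h : H) : H ⧸ D) = h := this
    rw [eq_comm, QuotientGroup.eq] at h1
    exact ⟨_, h1, by simp [mul_assoc]⟩
  · refine le_trans (le_of_eq ?_) hc
    exact (Nat.card_congr (D.equivMapOfInjective _ (MulAut.conj h).injective).toEquiv).symm

theorem card_normalizer_conj (D : Subgroup H) (h : H) :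
    Nat.card (Subgroup.normalizer ((D.map (MulAut.conj h).toMonoidHom : Subgroup H) : Set H)) =
      Nat.card (Subgroup.normalizer (D : Set H)) := by
  have : Subgroup.normalizer ((D.map (MulAut.conj h).toMonoidHom : Subgroup H) : Set H) =
      (Subgroup.normalizer (D : Set H)).map (MulAut.conj h).toMonoidHom := by
    exact (Subgroup.map_equiv_normalizer_eq D (MulAut.conj h)).symm
  rw [this]
  exact (Nat.card_congr ((Subgroup.normalizer (D : Set H)).equivMapOfInjective _
    (MulAut.conj h).injective).toEquiv).symm

theorem card_conj (D : Subgroup H) (h : H) :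
    Nat.card (D.map (MulAut.conj h).toMonoidHom) = Nat.card D :=
  (Nat.card_congr (D.equivMapOfInjective _ (MulAut.conj h).injective).toEquiv).symm

end FixedSet

variable {G : Type*} [Group G] {T N : Subgroup G} {p : ℕ}
variable {F : FusionSystem T} {P Q R K : Subgroup G} {f g : G → G}
variable {D D' : Subgroup (T × T)}

/-- The graph of a morphism. -/
def IsMap.graph (hf : F.IsMap P f) : Subgroup (T × T) where
  carrier := {d | (d.1 : G) ∈ P ∧ (d.2 : G) = f d.1}
  one_mem' := ⟨P.one_mem, hf.map_one.symm⟩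
  mul_mem' := fun {d e} hd he => ⟨P.mul_mem hd.1 he.1, by
    change (d.2 : G) * e.2 = f (d.1 * e.1)
    rw [hf.map_mul hd.1 he.1, hd.2, he.2]⟩
  inv_mem' := fun {d} hd => ⟨P.inv_mem hd.1, by
    change (d.2 : G)⁻¹ = f (d.1 : G)⁻¹
    rw [hf.map_inv hd.1, hd.2]⟩

theorem IsGraph.conj (h : F.IsGraph D) (a : T × T) :
    F.IsGraph (D.map (MulAut.conj a).toMonoidHom) := by
  obtain ⟨P, f, hf, h⟩ := h
  obtain ⟨Q, hQ⟩ := F.isIso_conj hf.le a.1.2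
  obtain ⟨k, hk, hkf, -⟩ := hQ.symm
  refine ⟨Q, fun x => a.2 * f (k x) * a.2⁻¹, (hk.1.comp hf fun x hx => hk.mem hx).comp
    (F.isMap_conj le_rfl a.2.2) fun x hx => hf.mem (hk.mem hx), fun d => ?_⟩
  constructor
  · rintro ⟨d, hd, rfl⟩
    have hd' := (h d).1 hd
    refine ⟨hQ.mem hd'.1, ?_⟩
    have h1 := hkf _ hd'.1
    change (a.2 : G) * d.2 * (a.2 : G)⁻¹ = a.2 * f (k (a.1 * d.1 * (a.1 : G)⁻¹)) * (a.2 : G)⁻¹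
    rw [h1, hd'.2]
  · rintro ⟨h1, h2⟩
    obtain ⟨x, hx, hxd⟩ := (hQ.2 _).1 h1
    rw [← hxd] at h2
    dsimp only at h2
    rw [hkf x hx] at h2
    refine ⟨(⟨x, hf.le hx⟩, ⟨f x, hf.mem hx⟩), (h _).2 ⟨hx, rfl⟩, ?_⟩
    exact Prod.ext (Subtype.ext hxd) (Subtype.ext h2.symm)

theorem IsGraph.card_map_snd (h : F.IsGraph D) :
    Nat.card (D.map (MonoidHom.snd T T)) = Nat.card D := by
  obtain ⟨P, f, hf, h⟩ := h
  refine (Nat.card_congr (Equiv.ofBijective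
    (fun d : D => (⟨d.1.2, d.1, d.2, rfl⟩ : D.map (MonoidHom.snd T T))) ⟨?_, ?_⟩)).symm
  · rintro ⟨d, hd⟩ ⟨e, he⟩ hde
    have h1 : d.2 = e.2 := congrArg Subtype.val hde
    have hd := (h d).1 hd
    have he := (h e).1 he
    refine Subtype.ext (Prod.ext (Subtype.ext (hf.inj hd.1 he.1 ?_)) h1)
    rw [← hd.2, ← he.2, h1]
  · rintro ⟨_, d, hd, rfl⟩
    exact ⟨⟨d, hd⟩, rfl⟩

theorem hasGraphStabilizers_quotient (h : F.IsGraph D) :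
    F.HasGraphStabilizers ((T × T) ⧸ D) := by
  intro x
  obtain ⟨a, rfl⟩ := QuotientGroup.mk_surjective x
  refine (h.conj a).of_le fun d hd => ?_
  have h1 : ((d * a : T × T) : (T × T) ⧸ D) = a := hd
  rw [eq_comm, QuotientGroup.eq] at h1
  exact ⟨_, h1, by simp [mul_assoc]⟩

theorem HasGraphStabilizers.sum {Ω Ω' : Type*} [MulAction (T × T) Ω] [MulAction (T × T) Ω']
    (h : F.HasGraphStabilizers Ω) (h' : F.HasGraphStabilizers Ω') :
    F.HasGraphStabilizers (Ω ⊕ Ω') := by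
  rintro (x | x)
  · refine (h x).of_le fun d hd => ?_
    exact Sum.inl_injective hd
  · refine (h' x).of_le fun d hd => ?_
    exact Sum.inr_injective hd

/-- Among the graphs with a given second projection there is one with respect to which the
numbers of fixed points of the others are congruent. -/
theorem Saturated.exists_graph_modEq [Finite G] [Fact p.Prime] (hT : IsPGroup p T)
    (hF : F.Saturated p) {Ω : Type*} [Finite Ω] [MulAction (T × T) Ω] {n : ℕ}
    (hΩ : F.HasGraphStabilizers Ω) (hs : F.StableAbove Ω n) (Q : Subgroup T)
    (hQn : Nat.card Q = n) :
    ∃ K : Subgroup (T × T), ∀ D : Subgroup (T × T), F.IsGraph D →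
      D.map (MonoidHom.snd T T) = Q →
      Nat.card (Subgroup.normalizer (D : Set (T × T))) ∣
        Nat.card (Subgroup.normalizer (K : Set (T × T))) ∧
      n * (fixedSet D Ω).ncard ≡ n * (fixedSet K Ω).ncard
        [MOD Nat.card (Subgroup.normalizer (D : Set (T × T)))] := by
  have hQT : Q.map T.subtype ≤ T := by
    rintro _ ⟨x, -, rfl⟩
    exact x.2
  have hQmem : ∀ x : T, (x : G) ∈ Q.map T.subtype ↔ x ∈ Q := fun x =>
    ⟨fun ⟨y, hy, hyx⟩ => Subtype.ext hyx ▸ hy, fun hx => ⟨x, hx, rfl⟩⟩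
  obtain ⟨R, hQR, hR⟩ := F.exists_fullyNormalized hQT
  obtain ⟨r, hr, hrN⟩ := hF.exists_map_normalizer hT hQT hQR hR
  have hRc := hF.fullyCentralized R hr.le' hR
  obtain ⟨r', hr', hrr', hr'r⟩ := hr.symm
  -- The reference graph is that of `r⁻¹ : R → Q` with `R` fully normalized, so that the extension
  -- axiom applies to maps into `R`.
  refine ⟨hr'.1.graph, ?_⟩
  rintro D hDg rfl
  have hDn : Nat.card D = n := hDg.card_map_snd.symm.trans hQn
  obtain ⟨P, f, hf, hfD⟩ := hDg
  have hfi : F.IsIso P ((D.map (MonoidHom.snd T T)).map T.subtype) f := by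
    refine ⟨hf, fun y => ⟨?_, ?_⟩⟩
    · rintro ⟨_, ⟨d, hd, rfl⟩, rfl⟩
      exact ⟨d.1, ((hfD d).1 hd).1, ((hfD d).1 hd).2.symm⟩
    · rintro ⟨x, hx, rfl⟩
      exact ⟨⟨f x, hf.mem hx⟩, ⟨(⟨x, hf.le hx⟩, ⟨f x, hf.mem hx⟩), (hfD _).2 ⟨hx, rfl⟩, rfl⟩, rfl⟩
  set E := Subgroup.normalizer (D : Set (T × T)) with hE
  have hEmem : ∀ d ∈ E, (d.1 : G) ∈ Subgroup.normalizer (P : Set G) ∧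
      (∀ x ∈ P, f (d.1 * x * (d.1 : G)⁻¹) = d.2 * f x * (d.2 : G)⁻¹) := by
    intro d hd
    have h1 : ∀ x ∈ P, (d.1 : G) * x * (d.1 : G)⁻¹ ∈ P ∧
        (d.2 : G) * f x * (d.2 : G)⁻¹ = f (d.1 * x * (d.1 : G)⁻¹) := by
      intro x hx
      have := (Subgroup.mem_normalizer_iff.1 hd (⟨x, hf.le hx⟩, ⟨f x, hf.mem hx⟩)).1
        ((hfD _).2 ⟨hx, rfl⟩)
      exact (hfD _).1 this
    exact ⟨Subgroup.mem_normalizer_fintype fun x hx => (h1 x hx).1, fun x hx => (h1 x hx).2.symm⟩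
  let K := (E.map (MonoidHom.fst T T)).map T.subtype
  have hPK : P ≤ K := fun x hx => ⟨_, ⟨(⟨x, hf.le hx⟩, ⟨f x, hf.mem hx⟩),
    Subgroup.le_normalizer ((hfD _).2 ⟨hx, rfl⟩), rfl⟩, rfl⟩
  have hKT : K ≤ T := by
    rintro _ ⟨x, -, rfl⟩
    exact x.2
  obtain ⟨k, hk, hkf⟩ := hF.exists_extension (hfi.comp hr) hRc hPK hKT (by
    rintro _ ⟨_, ⟨d, hd, rfl⟩, rfl⟩
    obtain ⟨h1, h2⟩ := hEmem d hd
    have hd2 : (d.2 : G) ∈ T ⊓ Subgroup.normalizer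
        (((D.map (MonoidHom.snd T T)).map T.subtype : Subgroup G) : Set G) := by
      refine Subgroup.mem_inf.2 ⟨d.2.2, Subgroup.mem_normalizer_fintype fun y hy => ?_⟩
      obtain ⟨x, hx, rfl⟩ := (hfi.2 y).1 hy
      rw [← h2 x hx]
      exact hfi.mem ((Subgroup.mem_normalizer_iff.1 h1 x).1 hx)
    refine ⟨h1, r d.2, hrN.mem hd2, fun x hx => ?_⟩
    rw [← hrN.map_conj hd2 ((le_inf hQT Subgroup.le_normalizer :
      _ ≤ T ⊓ Subgroup.normalizer _) (hfi.mem hx)), ← h2 x hx]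
    rfl)
  have hEK : ∀ d ∈ E, (d.1 : G) ∈ K := fun d hd => ⟨_, ⟨d, hd, rfl⟩, rfl⟩
  -- With `k` extending `r ∘ f` to the first projection of `E = N(D)`, the map `(a, b) ↦ (k a, b)`
  -- embeds `E` and carries `D` onto the reference graph. Subgroups of `E` strictly above `D` and
  -- their images have equally many fixed points by stability.
  let χ : E →* T × T := hk.twist.comp (Subgroup.inclusion fun d hd =>
    ⟨hEK d hd, Subgroup.mem_top _⟩)
  have hχ1 : ∀ d : E, ((χ d).1 : G) = k d.1.1 := fun d => rfl
  have hχ2 : ∀ d : E, (χ d).2 = d.1.2 := fun d => rfl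
  have hχi : Function.Injective χ := by
    intro d e hde
    refine Subtype.ext (Prod.ext (Subtype.ext (hk.inj (hEK d d.2) (hEK e e.2) ?_)) ?_)
    · rw [← hχ1, ← hχ1, hde]
    · rw [← hχ2, ← hχ2, hde]
  have hDmap : (D.subgroupOf E).map χ = hr'.1.graph := by
    ext e
    constructor
    · rintro ⟨d, hd, rfl⟩
      obtain ⟨h1, h2⟩ := (hfD d).1 hd
      change ((χ d).1 : G) ∈ R ∧ ((χ d).2 : G) = r' (χ d).1
      rw [hχ1, hχ2, hkf _ h1, hrr' _ (hfi.mem h1)]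
      exact ⟨hr.mem (hfi.mem h1), h2⟩
    · rintro ⟨h1, h2⟩
      obtain ⟨x, hx, hxe⟩ := ((hfi.comp hr).2 _).1 h1
      dsimp only at hxe
      rw [← hxe, hrr' _ (hfi.mem hx)] at h2
      have hd : ((⟨x, hf.le hx⟩, ⟨f x, hf.mem hx⟩) : T × T) ∈ D := (hfD _).2 ⟨hx, rfl⟩
      refine ⟨⟨_, Subgroup.le_normalizer hd⟩, hd, Prod.ext (Subtype.ext ?_) (Subtype.ext h2.symm)⟩
      rw [hχ1, hkf x hx, hxe]
  have hnorm : (D.subgroupOf E).Normal := Subgroup.normal_in_normalizer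
  constructor
  · have h1 : χ.range ≤ Subgroup.normalizer (hr'.1.graph : Set (T × T)) := by
      rintro _ ⟨e, rfl⟩
      refine Subgroup.mem_normalizer_fintype fun y hy => ?_
      have hy : y ∈ hr'.1.graph := hy
      rw [← hDmap] at hy
      obtain ⟨d, hd, rfl⟩ := hy
      change _ ∈ hr'.1.graph
      rw [← hDmap]
      exact ⟨e * d * e⁻¹, hnorm.conj_mem d hd e, by simp⟩
    have h2 := Subgroup.card_dvd_of_le h1
    rwa [← Nat.card_congr (MonoidHom.ofInjective hχi).toEquiv] at h2
  · have h := card_mul_ncard_fixed_modEq (E := E) (X := Ω)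
      ((MulAction.toPermHom (T × T) Ω).comp E.subtype)
      ((MulAction.toPermHom (T × T) Ω).comp χ) (D.subgroupOf E) ?_
    · have h1 : Nat.card (D.subgroupOf E) = n := by
        rw [← hDn]
        exact Nat.card_congr (Subgroup.subgroupOfEquivOfLe Subgroup.le_normalizer).toEquiv
      rw [h1] at h
      convert h using 3
      · ext ω
        exact ⟨fun h d hd => h d hd, fun h d hd => h ⟨d, Subgroup.le_normalizer hd⟩ hd⟩
      · rw [← hDmap]
        ext ω
        constructor
        · intro h d hd
          exact h _ ⟨d, hd, rfl⟩
        · rintro h _ ⟨d, hd, rfl⟩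
          exact h d hd
    · intro Z hZ
      have h1 := hs.ncard_twist hΩ hk (D := Z.map E.subtype) (D' := Z.map χ) ?_ ?_ ?_
      · convert h1 using 2
        · ext ω
          constructor
          · rintro h _ ⟨d, hd, rfl⟩
            exact h d hd
          · intro h d hd
            exact h _ ⟨d, hd, rfl⟩
        · ext ω
          constructor
          · rintro h _ ⟨d, hd, rfl⟩
            exact h d hd
          · intro h d hd
            exact h _ ⟨d, hd, rfl⟩
      · rintro _ ⟨d, -, rfl⟩
        exact hEK d d.2
      · intro e
        constructor
        · rintro ⟨d, hd, rfl⟩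
          exact ⟨d, ⟨d, hd, rfl⟩, hχ1 d, hχ2 d⟩
        · rintro ⟨_, ⟨d, hd, rfl⟩, h1, h2⟩
          exact ⟨d, hd, Prod.ext (Subtype.ext h1.symm) h2.symm⟩
      · have h2 : Nat.card (Z.map E.subtype) = Nat.card Z :=
          (Nat.card_congr (Z.equivMapOfInjective _ Subtype.val_injective).toEquiv).symm
        have h3 : Nat.card (D.subgroupOf E) = Nat.card D :=
          Nat.card_congr (Subgroup.subgroupOfEquivOfLe Subgroup.le_normalizer).toEquiv
        rw [h2, ← hDn, ← h3]
        exact Subgroup.card_lt_of_lt hZ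

end FusionSystem

/-! ### Construction of a stable set -/

namespace FusionSystem

universe u

variable {G : Type u} [Group G] {T N : Subgroup G} {p : ℕ}
variable {F : FusionSystem T} {P Q R K : Subgroup G} {f g : G → G}
variable {D D' : Subgroup (T × T)}

/-- A `T × T`-set with graph stabilizers that is stable above `n` and whose number of right orbits
is prime to `p`. -/
structure IsAdmissible (F : FusionSystem T) (p n : ℕ) (Ω : Type*) [MulAction (T × T) Ω] : Prop where
  stabilizers : F.HasGraphStabilizers Ω
  stable : F.StableAbove Ω n
  card : ¬ p * Nat.card T ∣ Nat.card Ω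

theorem map_snd_conj (D : Subgroup (T × T)) (a : T × T) :
    (D.map (MulAut.conj a).toMonoidHom).map (MonoidHom.snd T T) =
      (D.map (MonoidHom.snd T T)).map (MulAut.conj a.2).toMonoidHom := by
  rw [Subgroup.map_map, Subgroup.map_map]
  rfl

/-- The fixed point counts at level `n` can only be increased, so a common upper bound `M` is needed
that depends on the conjugacy class of the second projection alone and is congruent to the present
counts. -/
theorem Saturated.exists_target [Finite G] [Fact p.Prime] (hT : IsPGroup p T)
    (hF : F.Saturated p) {Ω : Type*} [Finite Ω] [MulAction (T × T) Ω] {n : ℕ}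
    (hΩ : F.HasGraphStabilizers Ω) (hs : F.StableAbove Ω n) :
    ∃ M : Subgroup T → ℕ, (∀ (Q : Subgroup T) (b : T),
        M (Q.map (MulAut.conj b).toMonoidHom) = M Q) ∧
      ∀ D : Subgroup (T × T), F.IsGraph D → Nat.card D = n →
        (fixedSet D Ω).ncard ≤ M (D.map (MonoidHom.snd T T)) ∧
        n * (fixedSet D Ω).ncard ≡ n * M (D.map (MonoidHom.snd T T))
          [MOD Nat.card (Subgroup.normalizer (D : Set (T × T)))] := by
  have hK : ∀ Q : Subgroup T, ∃ K : Subgroup (T × T), Nat.card Q = n →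
      ∀ D : Subgroup (T × T), F.IsGraph D → D.map (MonoidHom.snd T T) = Q →
      Nat.card (Subgroup.normalizer (D : Set (T × T))) ∣
        Nat.card (Subgroup.normalizer (K : Set (T × T))) ∧
      n * (fixedSet D Ω).ncard ≡ n * (fixedSet K Ω).ncard
        [MOD Nat.card (Subgroup.normalizer (D : Set (T × T)))] := by
    intro Q
    by_cases h : Nat.card Q = n
    · obtain ⟨K, hK⟩ := hF.exists_graph_modEq hT hΩ hs Q h
      exact ⟨K, fun _ => hK⟩
    · exact ⟨⊥, fun h' => absurd h' h⟩
  choose K hK using hK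
  have hmap : ∀ (Q : Subgroup T) (b c : T), (Q.map (MulAut.conj b).toMonoidHom).map
      (MulAut.conj c).toMonoidHom = Q.map (MulAut.conj (c * b)).toMonoidHom := by
    intro Q b c
    rw [Subgroup.map_map, map_mul]
    rfl
  have hone : ∀ Q : Subgroup T, Q.map (MulAut.conj (1 : T)).toMonoidHom = Q := by
    intro Q
    rw [map_one]
    exact Subgroup.map_id Q
  let s : Setoid (Subgroup T) :=
    { r := fun Q Q' => ∃ b : T, Q.map (MulAut.conj b).toMonoidHom = Q'
      iseqv := ⟨fun Q => ⟨1, hone Q⟩,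
        fun {Q Q'} ⟨b, hb⟩ => ⟨b⁻¹, by rw [← hb, hmap, inv_mul_cancel, hone]⟩,
        fun {Q Q' Q''} ⟨b, hb⟩ ⟨c, hc⟩ => ⟨c * b, by rw [← hc, ← hb, hmap]⟩⟩ }
  -- A representative of the class of `Q` secures invariance. The summand `|Ω| * |N(K)|` makes the
  -- value large enough and keeps the congruences, as `|N(D)|` divides `|N(K)|`.
  refine ⟨fun Q => (fixedSet (K (Quotient.mk s Q).out) Ω).ncard +
    Nat.card Ω * Nat.card (Subgroup.normalizer (K (Quotient.mk s Q).out : Set (T × T))), ?_, ?_⟩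
  · intro Q b
    have : Quotient.mk s (Q.map (MulAut.conj b).toMonoidHom) = Quotient.mk s Q :=
      (Quotient.sound (show s.r _ _ from ⟨b, rfl⟩)).symm
    dsimp only
    rw [this]
  · intro D hD hDn
    obtain ⟨b, hb⟩ : s.r (D.map (MonoidHom.snd T T))
      (Quotient.mk s (D.map (MonoidHom.snd T T))).out := Quotient.exact (Quotient.out_eq _).symm
    set Q := (Quotient.mk s (D.map (MonoidHom.snd T T))).out with hQ
    have hD' := hD.conj (1, b)
    have hQD : (D.map (MulAut.conj ((1, b) : T × T)).toMonoidHom).map (MonoidHom.snd T T) = Q := by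
      rw [map_snd_conj]
      exact hb
    have hQn : Nat.card Q = n := by
      rw [← hQD, hD'.card_map_snd, card_conj, hDn]
    obtain ⟨h1, h2⟩ := hK Q hQn _ hD' hQD
    rw [card_normalizer_conj] at h1 h2
    rw [ncard_fixedSet_conj] at h2
    constructor
    · have h3 : (fixedSet D Ω).ncard ≤ Nat.card Ω := by
        rw [← Set.ncard_univ]
        exact Set.ncard_le_ncard (Set.subset_univ _)
      have h4 : 0 < Nat.card (Subgroup.normalizer (K Q : Set (T × T))) := Nat.card_pos
      nlinarith
    · refine h2.trans ?_
      dsimp only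
      rw [mul_add]
      refine (Nat.ModEq.add_left _ (Nat.modEq_zero_iff_dvd.2 ?_)).symm
      exact Dvd.dvd.mul_left (Dvd.dvd.mul_left h1 _) _

/-- Subgroups of order above `n = |D|` have no fixed points on the new orbit, and its size `|T| *
(|T| / n)` is divisible by `p * |T|` since `n < |T|`. -/
theorem IsAdmissible.sum_quotient [Finite G] [Fact p.Prime] (hT : IsPGroup p T) {Ω : Type*}
    [Finite Ω] [MulAction (T × T) Ω] {n : ℕ} (h : F.IsAdmissible p n Ω) (hD : F.IsGraph D)
    (hDn : Nat.card D = n) (hn : n < Nat.card T) : F.IsAdmissible p n (Ω ⊕ (T × T) ⧸ D) where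
  stabilizers := h.stabilizers.sum (hasGraphStabilizers_quotient hD)
  stable := by
    have key : ∀ E : Subgroup (T × T), n < Nat.card E → (fixedSet E ((T × T) ⧸ D)).ncard = 0 := by
      intro E hE
      rw [Set.ncard_eq_zero, Set.eq_empty_iff_forall_notMem]
      intro x hx
      obtain ⟨a, rfl⟩ := exists_conj_of_fixedSet_quotient (hDn.le.trans hE.le) ⟨x, hx⟩
      rw [card_conj, hDn] at hE
      exact lt_irrefl _ hE
    intro E E' hE hE' hn hEE'
    have hc : Nat.card E = Nat.card E' := by
      rw [← hE.card_map_snd, ← hE'.card_map_snd, hEE']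
    rw [ncard_fixedSet_sum, ncard_fixedSet_sum, key E hn, key E' (hc ▸ hn),
      h.stable E E' hE hE' hn hEE']
  card := by
    have h1 : Nat.card ((T × T) ⧸ D) * n = Nat.card T * Nat.card T := by
      rw [← Nat.card_prod, Subgroup.card_eq_card_quotient_mul_card_subgroup D, hDn]
    have h2 : n ∣ Nat.card T := by
      rw [← hDn, ← hD.card_map_snd]
      exact Subgroup.card_subgroup_dvd_card _
    obtain ⟨j, hj⟩ := h2
    have hn0 : 0 < n := hDn ▸ Nat.card_pos
    obtain ⟨k, hk⟩ := IsPGroup.iff_card.1 hT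
    have hpj : p ∣ j := by
      have h3 : j ∣ p ^ k := hk ▸ hj ▸ dvd_mul_left _ _
      obtain ⟨i, -, rfl⟩ := (Nat.dvd_prime_pow Fact.out).1 h3
      refine dvd_pow_self p ?_
      rintro rfl
      rw [hj] at hn
      simp at hn
    have h4 : Nat.card ((T × T) ⧸ D) = Nat.card T * j := by
      refine Nat.eq_of_mul_eq_mul_right hn0 ?_
      rw [h1, mul_assoc, mul_comm j n, ← hj]
    intro h5
    rw [Nat.card_sum, h4] at h5
    refine h.card ((Nat.dvd_add_left ?_).1 h5)
    rw [mul_comm]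
    exact mul_dvd_mul_left _ hpj

/-- A copy of `(T × T)/D` raises the count at `D` and its conjugates by `|N(D)| / n` and changes no
other graph of order `n`. By the congruence the deficit is a multiple of this increment, so the
target is never overshot; `m` is the total deficit. -/
theorem IsAdmissible.exists_eq_target [Finite G] [Fact p.Prime] (hT : IsPGroup p T) {n : ℕ}
    (hn : n < Nat.card T) {M : Subgroup T → ℕ}
    (hM : ∀ (Q : Subgroup T) (b : T), M (Q.map (MulAut.conj b).toMonoidHom) = M Q) (m : ℕ) :
    ∀ (Ω : Type u) [Finite Ω] [MulAction (T × T) Ω], F.IsAdmissible p n Ω →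
      (∀ D : Subgroup (T × T), F.IsGraph D → Nat.card D = n →
        (fixedSet D Ω).ncard ≤ M (D.map (MonoidHom.snd T T)) ∧
        n * (fixedSet D Ω).ncard ≡ n * M (D.map (MonoidHom.snd T T))
          [MOD Nat.card (Subgroup.normalizer (D : Set (T × T)))]) →
      ∑ᶠ D : Subgroup (T × T), (M (D.map (MonoidHom.snd T T)) - (fixedSet D Ω).ncard) = m →
      ∃ (Ω' : Type u) (_ : Finite Ω') (_ : MulAction (T × T) Ω'), F.IsAdmissible p n Ω' ∧
        ∀ D : Subgroup (T × T), F.IsGraph D → Nat.card D = n →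
          (fixedSet D Ω').ncard = M (D.map (MonoidHom.snd T T)) := by
  classical
  have := Fintype.ofFinite (Subgroup (T × T))
  induction m using Nat.strong_induction_on with
  | _ m ih =>
    intro Ω _ _ hΩ hle hm
    by_cases hall : ∀ D : Subgroup (T × T), F.IsGraph D → Nat.card D = n →
          (fixedSet D Ω).ncard = M (D.map (MonoidHom.snd T T))
    · exact ⟨Ω, inferInstance, inferInstance, hΩ, hall⟩
    · push Not at hall
      obtain ⟨D, hD, hDn, hne⟩ := hall
      have hn0 : 0 < n := hDn ▸ Nat.card_pos
      have hlt := lt_of_le_of_ne (hle D hD hDn).1 hne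
      have hβ : n * (fixedSet D ((T × T) ⧸ D)).ncard =
          Nat.card (Subgroup.normalizer (D : Set (T × T))) := by
        rw [← ncard_fixedSet_quotient, hDn, mul_comm]
      have hβ0 : 0 < (fixedSet D ((T × T) ⧸ D)).ncard := by
        rcases Nat.eq_zero_or_pos (fixedSet D ((T × T) ⧸ D)).ncard with h0 | h0
        · rw [h0, mul_zero] at hβ
          exact absurd hβ.symm Nat.card_pos.ne'
        · exact h0
      have hdvd : n * (fixedSet D ((T × T) ⧸ D)).ncard ∣
          n * (M (D.map (MonoidHom.snd T T)) - (fixedSet D Ω).ncard) := by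
        rw [hβ, Nat.mul_sub]
        exact (Nat.modEq_iff_dvd' (Nat.mul_le_mul_left _ hlt.le)).1 (hle D hD hDn).2
      have hβle : (fixedSet D Ω).ncard + (fixedSet D ((T × T) ⧸ D)).ncard ≤
          M (D.map (MonoidHom.snd T T)) := by
        have h1 := Nat.le_of_dvd (Nat.sub_pos_of_lt hlt) (Nat.dvd_of_mul_dvd_mul_left hn0 hdvd)
        omega
      refine ih _ ?_ (Ω ⊕ (T × T) ⧸ D) (hΩ.sum_quotient hT hD hDn hn) ?_ rfl
      · rw [← hm, finsum_eq_sum_of_fintype, finsum_eq_sum_of_fintype]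
        refine Finset.sum_lt_sum (fun E _ => ?_) ⟨D, Finset.mem_univ _, ?_⟩
        · rw [ncard_fixedSet_sum]
          omega
        · rw [ncard_fixedSet_sum]
          omega
      · intro E hE hEn
        rw [ncard_fixedSet_sum]
        rcases Set.eq_empty_or_nonempty (fixedSet E ((T × T) ⧸ D)) with h0 | h0
        · rw [h0, Set.ncard_empty, add_zero]
          exact hle E hE hEn
        · obtain ⟨a, rfl⟩ := exists_conj_of_fixedSet_quotient (hDn.trans hEn.symm).le h0
          rw [ncard_fixedSet_conj, ncard_fixedSet_conj, card_normalizer_conj, map_snd_conj, hM]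
          refine ⟨hβle, ?_⟩
          rw [mul_add, hβ]
          have := (hle D hD hDn).2.add_right (Nat.card (Subgroup.normalizer (D : Set (T × T))))
          refine ((Nat.ModEq.add_left _ ?_).trans (by rw [add_zero])).trans (hle D hD hDn).2
          exact Nat.modEq_zero_iff_dvd.2 dvd_rfl

/-- The set is a disjoint union of copies of `T` twisted by representatives of `Aut_F(T) /
Aut_T(T)`. The number of copies is prime to `p` because `Aut_T(T)` is a Sylow subgroup. -/
theorem Saturated.exists_isAdmissible_top [Finite G] [Fact p.Prime] (hF : F.Saturated p) :
    ∃ (Ω : Type u) (_ : Finite Ω) (_ : MulAction (T × T) Ω),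
      F.IsAdmissible p (Nat.card T - 1) Ω := by
  let A := F.aut T le_rfl
  obtain ⟨S, hS⟩ := hF.sylow T le_rfl F.fullyNormalized_top
  let I := A ⧸ (S : Subgroup A)
  let act : MulAction (T × T) (I × T) :=
    { smul := fun d x => (x.1, x.1.out.1 d.1 * x.2 * d.2⁻¹)
      one_smul := fun x => Prod.ext rfl (by change x.1.out.1 1 * x.2 * 1⁻¹ = x.2; simp)
      mul_smul := fun d e x => Prod.ext rfl (by
        change x.1.out.1 (d.1 * e.1) * x.2 * (d.2 * e.2)⁻¹ =
          x.1.out.1 d.1 * (x.1.out.1 e.1 * x.2 * e.2⁻¹) * d.2⁻¹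
        simp [mul_assoc]) }
  have hsmul : ∀ (d : T × T) (x : I × T), d • x = x ↔ d.2 = x.2⁻¹ * x.1.out.1 d.1 * x.2 := by
    intro d x
    have : d • x = (x.1, x.1.out.1 d.1 * x.2 * d.2⁻¹) := rfl
    rw [this, Prod.ext_iff]
    simp only [true_and]
    rw [mul_inv_eq_iff_eq_mul, mul_assoc, eq_inv_mul_iff_mul_eq, eq_comm]
  refine ⟨I × T, inferInstance, act, ?_, ?_, ?_⟩
  · rintro ⟨c, t⟩
    obtain ⟨k, hk, hck⟩ := exists_isIso_of_mem_aut c.out.2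
    refine ⟨T, fun x => (t : G)⁻¹ * k x * (t : G)⁻¹⁻¹, hk.1.comp
      (F.isMap_conj le_rfl (T.inv_mem t.2)) fun x hx => hk.mem hx, fun d => ?_⟩
    rw [MulAction.mem_stabilizer_iff, hsmul, Subtype.ext_iff]
    simp [hck]
  -- Such a `D` has order `|T|` and is the graph of an automorphism `e`. Its fixed points lie in the
  -- single copy indexed by the class of `e` and form a coset of the center.
  · have key : ∀ D : Subgroup (T × T), F.IsGraph D → Nat.card T - 1 < Nat.card D →
        (fixedSet D (I × T)).ncard = Nat.card (Subgroup.center T) := by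
      intro D hD hDn
      have hDc := hD.card_map_snd
      obtain ⟨P, f, hf, hfD⟩ := hD
      obtain ⟨P', hP'⟩ := hf.exists_isIso
      have hPT : P = T := by
        refine Subgroup.eq_of_le_of_card_ge hf.le ?_
        have h1 : Nat.card D ≤ Nat.card P := by
          refine Nat.card_le_card_of_injective
            (fun d : D => (⟨d.1.1, ((hfD _).1 d.2).1⟩ : P)) fun d e hde => ?_
          have h2 : d.1.1 = e.1.1 := Subtype.ext (congrArg (fun z : P => (z : G)) hde)
          refine Subtype.ext (Prod.ext h2 (Subtype.ext ?_))
          rw [((hfD _).1 d.2).2, ((hfD _).1 e.2).2, h2]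
        omega
      subst hPT
      have hP'T : P' = P := by
        refine Subgroup.eq_of_le_of_card_ge hP'.le' ?_
        exact Subgroup.card_le_of_injOn f (fun x hx => hP'.mem hx) fun x hx y hy => hf.inj hx hy
      subst hP'T
      obtain ⟨e, he, hef⟩ := hP'.exists_mulEquiv
      let β : A := ⟨e, he⟩
      have hfix : ∀ x : I × P', x ∈ fixedSet D (I × P') ↔
          ∀ a : P', x.1.out.1 a = x.2 * e a * x.2⁻¹ := by
        intro x
        constructor
        · intro hx a
          have h1 := hx (a, e a) ((hfD _).2 ⟨a.2, hef a⟩)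
          rw [hsmul] at h1
          dsimp only at h1
          rw [h1]
          group
        · intro hx d hd
          have h1 : d.2 = e d.1 := Subtype.ext (by rw [hef]; exact ((hfD d).1 hd).2)
          rw [hsmul, h1, hx]
          group
      let c : I := QuotientGroup.mk β
      have hc : (β⁻¹ * c.out) ∈ (S : Subgroup A) :=
        QuotientGroup.eq.1 (QuotientGroup.out_eq' c).symm
      have hc' : ∃ t : P', ∀ a : P', c.out.1 a = t * e a * t⁻¹ := by
        obtain ⟨s, hs, hsc⟩ := (SetLike.ext_iff.1 hS _).1 hc
        refine ⟨e ⟨s, hs⟩, fun a => ?_⟩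
        have h1 : (β.1⁻¹ (c.out.1 a) : P') = ⟨s, hs⟩ * a * ⟨s, hs⟩⁻¹ := Subtype.ext (hsc a)
        have h2 : c.out.1 a = β.1 (β.1⁻¹ (c.out.1 a)) := by simp
        rw [h2, h1]
        change e _ = _
        simp
      obtain ⟨t, ht⟩ := hc'
      have hrange : fixedSet D (I × P') =
          Set.range (fun z : Subgroup.center P' => (c, t * (z : P'))) := by
        ext ⟨c', t'⟩
        rw [hfix]
        constructor
        · intro h
          have hcc : c' = c := by
            rw [← QuotientGroup.out_eq' c', eq_comm]
            refine QuotientGroup.eq.2 ?_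
            refine (SetLike.ext_iff.1 hS _).2 ⟨e.symm t', (e.symm t').2, fun a => ?_⟩
            have h1 : β.1⁻¹ (c'.out.1 a) = e.symm t' * a * (e.symm t')⁻¹ := by
              rw [h a]
              change e.symm _ = _
              simp
            exact congrArg Subtype.val h1
          subst hcc
          refine ⟨⟨t⁻¹ * t', Subgroup.mem_center_iff.2 fun a => ?_⟩, ?_⟩
          · have h1 := (ht (e.symm a)).symm.trans (h (e.symm a))
            simp only [MulEquiv.apply_symm_apply] at h1
            rw [mul_inv_eq_iff_eq_mul] at h1
            have h2 : a = t⁻¹ * (t' * a * t'⁻¹ * t) := by rw [← h1]; group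
            conv_lhs => rw [h2]
            group
          · simp
        · rintro ⟨z, hz⟩ a
          obtain ⟨rfl, rfl⟩ := Prod.ext_iff.1 hz
          have h1 := Subgroup.mem_center_iff.1 z.2 (e a)
          dsimp only
          rw [ht a, mul_inv_rev, mul_assoc t z, ← h1]
          group
      rw [hrange, ← Nat.card_coe_set_eq, Nat.card_range_of_injective]
      intro z w hzw
      exact Subtype.ext (mul_left_cancel (Prod.ext_iff.1 hzw).2)
    intro D D' hD hD' hn hDD'
    have hc : Nat.card D = Nat.card D' := by
      rw [← hD.card_map_snd, ← hD'.card_map_snd, hDD']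
    rw [key D hD hn, key D' hD' (hc ▸ hn)]
  · intro h
    rw [Nat.card_prod] at h
    have h1 : p ∣ Nat.card I := Nat.dvd_of_mul_dvd_mul_right Nat.card_pos h
    exact S.not_dvd_index h1

theorem Saturated.exists_isAdmissible [Finite G] [Fact p.Prime] (hT : IsPGroup p T)
    (hF : F.Saturated p) (n : ℕ) (hn : n < Nat.card T) :
    ∃ (Ω : Type u) (_ : Finite Ω) (_ : MulAction (T × T) Ω), F.IsAdmissible p n Ω := by
  refine Nat.decreasingInduction' (m := n) (n := Nat.card T - 1)
    (P := fun n => ∃ (Ω : Type u) (_ : Finite Ω) (_ : MulAction (T × T) Ω), F.IsAdmissible p n Ω)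
    ?_ (by omega) hF.exists_isAdmissible_top
  rintro k hk - ⟨Ω, _, _, hΩ⟩
  -- `Ω` is stable above `k + 1`; equalizing the graphs of order exactly `k + 1` makes it stable
  -- above `k`.
  obtain ⟨M, hM, hle⟩ := hF.exists_target hT hΩ.stabilizers hΩ.stable
  obtain ⟨Ω', _, _, hΩ', heq⟩ :=
    IsAdmissible.exists_eq_target hT (by omega) hM _ Ω hΩ hle rfl
  refine ⟨Ω', inferInstance, inferInstance, hΩ'.stabilizers, fun D D' hD hD' hkD hDD' => ?_, hΩ'.card⟩
  rcases Nat.lt_or_ge (k + 1) (Nat.card D) with h | h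
  · exact hΩ'.stable D D' hD hD' h hDD'
  · have hD1 : Nat.card D = k + 1 := by omega
    have hD2 : Nat.card D' = k + 1 := by
      rw [← hD1, ← hD.card_map_snd, ← hD'.card_map_snd, hDD']
    rw [heq D hD hD1, heq D' hD' hD2, hDD']

end FusionSystem

/-! ### Index `p` and induction on the order of `T` -/

namespace FusionSystem

universe u

variable {G : Type u} [Group G] {T N : Subgroup G} {p : ℕ} {F : FusionSystem T} {f : G → G}

/-- A homomorphism from `T` to an abelian group that is trivial on the hyperfocal subgroup is
preserved by the morphisms of the fusion system. -/
theorem Saturated.map_eq_of_hyperfocal [Finite G] [Fact p.Prime] (hT : IsPGroup p T)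
    (hF : F.Saturated p) {A : Type*} [AddCommGroup A] {δ : T → A}
    (hδ : ∀ a b, δ (a * b) = δ a + δ b)
    (hyp : ∀ a : T, (a : G) ∈ F.hyperfocal p → δ a = 0) {P : Subgroup G} (h : F.IsMap P f) :
    ∀ a b : T, (a : G) ∈ P → (b : G) = f a → δ b = δ a := by
  refine hF.induction hT
    (C := fun P f => ∀ a b : T, (a : G) ∈ P → (b : G) = f a → δ b = δ a) ?_ ?_ ?_ ?_ ?_ ?_ h
  · intro P f g h hfg a b ha hb
    exact h a b ha (hb.trans (hfg a ha).symm)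
  · intro P Q f _ h hQ a b ha
    exact h a b (hQ ha)
  · intro P Q R f g hf h hg h' a b ha hb
    have hfa := hf.mem ha
    exact (h' ⟨f a, hg.le hfa⟩ b hfa hb).trans (h a ⟨f a, hg.le hfa⟩ ha rfl)
  · intro P Q f g hf h _ _ hfg a b ha hb
    obtain ⟨x, hx, hxa⟩ := (hf.2 a).1 ha
    refine (h b a ?_ ?_).symm
    · rw [hb, ← hxa, ‹∀ x ∈ P, g (f x) = x› x hx]
      exact hx
    · rw [hb, hfg a ha]
  · intro s hs a b _ hb
    have h1 : b * ⟨s, hs⟩ = ⟨s, hs⟩ * a := Subtype.ext (by simp [hb])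
    have h2 := congrArg δ h1
    rw [hδ, hδ, add_comm] at h2
    exact add_left_cancel h2
  · intro P f k hf hk hfk a b ha hb
    have h1 := hyp (a⁻¹ * b) (by
      rw [Subgroup.coe_mul, Subgroup.coe_inv, hb]
      exact hyperfocal_mem hf hk hfk ha)
    have h2 := hδ a (a⁻¹ * b)
    rw [h1, mul_inv_cancel_left, add_zero] at h2
    exact h2

/-- Existence of the subsystem on a subgroup of index `p`. -/
theorem Saturated.exists_subsystem_of_index_eq [Finite G] [hp : Fact p.Prime] (hT : IsPGroup p T)
    (hF : F.Saturated p) (hNT : N ≤ T) (hN : ∀ t ∈ T, ∀ x ∈ N, t * x * t⁻¹ ∈ N)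
    (hyp : F.hyperfocal p ≤ N) (hNp : (N.subgroupOf T).index = p) :
    ∃ FN : FusionSystem N, FN.Saturated p ∧ FN.IsPPowerIndex F p := by
  have hnormal : (N.subgroupOf T).Normal := ⟨fun n hn t => hN t t.2 n hn⟩
  have hc : Nat.card (Multiplicative (ZMod p)) = p := Nat.card_zmod p
  let e : T ⧸ N.subgroupOf T ≃* Multiplicative (ZMod p) := mulEquivOfPrimeCardEq hNp hc
  let δ : T → ZMod p := fun a => Multiplicative.toAdd (e (QuotientGroup.mk a))
  have hδ : ∀ a b, δ (a * b) = δ a + δ b := fun a b => by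
    simp only [δ, QuotientGroup.mk_mul, map_mul, toAdd_mul]
  have hδN : ∀ a : T, δ a = 0 ↔ (a : G) ∈ N := fun a => by
    simp only [δ, toAdd_eq_zero, map_eq_one_iff e e.injective, QuotientGroup.eq_one_iff]
    rfl
  obtain ⟨Ω, _, _, hΩ⟩ := hF.exists_isAdmissible hT 0 Nat.card_pos
  obtain ⟨d⟩ := exists_degreeModel hT hΩ.stabilizers hΩ.stable hΩ.card hδ hδN fun P f h =>
    hF.map_eq_of_hyperfocal hT hδ (fun a ha => (hδN a).2 (hyp ha)) h
  have hcl : ∀ {P f}, F.IsMap P f → ∀ x ∈ P, (f x ∈ N ↔ x ∈ N) := hF.map_mem_iff hT hN hyp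
  refine ⟨d.subsystem hNT, d.saturated_subsystem hT hF (fun h => ?_) hcl,
    d.isPPowerIndex hyp hcl⟩
  rw [Subgroup.subgroupOf_eq_top.2 h, Subgroup.index_top] at hNp
  exact hp.out.one_lt.ne hNp

/-- A `p'`-automorphism in `F` of a subgroup of `N` lies in `H`, is a `p'`-automorphism there, and
therefore lies in `K`. -/
theorem IsPPowerIndex.trans [Finite G] [Fact p.Prime] {M : Subgroup G} {H : FusionSystem M}
    {K : FusionSystem N} (hH : H.IsPPowerIndex F p) (hK : K.IsPPowerIndex H p)
    (hyp : F.hyperfocal p ≤ N) : K.IsPPowerIndex F p := by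
  rw [isPPowerIndex_iff] at hH hK ⊢
  refine ⟨⟨hK.1.1.trans hH.1.1, fun P Q => (hK.1.2 P Q).trans (hH.1.2 P Q)⟩, hyp,
    fun P f k hP hf hk hfk => ?_⟩
  exact hK.2.2 P f k hP ⟨hH.2.2 P f k (hP.trans hK.1.1) hf hk hfk, hf.2⟩ hk hfk

theorem IsSubsystem.hyperfocal_le [Finite G] [Fact p.Prime] {H : FusionSystem N}
    (h : H.IsSubsystem F) : H.hyperfocal p ≤ F.hyperfocal p :=
  hyperfocal_le_of fun _ _ _ hf hk hfk _ hx => hyperfocal_mem (h.isIso hf) hk hfk hx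

theorem _root_.Subgroup.exists_normal_index_eq [hp : Fact p.Prime] {A : Type*} [Group A] [Finite A]
    (hA : IsPGroup p A) {B : Subgroup A} (hB : B ≠ ⊤) :
    ∃ C : Subgroup A, B ≤ C ∧ C.Normal ∧ C.index = p := by
  obtain ⟨n, hn⟩ := IsPGroup.iff_card.1 hA
  obtain ⟨m, hm⟩ := IsPGroup.iff_card.1 (hA.to_subgroup B)
  have hmn : m < n := by
    by_contra! h
    refine hB (Subgroup.eq_top_of_le_card B ?_)
    rw [hn, hm]
    exact Nat.pow_le_pow_right hp.out.pos h
  obtain ⟨C, hC, hBC⟩ := Sylow.exists_subgroup_card_pow_prime_le p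
    (hn ▸ Nat.pow_dvd_pow p (Nat.sub_le n 1)) B hm (show m ≤ n - 1 by omega)
  have hi : C.index = p := by
    have h1 := C.card_mul_index
    rw [hC, hn, ← Nat.sub_add_cancel (show 1 ≤ n by omega), Nat.add_sub_cancel, pow_succ] at h1
    exact Nat.eq_of_mul_eq_mul_left (pow_pos hp.out.pos _) h1
  refine ⟨C, hBC, Subgroup.normal_of_index_eq_minFac_card ?_, hi⟩
  rw [hi, hn, hp.out.pow_minFac (by omega)]

/-- Existence of the saturated subsystem of `p`-power index on `N`. -/
theorem Saturated.exists_subsystem [Finite G] [hp : Fact p.Prime] (hT : IsPGroup p T)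
    (hF : F.Saturated p) (hNT : N ≤ T) (hN : ∀ t ∈ T, ∀ x ∈ N, t * x * t⁻¹ ∈ N)
    (hyp : F.hyperfocal p ≤ N) : ∃ FN : FusionSystem N, FN.Saturated p ∧ FN.IsPPowerIndex F p := by
  induction hm : Nat.card T using Nat.strong_induction_on generalizing T with
  | _ m ih =>
    by_cases hTN : T ≤ N
    · obtain rfl := le_antisymm hNT hTN
      exact ⟨F, hF, isPPowerIndex_iff.2 ⟨⟨le_rfl, fun _ _ => subset_rfl⟩, hyp,
        fun _ _ _ _ hf _ _ => hf.1⟩⟩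
    -- Passing to a subgroup `M ≥ N` of index `p` gives a saturated system on a smaller group, whose
    -- hyperfocal subgroup is still contained in `N`.
    · obtain ⟨C, hNC, hC, hCp⟩ := Subgroup.exists_normal_index_eq hT
        (fun h => hTN (Subgroup.subgroupOf_eq_top.1 h))
      obtain ⟨M, hMT, rfl⟩ : ∃ M ≤ T, M.subgroupOf T = C :=
        ⟨C.map T.subtype, Subgroup.map_subtype_le C,
          Subgroup.comap_map_eq_self_of_injective Subtype.val_injective C⟩
      have hNM : N ≤ M := fun x hx => hNC (show (⟨x, hNT hx⟩ : T) ∈ N.subgroupOf T from hx)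
      obtain ⟨FM, hFM, hFMF⟩ := hF.exists_subsystem_of_index_eq hT hMT
        (fun t ht x hx => hC.conj_mem ⟨x, hMT hx⟩ hx ⟨t, ht⟩) (hyp.trans hNM) hCp
      have hlt : Nat.card M < m := by
        have h1 := (M.subgroupOf T).index_mul_card
        rw [Nat.card_congr (Subgroup.subgroupOfEquivOfLe hMT).toEquiv, hCp, hm] at h1
        rw [← h1]
        exact lt_mul_of_one_lt_left Nat.card_pos hp.out.one_lt
      obtain ⟨FN, hFN, hFNM⟩ := ih _ hlt (hT.to_le hMT) hFM hNM
        (fun t ht => hN t (hMT ht)) (hFMF.1.hyperfocal_le.trans hyp) rfl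
      exact ⟨FN, hFN, hFMF.trans hFNM hyp⟩

end FusionSystem

theorem mainTheorem11 {S : Type*} [Group S] [Finite S] (p : ℕ) [Fact p.Prime] (hS : IsPGroup p S)
    (F : FusionSystem (⊤ : Subgroup S)) (hF : F.Saturated p)
    (N : Subgroup S) (hN : N.Normal) (hyp : F.hyperfocal p ≤ N) :
    F.StronglyClosed N ∧
    ∃ FN : FusionSystem N,
      (FN.Saturated p ∧ FN.IsPPowerIndex F p) ∧
      (∀ H : FusionSystem N, H.Saturated p ∧ H.IsPPowerIndex F p → H = FN) ∧
      FN.IsInvariant F := by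
  have hT : IsPGroup p (⊤ : Subgroup S) := hS.to_subgroup ⊤
  have hconj : ∀ t ∈ (⊤ : Subgroup S), ∀ x ∈ N, t * x * t⁻¹ ∈ N := fun t _ x hx =>
    hN.conj_mem x hx t
  obtain ⟨FN, hFN, hFNF⟩ := hF.exists_subsystem hT le_top hconj hyp
  exact ⟨hF.stronglyClosed hT le_top hconj hyp, FN, ⟨hFN, hFNF⟩,
    fun H hH => FusionSystem.Saturated.unique (hS.to_subgroup N) hH.1 hH.2 hFN hFNF,
    hFNF.isInvariant hT hF hFN hconj⟩
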